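/- A graph (loops and multiple edges allowed) is called series-parallel if it can be constructed from a 2-cycle by a (possibly empty) sequence of series extensions (subdividing an edge) and parallel extensions (adding a new edge parallel to an existing one); by convention, a single edge joining two vertices and a single loop are also series-parallel graphs. A series-parallel matroid is the cycle matroid of a series-parallel graph. For $n,\ell\ge 0$ let $C_{n,\ell}$ be the number of series-parallel matroids of rank $\ell$ on the ground set $[n]=\{1,\dots,n\}$. Let $\left[\!\left[{m\atop k}\right]\!\right]$ be the unsigned associated Stirling number of the first kind, that is, the number of derangements (fixed-point-free permutations) of $[m]$ with exactly $k$ cycles (so $\left[\!\left[{0\atop 0}\right]\!\right]=1$), and let $\left\{{m\atop k}\right\}$ be the Stirling number of the second kind, the number of partitions of $[m]$ into $k$ nonempty parts. Then for all integers $n\ge 2$ and $\ell\ge 0$, $$C_{n,\ell}=\sum_{k=0}^{\ell-1}(-1)^{k+\ell-1}\left[\!\left[{k+\ell-1\atop k}\right]\!\right]\left\{{n-1+k\atop k+\ell}\right\}.$$ -/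

import Mathlib

open scoped Graph

namespace Graph

variable {α β : Type*}

/-- The edge set `C` is the edge set of a cycle of the multigraph `G`: there are distinct vertices
`v 0, …, v k` and distinct edges `e 0, …, e k`, with `e i` joining `v i` to the cyclically next
vertex, and `C = {e 0, …, e k}`. (Addition in `Fin (k + 1)` is cyclic, so `k = 0` gives a loop and
`k = 1` gives a pair of parallel edges.) -/
def IsCycleEdgeSet (G : Graph α β) (C : Set β) : Prop :=
  ∃ (k : ℕ) (v : Fin (k + 1) → α) (e : Fin (k + 1) → β),
    Function.Injective v ∧ Function.Injective e ∧
      (∀ i, G.IsLink (e i) (v i) (v (i + 1))) ∧ C = Set.range e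

/-- `M` is the matroid associated with `G` (its cycle matroid): the ground set of `M` is the edge
set of `G`, and the circuits of `M` are the edge sets of the cycles of `G`. A matroid is determined
by its ground set and its circuits, so there is at most one such `M`. -/
def IsCycleMatroid (G : Graph α β) (M : Matroid β) : Prop :=
  M.E = E(G) ∧ ∀ C : Set β, M.IsCircuit C ↔ G.IsCycleEdgeSet C

/-- `G` consists of two distinct vertices and a single edge joining them. -/
def IsSingleEdge (G : Graph α β) : Prop :=
  ∃ (x y : α) (e : β), x ≠ y ∧ V(G) = {x, y} ∧
    ∀ g a b, G.IsLink g a b ↔ g = e ∧ s(a, b) = s(x, y)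

/-- `G` consists of one vertex and a single loop. -/
def IsSingleLoop (G : Graph α β) : Prop :=
  ∃ (x : α) (e : β), V(G) = {x} ∧ ∀ g a b, G.IsLink g a b ↔ g = e ∧ s(a, b) = s(x, x)

/-- `G` is a 2-cycle: two distinct vertices and exactly two distinct edges, both joining them. -/
def IsTwoCycle (G : Graph α β) : Prop :=
  ∃ (x y : α) (e f : β), x ≠ y ∧ e ≠ f ∧ V(G) = {x, y} ∧
    ∀ g a b, G.IsLink g a b ↔ (g = e ∨ g = f) ∧ s(a, b) = s(x, y)

/-- `H` is obtained from `G` by subdividing an edge `e` with ends `x`, `y`: a new vertex `z` is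
added, `e` now joins `x` and `z`, and a new edge `f` joins `z` and `y`. -/
def IsSeriesExtension (G H : Graph α β) : Prop :=
  ∃ (e f : β) (x y z : α), G.IsLink e x y ∧ f ∉ E(G) ∧ z ∉ V(G) ∧ V(H) = insert z V(G) ∧
    ∀ g a b, H.IsLink g a b ↔
      (g ≠ e ∧ G.IsLink g a b) ∨ (g = e ∧ s(a, b) = s(x, z)) ∨ (g = f ∧ s(a, b) = s(z, y))

/-- `H` is obtained from `G` by adding a new edge `f` parallel to an edge `e` of `G`. -/
def IsParallelExtension (G H : Graph α β) : Prop :=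
  ∃ (e f : β) (x y : α), G.IsLink e x y ∧ f ∉ E(G) ∧ V(H) = V(G) ∧
    ∀ g a b, H.IsLink g a b ↔ G.IsLink g a b ∨ (g = f ∧ s(a, b) = s(x, y))

/-- `G` can be constructed from a 2-cycle by a (possibly empty) sequence of series and parallel
extensions. -/
inductive BuiltFromTwoCycle : Graph α β → Prop
  | twoCycle {G : Graph α β} (hG : G.IsTwoCycle) : BuiltFromTwoCycle G
  | series {G H : Graph α β} (hG : BuiltFromTwoCycle G) (h : G.IsSeriesExtension H) :
      BuiltFromTwoCycle H
  | parallel {G H : Graph α β} (hG : BuiltFromTwoCycle G) (h : G.IsParallelExtension H) :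
      BuiltFromTwoCycle H

/-- Series-parallel graphs: those constructed from a 2-cycle by series and parallel extensions
and, by convention, a single edge and a single loop. -/
def IsSeriesParallel (G : Graph α β) : Prop :=
  G.IsSingleEdge ∨ G.IsSingleLoop ∨ G.BuiltFromTwoCycle

end Graph

/-- A series-parallel matroid is the cycle matroid of a series-parallel graph. Series-parallel
graphs are finite and the names of the vertices do not matter, so vertices may be taken in `ℕ`. -/
def Matroid.IsSeriesParallel {β : Type*} (M : Matroid β) : Prop :=
  ∃ G : Graph ℕ β, G.IsSeriesParallel ∧ G.IsCycleMatroid M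

/-- The number of series-parallel matroids of rank `l` on an `n`-element labelled ground set
(there are finitely many matroids on `Fin n`). -/
noncomputable def numSeriesParallel (n l : ℕ) : ℕ :=
  {M : Matroid (Fin n) | M.E = Set.univ ∧ M.IsSeriesParallel ∧ M.eRank = (l : ℕ∞)}.ncard

/-- The unsigned associated Stirling number of the first kind: the number of derangements of an
`n`-element set with exactly `k` cycles. (Mathlib's `cycleType` lists the lengths of the cycles
of length at least 2, which for a derangement are all of its cycles.) -/
def assocStirlingFirst (n k : ℕ) : ℕ :=
  (Finset.univ.filter fun σ : Equiv.Perm (Fin n) =>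
    (∀ i, σ i ≠ i) ∧ σ.cycleType.card = k).card

/-! A series-parallel matroid is binary, so it is determined by its cycle space `Z` over `ZMod 2`.
For n ≥ 2 the two exceptional one-edge graphs play no role, and the matroids to be counted
correspond to the spaces `SPSpace Finset.univ Z a`, where `a` counts series extensions and the rank
is `a + 1` (`numSeriesParallel_eq_ncard_spSpace`).

Fix an element e as root. The sets containing C \ {e} for some member C of `Z` through e form a
monotone Boolean function `pathFn Z e` of the other elements: the connectivity between the ends of e
in a two-terminal network. A parallel extension replaces a variable g by g ∨ h and a series
extension replaces it by g ∧ h, so this function is read-once with exactly `a` conjunctions. Every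
read-once function arises in this way (`ReadOnce.exists_spSpace`). The function determines `Z`,
because the minimal members through e span the space (`SPSpace.le_span_minimalThrough`,
`SPSpace.eq_of_pathFn_eq`). Hence the task is to count read-once functions of n - 1 variables by
number of conjunctions.

Let u, a, b be the generating functions, with weight t per conjunction, of all read-once functions
of m + 1 variables, of the non-conjunctions and of the non-disjunctions. The sets along which a
function splits as a conjunction are closed under intersection and complement, so a fixed variable
lies in a unique indecomposable factor; this gives the recursion u = a + t(a * u) in binomial
convolution (`readOnceGen_eq_nonAndGen_add`). Duality gives u = b + (b * u), and a + b = u except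
for one variable, which is counted twice.

With U the exponential generating function, U' = A(1 + tU) = B(1 + U) and A + B = U' + 1, so U'(1 -
tU²) = (1 + U)(1 + tU). Writing U = z = exp y - 1 turns this into x = y - φ with φ = z - log(1 +
tz)/t. Lagrange inversion then expresses the coefficients of U through the powers φ^k/k!, whose
coefficients are signed associated Stirling numbers of the first kind, while expanding powers of exp
y - 1 produces Stirling numbers of the second kind (`eq_sum_of_recursion`). The coefficient of
t^(l-1) is the stated sum. -/

/-! ### Derangements by number of cycles: the recurrence. -/

section AssocStirling

open Equiv Equiv.Perm Finset

variable {α : Type*} [Fintype α] [DecidableEq α]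

/-- The permutations with support exactly `S` and exactly `k` cycles. -/
def permsWithSupport (S : Finset α) (k : ℕ) : Finset (Perm α) :=
  univ.filter fun σ => σ.support = S ∧ σ.cycleType.card = k

lemma mem_permsWithSupport {S : Finset α} {k : ℕ} {σ : Perm α} :
    σ ∈ permsWithSupport S k ↔ σ.support = S ∧ σ.cycleType.card = k := by
  simp [permsWithSupport]

lemma assocStirlingFirst_eq_card_permsWithSupport (n k : ℕ) :
    assocStirlingFirst n k = (permsWithSupport (univ : Finset (Fin n)) k).card := by
  unfold assocStirlingFirst permsWithSupport
  congr 1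
  ext σ
  simp [Finset.ext_iff]

/-- A permutation with support S is a derangement of S extended by fixed points, and the extension
preserves the cycle type. This makes counts on subsets of a fixed type available, as the recurrence
deletes points from a support. -/
lemma card_permsWithSupport (S : Finset α) (k : ℕ) :
    (permsWithSupport S k).card = assocStirlingFirst S.card k := by
  rw [assocStirlingFirst_eq_card_permsWithSupport]
  let ψ : Fin S.card ≃ {x // x ∈ S} := (Fintype.equivFinOfCardEq (by simp)).symm
  symm
  refine Finset.card_bij (fun τ _ => τ.extendDomain ψ) ?_ ?_ ?_
  · intro τ hτ
    rw [mem_permsWithSupport] at hτ ⊢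
    refine ⟨?_, by rw [cycleType_extendDomain, hτ.2]⟩
    rw [support_extend_domain, hτ.1]
    ext x
    simp only [Finset.mem_map, Finset.mem_univ, true_and, Equiv.asEmbedding_apply]
    exact ⟨fun ⟨i, hi⟩ => hi ▸ (ψ i).2, fun hx => ⟨ψ.symm ⟨x, hx⟩, by simp⟩⟩
  · intro τ _ τ' _ h
    exact Perm.extendDomainHom_injective ψ h
  · intro σ hσ
    rw [mem_permsWithSupport] at hσ
    have hmem : ∀ x, σ x ∈ S ↔ x ∈ S := fun x => by
      rw [← hσ.1]; exact Perm.apply_mem_support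
    let τ : Perm (Fin S.card) := (ψ.trans (σ.subtypePerm (p := (· ∈ S)) hmem)).trans ψ.symm
    have hτ : τ.extendDomain ψ = σ := by
      ext x
      by_cases hx : x ∈ S
      · rw [Perm.extendDomain_apply_subtype _ _ hx]
        simp [τ]
      · rw [Perm.extendDomain_apply_not_subtype _ _ hx]
        rw [← hσ.1] at hx
        simpa using (Perm.notMem_support.1 hx).symm
    refine ⟨τ, ?_, hτ⟩
    rw [mem_permsWithSupport]
    refine ⟨?_, by rw [← cycleType_extendDomain ψ, hτ, hσ.2]⟩
    ext i
    have : (ψ i : α) ∈ σ.support := by rw [hσ.1]; exact (ψ i).2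
    rw [← hτ, mem_support, Perm.extendDomain_apply_image] at this
    simp only [Finset.mem_univ, iff_true, mem_support]
    exact fun h => this (by rw [h])

/-- Removing a point from a cycle of length at least three. -/
lemma card_cycleType_swap_mul {σ : Perm α} {a : α} (ha : σ a ≠ a) (ha' : σ (σ a) ≠ a) :
    (swap a (σ a) * σ).cycleType.card = σ.cycleType.card := by
  set c := σ.cycleOf a with hc
  have hcyc : c.IsCycle := isCycle_cycleOf σ ha
  have hca : c a = σ a := cycleOf_apply_self σ a
  have hcaa : c (c a) = σ (σ a) := by
    rw [hca]
    exact SameCycle.cycleOf_apply ⟨1, by simp⟩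
  obtain ⟨ρ, hρ⟩ : ∃ ρ, ρ = σ * c⁻¹ := ⟨_, rfl⟩
  have hdisj : c.Disjoint ρ := hρ ▸ (disjoint_mul_inv_of_mem_cycleFactorsFinset
    (cycleOf_mem_cycleFactorsFinset_iff.2 (mem_support.2 ha))).symm
  have hσ : σ = c * ρ := by rw [hdisj.commute.eq, hρ]; group
  have hne : c (c a) ≠ a := by rwa [hcaa]
  have hcyc' : (swap a (c a) * c).IsCycle := hcyc.swap_mul (by rwa [hca]) hne
  have hdisj' : (swap a (c a) * c).Disjoint ρ := by
    rw [disjoint_iff_disjoint_support, support_swap_mul_eq _ _ hne]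
    exact (disjoint_iff_disjoint_support.1 hdisj).mono_left sdiff_subset
  have h1 : swap a (σ a) * σ = (swap a (c a) * c) * ρ := by
    rw [mul_assoc, ← hσ, hca]
  rw [h1, hdisj'.cycleType_mul]
  conv_rhs => rw [hσ, hdisj.cycleType_mul]
  simp [hcyc.cycleType, hcyc'.cycleType]

/-- Removing a transposition. -/
lemma support_swap_mul_of_involutive {σ : Perm α} {a : α} (ha : σ a ≠ a) (ha' : σ (σ a) = a) :
    (swap a (σ a) * σ).support = σ.support \ {a, σ a} := by
  ext x
  simp only [mem_support, coe_mul, Function.comp_apply, mem_sdiff, Finset.mem_insert,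
    Finset.mem_singleton, not_or]
  by_cases h1 : x = a
  · subst h1; simp
  by_cases h2 : x = σ a
  · subst h2; simp [ha']
  have h3 : σ x ≠ a := fun h => h2 (by rw [← ha'] at h; exact σ.injective h)
  have h4 : σ x ≠ σ a := fun h => h1 (σ.injective h)
  simp [swap_apply_of_ne_of_ne h3 h4, h1, h2]

lemma disjoint_swap {γ : Type*} [DecidableEq γ] {ρ : Perm γ} {a b : γ} (ha : ρ a = a) (hb : ρ b = b) :
    (swap a b).Disjoint ρ := by
  intro x
  by_cases h1 : x = a
  · subst h1; exact Or.inr ha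
  by_cases h2 : x = b
  · subst h2; exact Or.inr hb
  exact Or.inl (swap_apply_of_ne_of_ne h1 h2)

lemma card_cycleType_swap_mul_of_fixed {ρ : Perm α} {a b : α} (hab : a ≠ b) (ha : ρ a = a)
    (hb : ρ b = b) : (swap a b * ρ).cycleType.card = ρ.cycleType.card + 1 := by
  rw [(disjoint_swap ha hb).cycleType_mul, (swap_isSwap_iff.2 hab).isCycle.cycleType]
  simp [add_comm]

/-- Left multiplication by the transposition (a b) is an involution that cuts a out of its cycle. If
that cycle has length at least three, the number of cycles is kept and only a leaves the support; if
it is (a b) itself, a cycle and both points disappear. -/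
lemma card_permsWithSupport_apply_eq {S : Finset α} {a b : α} (ha : a ∈ S) (hb : b ∈ S)
    (hab : a ≠ b) (k : ℕ) :
    ((permsWithSupport S (k + 1)).filter fun σ => σ a = b).card =
      (permsWithSupport (S.erase a) (k + 1)).card +
        (permsWithSupport ((S.erase a).erase b) k).card := by
  rw [← Finset.card_filter_add_card_filter_not (p := fun σ : Perm α => σ b = a), add_comm]
  congr 1
  · symm
    refine Finset.card_bij (fun τ _ => swap a b * τ) ?_ ?_ ?_
    · intro τ hτ
      rw [mem_permsWithSupport] at hτ
      have h1 : τ a = a := by rw [← Perm.notMem_support, hτ.1]; simp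
      have h2 : τ b ≠ b := by
        rw [← mem_support, hτ.1]; simp [hb, hab.symm]
      have h3 : τ b ≠ a := fun h => hab.symm (τ.injective (h.trans h1.symm))
      have h4 : (swap a b * τ) a = b := by simp [h1]
      have h5 : (swap a b * τ) b = τ b := by simp [swap_apply_of_ne_of_ne h3 h2]
      have h6 : swap a ((swap a b * τ) a) * (swap a b * τ) = τ := by
        rw [h4, ← mul_assoc, swap_mul_self, one_mul]
      have h7 : (swap a b * τ) ((swap a b * τ) a) ≠ a := by rw [h4, h5]; exact h3
      have h8 := support_swap_mul_eq _ _ h7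
      have h9 := card_cycleType_swap_mul (by rw [h4]; exact hab.symm) h7
      rw [h6] at h8 h9
      simp only [Finset.mem_filter, mem_permsWithSupport]
      refine ⟨⟨⟨?_, by rw [← h9, hτ.2]⟩, h4⟩, by rw [h5]; exact h3⟩
      have : a ∈ (swap a b * τ).support := by rw [mem_support, h4]; exact hab.symm
      rw [hτ.1] at h8
      ext x
      by_cases hx : x = a
      · subst hx; simp only [this, ha]
      · have := Finset.ext_iff.1 h8 x
        simpa [hx] using this.symm
    · intro τ _ τ' _ h; exact mul_left_cancel h
    · intro σ hσ
      simp only [Finset.mem_filter, mem_permsWithSupport] at hσ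
      obtain ⟨⟨⟨h1, h2⟩, h3⟩, h4⟩ := hσ
      have h7 : σ (σ a) ≠ a := by rwa [h3]
      refine ⟨swap a b * σ, ?_, by rw [← mul_assoc, swap_mul_self, one_mul]⟩
      rw [mem_permsWithSupport]
      have h8 := support_swap_mul_eq _ _ h7
      have h9 := card_cycleType_swap_mul (by rw [h3]; exact hab.symm) h7
      rw [h3] at h8 h9
      rw [h8, h9, h1, h2, Finset.sdiff_singleton_eq_erase]
      exact ⟨rfl, rfl⟩
  · symm
    refine Finset.card_bij (fun τ _ => swap a b * τ) ?_ ?_ ?_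
    · intro τ hτ
      rw [mem_permsWithSupport] at hτ
      have h1 : τ a = a := by rw [← Perm.notMem_support, hτ.1]; simp
      have h2 : τ b = b := by rw [← Perm.notMem_support, hτ.1]; simp
      simp only [Finset.mem_filter, mem_permsWithSupport]
      refine ⟨⟨⟨?_, by rw [card_cycleType_swap_mul_of_fixed hab h1 h2, hτ.2]⟩, by simp [h1]⟩,
        by simp [h2]⟩
      rw [(disjoint_swap h1 h2).support_mul, hτ.1, support_swap hab]
      ext x
      by_cases hx : x = a
      · simp [hx, ha]
      by_cases hx' : x = b
      · simp [hx', hb]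
      simp [hx, hx']
    · intro τ _ τ' _ h; exact mul_left_cancel h
    · intro σ hσ
      simp only [Finset.mem_filter, mem_permsWithSupport] at hσ
      obtain ⟨⟨⟨h1, h2⟩, h3⟩, h4⟩ := hσ
      refine ⟨swap a b * σ, ?_, by rw [← mul_assoc, swap_mul_self, one_mul]⟩
      have h5 := support_swap_mul_of_involutive (σ := σ) (a := a) (by rw [h3]; exact hab.symm)
        (by rw [h3, h4])
      rw [h3] at h5
      rw [mem_permsWithSupport, h5, h1]
      refine ⟨by ext x; simp; tauto, ?_⟩
      have h6 := card_cycleType_swap_mul_of_fixed (ρ := swap a b * σ) hab (by simp [h3])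
        (by simp [h4])
      rw [← mul_assoc, swap_mul_self, one_mul, h2] at h6
      omega

lemma assocStirlingFirst_zero_zero : assocStirlingFirst 0 0 = 1 := by decide

lemma assocStirlingFirst_zero_succ (k : ℕ) : assocStirlingFirst 0 (k + 1) = 0 := by
  rw [assocStirlingFirst, Finset.card_eq_zero, Finset.filter_eq_empty_iff]
  intro σ _ h
  rw [Subsingleton.elim σ 1] at h
  simp at h

lemma assocStirlingFirst_succ_zero (n : ℕ) : assocStirlingFirst (n + 1) 0 = 0 := by
  rw [assocStirlingFirst, Finset.card_eq_zero, Finset.filter_eq_empty_iff]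
  intro σ _ h
  rw [Multiset.card_eq_zero, cycleType_eq_zero] at h
  exact h.1 0 (by rw [h.2]; rfl)

lemma assocStirlingFirst_one (k : ℕ) : assocStirlingFirst 1 k = 0 := by
  rw [assocStirlingFirst, Finset.card_eq_zero, Finset.filter_eq_empty_iff]
  intro σ _ h
  exact h.1 0 (Subsingleton.elim _ _)

/-- The image of the point 0 can be any of the n + 1 other points, and each choice contributes the
same amount. -/
lemma assocStirlingFirst_add_two (n k : ℕ) :
    assocStirlingFirst (n + 2) (k + 1) =
      (n + 1) * (assocStirlingFirst (n + 1) (k + 1) + assocStirlingFirst n k) := by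
  rw [assocStirlingFirst_eq_card_permsWithSupport]
  have h0 : ∀ σ ∈ permsWithSupport (univ : Finset (Fin (n + 2))) (k + 1),
      σ 0 ∈ univ.erase (0 : Fin (n + 2)) := by
    intro σ hσ
    rw [mem_permsWithSupport] at hσ
    have : (0 : Fin (n + 2)) ∈ σ.support := by rw [hσ.1]; simp
    simpa using this
  rw [Finset.card_eq_sum_card_fiberwise h0]
  rw [Finset.sum_congr rfl (g := fun _ => assocStirlingFirst (n + 1) (k + 1) +
    assocStirlingFirst n k)]
  · simp
  · intro b hb
    have hb' : b ≠ 0 := by simpa using hb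
    rw [card_permsWithSupport_apply_eq (mem_univ _) (mem_univ _) hb'.symm,
      card_permsWithSupport, card_permsWithSupport, card_erase_of_mem hb,
      card_erase_of_mem (mem_univ _), card_univ, Fintype.card_fin]
    rfl

lemma assocStirlingFirst_eq_zero_of_lt : ∀ {n k : ℕ}, n < 2 * k → assocStirlingFirst n k = 0
  | 0, 0, h => by omega
  | 0, k + 1, _ => assocStirlingFirst_zero_succ k
  | 1, k, _ => assocStirlingFirst_one k
  | n + 2, 0, h => by omega
  | n + 2, k + 1, h => by
    rw [assocStirlingFirst_add_two, assocStirlingFirst_eq_zero_of_lt (n := n + 1) (by omega),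
      assocStirlingFirst_eq_zero_of_lt (n := n) (by omega)]
    simp

end AssocStirling

/-! ### Lagrange inversion in the coordinate z = exp y - 1. -/

section Lagrange

open PowerSeries Finset Nat

variable {R : Type*} [CommRing R]

/-- The derivation `(1 + z) d/dz`, which becomes `d/dx` after the substitution `z = exp x - 1`. -/
noncomputable def expDeriv (h : R⟦X⟧) : R⟦X⟧ := (1 + X) * d⁄dX R h

/-- The functional `h ↦ n! [x ^ n] h (exp x - 1)`. -/
noncomputable def expCoeff (n : ℕ) (h : R⟦X⟧) : R := constantCoeff (expDeriv^[n] h)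

lemma expDeriv_add (g h : R⟦X⟧) : expDeriv (g + h) = expDeriv g + expDeriv h := by
  simp [expDeriv, mul_add]

lemma expDeriv_mul (g h : R⟦X⟧) : expDeriv (g * h) = g * expDeriv h + expDeriv g * h := by
  simp [expDeriv]; ring

lemma expCoeff_zero (h : R⟦X⟧) : expCoeff 0 h = constantCoeff h := rfl

lemma expCoeff_succ (n : ℕ) (h : R⟦X⟧) : expCoeff (n + 1) h = expCoeff n (expDeriv h) := rfl

lemma expCoeff_add (n : ℕ) (g h : R⟦X⟧) : expCoeff n (g + h) = expCoeff n g + expCoeff n h := by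
  induction n generalizing g h with
  | zero => simp [expCoeff_zero]
  | succ n ih => rw [expCoeff_succ, expDeriv_add, ih]; rfl

lemma expCoeff_zero_right (n : ℕ) : expCoeff n (0 : R⟦X⟧) = 0 := by
  simpa using expCoeff_add n (0 : R⟦X⟧) 0

lemma expCoeff_neg (n : ℕ) (g : R⟦X⟧) : expCoeff n (-g) = -expCoeff n g := by
  have := expCoeff_add n g (-g)
  rw [add_neg_cancel, expCoeff_zero_right] at this
  exact (neg_eq_of_add_eq_zero_right this.symm).symm

lemma X_pow_dvd_expDeriv {k : ℕ} {h : R⟦X⟧} (hk : (X : R⟦X⟧) ^ (k + 1) ∣ h) :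
    (X : R⟦X⟧) ^ k ∣ expDeriv h := by
  obtain ⟨g, rfl⟩ := hk
  refine ⟨(1 + X) * (((k : R⟦X⟧) + 1) * g + X * d⁄dX R g), ?_⟩
  rw [expDeriv, Derivation.leibniz, derivative_pow]
  simp only [smul_eq_mul, derivative_X, add_tsub_cancel_right]
  push_cast
  ring

/-- Each application of `expDeriv` lowers the order of vanishing by at most one. This is what
truncates all the sums below. -/
lemma expCoeff_eq_zero {n k : ℕ} {h : R⟦X⟧} (hk : (X : R⟦X⟧) ^ k ∣ h) (hn : n < k) :
    expCoeff n h = 0 := by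
  induction n generalizing k h with
  | zero =>
    rw [expCoeff_zero, ← coeff_zero_eq_constantCoeff_apply]
    exact X_pow_dvd_iff.1 hk 0 hn
  | succ n ih =>
    obtain ⟨k, rfl⟩ : ∃ j, k = j + 1 := ⟨k - 1, by omega⟩
    exact ih (X_pow_dvd_expDeriv hk) (by omega)

lemma expCoeff_C_mul (n : ℕ) (r : R) (h : R⟦X⟧) : expCoeff n (C r * h) = r * expCoeff n h := by
  induction n generalizing h with
  | zero => simp [expCoeff_zero]
  | succ n ih =>
    have : expDeriv (C r : R⟦X⟧) = 0 := by simp [expDeriv]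
    rw [expCoeff_succ, expDeriv_mul, expCoeff_succ, this, zero_mul, add_zero, ih]

lemma expCoeff_sum {ι : Type*} (s : Finset ι) (n : ℕ) (h : ι → R⟦X⟧) :
    expCoeff n (∑ i ∈ s, h i) = ∑ i ∈ s, expCoeff n (h i) := by
  classical
  induction s using Finset.induction_on with
  | empty => simp [expCoeff_zero_right]
  | insert a s ha ih => rw [sum_insert ha, sum_insert ha, expCoeff_add, ih]

/-- This is the classical fact that (exp x - 1)^j / j! generates the partitions into j parts;
`expDeriv` sends X^(j+1) to (j+1)(X^j + X^(j+1)), which is the Stirling recurrence. -/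
lemma expCoeff_X_pow (n j : ℕ) :
    expCoeff n ((X : R⟦X⟧) ^ j) = (j ! * stirlingSecond n j : ℕ) := by
  induction n generalizing j with
  | zero =>
    cases j <;> simp [expCoeff_zero]
  | succ n ih =>
    cases j with
    | zero =>
      have : expDeriv ((X : R⟦X⟧) ^ 0) = 0 := by simp [expDeriv]
      rw [expCoeff_succ, this, expCoeff_zero_right]; simp
    | succ j =>
      have : expDeriv ((X : R⟦X⟧) ^ (j + 1)) =
          C ((j + 1 : ℕ) : R) * X ^ j + C ((j + 1 : ℕ) : R) * X ^ (j + 1) := by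
        rw [expDeriv, derivative_pow]; simp; ring
      rw [expCoeff_succ, this, expCoeff_add, expCoeff_C_mul, expCoeff_C_mul, ih, ih,
        stirlingSecond_succ_succ, factorial_succ]
      push_cast; ring

lemma expCoeff_eq_sum (n : ℕ) (h : R⟦X⟧) :
    expCoeff n h = ∑ j ∈ range (n + 1), coeff j h * (j ! * stirlingSecond n j : ℕ) := by
  have h1 : h = (trunc (n + 1) h : R⟦X⟧) + (h - (trunc (n + 1) h : R⟦X⟧)) := by ring
  have h2 : (X : R⟦X⟧) ^ (n + 1) ∣ h - (trunc (n + 1) h : R⟦X⟧) := by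
    rw [X_pow_dvd_iff]
    intro m hm
    simp [coeff_trunc, hm]
  conv_lhs => rw [h1]
  rw [expCoeff_add, expCoeff_eq_zero h2 (by omega), add_zero]
  have h3 : (trunc (n + 1) h : R⟦X⟧) = ∑ j ∈ range (n + 1), C (coeff j h) * X ^ j := by
    ext m
    simp [coeff_trunc, coeff_X_pow, Finset.sum_ite_eq]
  rw [h3, expCoeff_sum]
  simp_rw [expCoeff_C_mul, expCoeff_X_pow]

variable (t : R)

/-- The derivative of `y ↦ y + f y` for the equation `x = y + f y`, in the coordinate
`z = exp y - 1`. -/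
noncomputable def timeChange : R⟦X⟧ := (1 - C t * X ^ 2) * invOfUnit (1 + C t * X) 1

/-- The inverse of `timeChange`. -/
noncomputable def timeChangeInv : R⟦X⟧ := (1 + C t * X) * invOfUnit (1 - C t * X ^ 2) 1

lemma mul_timeChange : (1 + C t * X) * timeChange t = 1 - C t * X ^ 2 := by
  have := mul_invOfUnit (1 + C t * X) 1 (by simp)
  rw [timeChange, mul_left_comm, this, mul_one]

lemma mul_timeChangeInv : (1 - C t * X ^ 2) * timeChangeInv t = 1 + C t * X := by
  have := mul_invOfUnit (1 - C t * X ^ 2) 1 (by simp)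
  rw [timeChangeInv, mul_left_comm, this, mul_one]

lemma timeChange_mul_timeChangeInv : timeChange t * timeChangeInv t = 1 := by
  have h1 := mul_invOfUnit (1 + C t * X) 1 (by simp)
  have h2 := mul_invOfUnit (1 - C t * X ^ 2) 1 (by simp)
  rw [timeChange, timeChangeInv]
  linear_combination (1 - C t * X ^ 2) * invOfUnit (1 - C t * X ^ 2) 1 * h1 + h2

variable [Algebra ℚ R]

/-- The series `(z - log (1 + t z) / t) ^ k / k!`. -/
noncomputable def logDefectPow (k : ℕ) : R⟦X⟧ :=
  PowerSeries.mk fun j =>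
    algebraMap ℚ R ((-1) ^ j * assocStirlingFirst j k / j !) * t ^ (j - k)

lemma logDefectPow_zero : logDefectPow t 0 = 1 := by
  ext j
  cases j with
  | zero => simp [logDefectPow, assocStirlingFirst_zero_zero]
  | succ j => simp [logDefectPow, assocStirlingFirst_succ_zero, coeff_one]

lemma X_pow_dvd_logDefectPow (k : ℕ) : (X : R⟦X⟧) ^ (2 * k) ∣ logDefectPow t k := by
  rw [X_pow_dvd_iff]
  intro m hm
  simp [logDefectPow, assocStirlingFirst_eq_zero_of_lt hm]

/-- For φ = z - log(1 + tz)/t one has φ' = tz/(1 + tz), and (φ^(k+1)/(k+1)!)' = φ' φ^k/k!. Since the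
powers are defined by their coefficients, the identity is the derangement recurrence read
coefficientwise. -/
lemma derivative_logDefectPow (k : ℕ) :
    (1 + C t * X) * d⁄dX R (logDefectPow t (k + 1)) = C t * X * logDefectPow t k := by
  have key : ∀ j, coeff (j + 1) ((1 + C t * X) * d⁄dX R (logDefectPow t (k + 1))) =
      coeff (j + 1) (C t * X * logDefectPow t k) := by
    intro j
    rw [add_mul, one_mul, map_add, mul_assoc, mul_assoc, coeff_C_mul, coeff_C_mul, coeff_succ_X_mul,
      coeff_succ_X_mul, coeff_derivative, coeff_derivative]
    simp only [logDefectPow, coeff_mk]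
    have e1 : ((j + 1 : ℕ) : R) + 1 = algebraMap ℚ R (j + 2) := by
      simp only [map_add, map_natCast, map_ofNat]; push_cast; ring
    have e2 : (j : R) + 1 = algebraMap ℚ R (j + 1) := by simp
    rw [e1, e2]
    -- For j < k the truncated exponents of t carry no meaning, but all three derangement numbers
    -- vanish there.
    rcases Nat.lt_or_ge j k with hjk | hjk
    · rw [assocStirlingFirst_eq_zero_of_lt (n := j + 1 + 1) (by omega),
        assocStirlingFirst_eq_zero_of_lt (n := j + 1) (by omega),
        assocStirlingFirst_eq_zero_of_lt (n := j) (by omega)]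
      simp
    · obtain ⟨i, rfl⟩ := Nat.exists_eq_add_of_le hjk
      have e3 : k + i + 1 + 1 - (k + 1) = i + 1 := by omega
      have e5 : k + i - k = i := by omega
      have e4 : k + i + 1 - (k + 1) = i := by omega
      rw [e3, e4, e5, assocStirlingFirst_add_two]
      have f1 : ((k + i + 1 + 1)! : ℚ) = (k + i + 2) * ((k + i + 1) * (k + i)!) := by
        rw [factorial_succ, factorial_succ]; push_cast; ring
      have f2 : ((k + i + 1)! : ℚ) = (k + i + 1) * (k + i)! := by
        rw [factorial_succ]; push_cast; ring
      have g0 : ((k + i)! : ℚ) ≠ 0 := by positivity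
      have g1 : (k + i + 1 : ℚ) ≠ 0 := by positivity
      have g2 : (k + i + 2 : ℚ) ≠ 0 := by positivity
      have := congrArg (algebraMap ℚ R) (show
        ((-1) ^ (k + i + 1 + 1) * ((k + i + 1 : ℕ) * (assocStirlingFirst (k + i + 1) (k + 1) +
          assocStirlingFirst (k + i) k) : ℚ) / (k + i + 1 + 1)!) * ((k + i : ℕ) + 2) +
        ((-1) ^ (k + i + 1) * assocStirlingFirst (k + i + 1) (k + 1) / (k + i + 1)!) *
          ((k + i : ℕ) + 1) = (-1) ^ (k + i) * assocStirlingFirst (k + i) k / (k + i)! by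
        rw [f1, f2]
        push_cast
        field_simp
        ring)
      simp only [map_add, map_mul] at this ⊢
      push_cast at this ⊢
      rw [← this]
      ring
  ext j
  cases j with
  | succ j => exact key j
  | zero =>
    rw [mul_assoc (C t), coeff_C_mul, coeff_zero_X_mul, mul_zero, add_mul, mul_assoc, map_add,
      coeff_C_mul, coeff_zero_X_mul, one_mul, coeff_derivative]
    simp [logDefectPow, assocStirlingFirst_one]

/-- With D = `expDeriv`, the factor `timeChange t` is 1 - Dφ, and (φ^k/k!) Dφ is the total
derivative D(φ^(k+1)/(k+1)!). This makes the Lagrange sums telescope. -/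
lemma logDefectPow_mul_timeChange (k : ℕ) :
    logDefectPow t k * timeChange t = logDefectPow t k - expDeriv (logDefectPow t (k + 1)) := by
  have h1 := mul_invOfUnit (1 + C t * X) 1 (by simp)
  have h2 := mul_timeChange t
  have h3 := derivative_logDefectPow t k
  rw [expDeriv]
  have h4 : (1 + C t * X) * (logDefectPow t k * timeChange t) = (1 + C t * X) *
      (logDefectPow t k - (1 + X) * d⁄dX R (logDefectPow t (k + 1))) := by
    linear_combination logDefectPow t k * h2 + (1 + X) * h3
  linear_combination invOfUnit (1 + C t * X) 1 * h4 - (logDefectPow t k * timeChange t -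
    (logDefectPow t k - (1 + X) * d⁄dX R (logDefectPow t (k + 1)))) * h1

/-- The Lagrange inversion functional. -/
noncomputable def lagrangeCoeff (N n : ℕ) (g : R⟦X⟧) : R :=
  ∑ k ∈ range N, expCoeff (n + k) (logDefectPow t k * timeChange t * g)

lemma X_pow_dvd_expDeriv_logDefectPow_mul (k : ℕ) (g : R⟦X⟧) :
    (X : R⟦X⟧) ^ (2 * k + 1) ∣ expDeriv (logDefectPow t (k + 1)) * g :=
  Dvd.dvd.mul_right (X_pow_dvd_expDeriv (X_pow_dvd_logDefectPow t (k + 1))) _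

lemma expDeriv_logDefectPow_zero : expDeriv (logDefectPow t 0) = 0 := by
  simp [logDefectPow_zero, expDeriv]

/-- The series φ^k/k! vanishes to order 2k and the derivative term to order 2k + 1, while only k
derivatives are taken; just the main term for k = 0 survives. -/
lemma lagrangeCoeff_zero (N : ℕ) (g : R⟦X⟧) :
    lagrangeCoeff t (N + 1) 0 g = constantCoeff g := by
  have h (k : ℕ) : expCoeff (0 + k) (logDefectPow t k * timeChange t * g) =
      expCoeff k (logDefectPow t k * g) := by
    rw [logDefectPow_mul_timeChange, sub_mul, sub_eq_add_neg, expCoeff_add, zero_add, expCoeff_neg,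
      expCoeff_eq_zero (X_pow_dvd_expDeriv_logDefectPow_mul t k g) (by omega), neg_zero, add_zero]
  rw [lagrangeCoeff, sum_congr rfl fun k _ => h k, sum_range_succ', sum_eq_zero, zero_add,
    logDefectPow_zero, one_mul, expCoeff_zero]
  intro k _
  exact expCoeff_eq_zero (Dvd.dvd.mul_right (X_pow_dvd_logDefectPow t _) _) (by omega)

/-- The product rule splits off a telescoping difference. Its first term is D1 = 0 and its last one
vanishes to too high an order once N exceeds n + 1. -/
lemma lagrangeCoeff_succ {N n : ℕ} (hN : n + 1 < N) (g : R⟦X⟧) :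
    lagrangeCoeff t N (n + 1) g =
      ∑ k ∈ range N, expCoeff (n + k) (logDefectPow t k * expDeriv g) := by
  have h (k : ℕ) : expCoeff (n + 1 + k) (logDefectPow t k * timeChange t * g) =
      expCoeff (n + k) (logDefectPow t k * expDeriv g) +
      (expCoeff (n + k) (expDeriv (logDefectPow t k) * g) -
        expCoeff (n + (k + 1)) (expDeriv (logDefectPow t (k + 1)) * g)) := by
    rw [logDefectPow_mul_timeChange, sub_mul, sub_eq_add_neg, expCoeff_add, expCoeff_neg,
      show n + 1 + k = n + k + 1 by ring, expCoeff_succ _ (logDefectPow t k * g), expDeriv_mul,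
      expCoeff_add, add_assoc n k 1]
    ring
  obtain ⟨M, rfl⟩ : ∃ M, N = M + 1 := ⟨N - 1, by omega⟩
  rw [lagrangeCoeff, sum_congr rfl fun k _ => h k, sum_add_distrib, sum_range_sub',
    expDeriv_logDefectPow_zero, zero_mul, expCoeff_zero_right,
    expCoeff_eq_zero (X_pow_dvd_expDeriv_logDefectPow_mul t M g) (by omega)]
  ring

/-- Lagrange inversion, by induction on n. The differential equation says that d/dx acts on
functions of U as `timeChangeInv t` times `expDeriv`; the factor `timeChange t` inside
`lagrangeCoeff` cancels the inverse, so both sides pass from n + 1 to n in the same way. -/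
lemma constantCoeff_iterate_derivative_subst {U : R⟦X⟧} (hU : constantCoeff U = 0)
    (hU' : d⁄dX R U * (1 - C t * U ^ 2) = (1 + U) * (1 + C t * U)) {N n : ℕ} (hN : n < N)
    (g : R⟦X⟧) :
    constantCoeff ((d⁄dX R)^[n] (g.subst U)) = lagrangeCoeff t N n g := by
  have hs : HasSubst U := HasSubst.of_constantCoeff_zero' hU
  have hone : (1 : R⟦X⟧).subst U = (1 : R⟦X⟧) := by
    rw [← coe_substAlgHom hs, map_one]
  have hC : ∀ r : R, (C r : R⟦X⟧).subst U = (C r : R⟦X⟧) := fun r => subst_C r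
  induction n generalizing g with
  | zero =>
    obtain ⟨M, rfl⟩ : ∃ M, N = M + 1 := ⟨N - 1, by omega⟩
    rw [lagrangeCoeff_zero, Function.iterate_zero, id]
    have : (X : R⟦X⟧) ∣ g - C (constantCoeff g) := by rw [X_dvd_iff]; simp
    obtain ⟨h, hh⟩ := this
    have : g = X * h + C (constantCoeff g) := by rw [← hh]; ring
    conv_lhs => rw [this]
    rw [subst_add hs, subst_mul hs, subst_X hs, hC]
    simp [hU]
  | succ n ih =>
    have h1 : d⁄dX R (g.subst U) = (timeChangeInv t * expDeriv g).subst U := by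
      rw [derivative_subst hs]
      have h2 := congrArg (fun f : R⟦X⟧ => (f.subst U : R⟦X⟧)) (mul_timeChangeInv t)
      simp only [subst_mul hs, subst_add hs, subst_sub hs, subst_X hs, hone, hC, subst_pow hs] at h2
      have h3 := mul_invOfUnit (1 - C t * U ^ 2) 1 (by simp [hU])
      have h4 : (1 - C t * U ^ 2) * ((d⁄dX R g).subst U * d⁄dX R U) =
          (1 - C t * U ^ 2) * (timeChangeInv t * expDeriv g).subst U := by
        rw [expDeriv]
        simp only [subst_mul hs, subst_add hs, subst_X hs, hone]
        linear_combination (d⁄dX R g).subst U * hU' - (1 + U) * (d⁄dX R g).subst U * h2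
      linear_combination invOfUnit (1 - C t * U ^ 2) 1 * h4 -
        ((d⁄dX R g).subst U * d⁄dX R U - (timeChangeInv t * expDeriv g).subst U) * h3
    rw [Function.iterate_succ_apply, h1, ih (by omega), lagrangeCoeff_succ t hN]
    rw [lagrangeCoeff]
    refine sum_congr rfl fun k _ => ?_
    congr 1
    linear_combination logDefectPow t k * expDeriv g * timeChange_mul_timeChangeInv t

/-- The factor 1 + X is absorbed by integration: (1 + X)h is `expDeriv` of an antiderivative of h.
This raises both indices of the Stirling number by one, and the factorials cancel. -/
lemma expCoeff_logDefectPow (m k : ℕ) :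
    expCoeff m (logDefectPow t k * (1 + X)) =
      ∑ j ∈ range (m + 1), ((-1) ^ j * assocStirlingFirst j k * stirlingSecond (m + 1) (j + 1)) *
        t ^ (j - k) := by
  -- The formal antiderivative; its constant term is zero because the inverse of 0 is 0.
  obtain ⟨I, hI⟩ : ∃ I : R⟦X⟧, I = PowerSeries.mk fun j =>
    algebraMap ℚ R (j : ℚ)⁻¹ * coeff (j - 1) (logDefectPow t k) := ⟨_, rfl⟩
  have h1 : expDeriv I = logDefectPow t k * (1 + X) := by
    rw [expDeriv, mul_comm]
    congr 1
    ext j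
    rw [coeff_derivative, hI, coeff_mk]
    have e2 : (j : R) + 1 = algebraMap ℚ R (j + 1) := by simp
    have e3 : (j + 1 : ℚ) ≠ 0 := by positivity
    rw [e2, mul_right_comm, ← map_mul, Nat.cast_succ, inv_mul_cancel₀ e3, map_one, one_mul,
      add_tsub_cancel_right]
  rw [← h1, ← expCoeff_succ, expCoeff_eq_sum, sum_range_succ']
  rw [stirlingSecond_succ_zero]
  simp only [mul_zero, Nat.cast_zero, add_zero]
  refine sum_congr rfl fun j _ => ?_
  rw [hI, coeff_mk]
  simp only [logDefectPow, coeff_mk, add_tsub_cancel_right]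
  have e3 : (j + 1 : ℚ) ≠ 0 := by positivity
  have e4 : (j ! : ℚ) ≠ 0 := by positivity
  have := congrArg (algebraMap ℚ R) (show ((j + 1 : ℕ) : ℚ)⁻¹ *
      ((-1) ^ j * assocStirlingFirst j k / j !) *
      ((j + 1)! * stirlingSecond (m + 1) (j + 1) : ℕ) =
      (-1) ^ j * assocStirlingFirst j k * stirlingSecond (m + 1) (j + 1) by
    rw [factorial_succ]; push_cast; field_simp)
  simp only [map_mul, map_natCast, map_pow, map_neg, map_one] at this ⊢
  rw [← this]
  ring

lemma lagrangeCoeff_X {N m : ℕ} (hN : m + 1 < N) :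
    lagrangeCoeff t N (m + 1) X = ∑ k ∈ range N, ∑ j ∈ range (m + k + 1),
      ((-1) ^ j * assocStirlingFirst j k * stirlingSecond (m + k + 1) (j + 1)) * t ^ (j - k) := by
  rw [lagrangeCoeff_succ t hN]
  refine sum_congr rfl fun k _ => ?_
  rw [← expCoeff_logDefectPow]
  simp [expDeriv]

/-- Binomial convolution recursions turn into products of exponential generating functions. -/
lemma mk_convolution (a u : ℕ → R) :
    PowerSeries.mk (fun m => algebraMap ℚ R (m ! : ℚ)⁻¹ *
      ∑ k ∈ range m, (m.choose k : R) * a k * u (m - 1 - k)) =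
    PowerSeries.mk (fun m => algebraMap ℚ R (m ! : ℚ)⁻¹ * a m) *
      PowerSeries.mk (fun m => if m = 0 then 0 else algebraMap ℚ R (m ! : ℚ)⁻¹ * u (m - 1)) := by
  ext m
  rw [coeff_mul, Nat.sum_antidiagonal_eq_sum_range_succ_mk, sum_range_succ]
  simp only [coeff_mk, tsub_self, if_true, mul_zero, add_zero, mul_sum]
  refine sum_congr rfl fun k hk => ?_
  have hk := mem_range.1 hk
  rw [if_neg (by omega), show m - k - 1 = m - 1 - k by omega, ← map_natCast (algebraMap ℚ R),
    Nat.cast_choose ℚ hk.le]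
  have := congrArg (algebraMap ℚ R) (show (m ! : ℚ)⁻¹ * (m ! / (k ! * (m - k)!)) =
    (k ! : ℚ)⁻¹ * ((m - k)! : ℚ)⁻¹ by field_simp)
  simp only [map_mul] at this
  linear_combination a k * u (m - 1 - k) * this

/-- The recursions become U' = A(1 + tU) = B(1 + U) and A + B = U' + 1. Eliminating A and B leaves
an equation for U alone, to which Lagrange inversion applies with g = X. -/
theorem eq_sum_of_recursion {u a b : ℕ → R}
    (ha : ∀ m, u m = a m + t * ∑ k ∈ range m, (m.choose k : R) * a k * u (m - 1 - k))
    (hb : ∀ m, u m = b m + ∑ k ∈ range m, (m.choose k : R) * b k * u (m - 1 - k))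
    (hab : ∀ m, a m + b m = u m + if m = 0 then 1 else 0) {N m : ℕ} (hN : m + 1 < N) :
    u m = ∑ k ∈ range N, ∑ j ∈ range (m + k + 1),
      ((-1) ^ j * assocStirlingFirst j k * stirlingSecond (m + k + 1) (j + 1)) * t ^ (j - k) := by
  set U : R⟦X⟧ := PowerSeries.mk
    (fun m => if m = 0 then 0 else algebraMap ℚ R (m ! : ℚ)⁻¹ * u (m - 1)) with hUdef
  set A : R⟦X⟧ := PowerSeries.mk (fun m => algebraMap ℚ R (m ! : ℚ)⁻¹ * a m) with hA
  set B : R⟦X⟧ := PowerSeries.mk (fun m => algebraMap ℚ R (m ! : ℚ)⁻¹ * b m) with hB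
  have hcancel (m : ℕ) : algebraMap ℚ R (m ! : ℚ) * algebraMap ℚ R (m ! : ℚ)⁻¹ = 1 := by
    rw [← map_mul, mul_inv_cancel₀ (by positivity), map_one]
  have hD : d⁄dX R U = PowerSeries.mk (fun m => algebraMap ℚ R (m ! : ℚ)⁻¹ * u m) := by
    ext m
    rw [coeff_derivative, hUdef, coeff_mk, coeff_mk, if_neg (by omega), add_tsub_cancel_right]
    have := congrArg (algebraMap ℚ R) (show ((m + 1)! : ℚ)⁻¹ * (m + 1) = (m ! : ℚ)⁻¹ by
      rw [factorial_succ]; push_cast; field_simp)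
    simp only [map_mul, map_add, map_natCast, map_one] at this
    linear_combination u m * this
  have h1 : d⁄dX R U = A * (1 + C t * U) := by
    rw [mul_add, mul_one, mul_left_comm, hUdef, hA, ← mk_convolution, ← hUdef, hD]
    ext m
    rw [map_add, coeff_C_mul, coeff_mk, coeff_mk, coeff_mk, ha]
    ring
  have h2 : d⁄dX R U = B * (1 + U) := by
    rw [mul_add, mul_one, hUdef, hB, ← mk_convolution, ← hUdef, hD]
    ext m
    rw [map_add, coeff_mk, coeff_mk, coeff_mk, hb]
    ring
  have h3 : A + B = d⁄dX R U + 1 := by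
    rw [hD]
    ext m
    rw [map_add, map_add, coeff_mk, coeff_mk, coeff_mk, ← mul_add, hab, coeff_one]
    split_ifs with h
    · subst h; simp
    · simp
  have hU0 : constantCoeff U = 0 := by
    rw [← coeff_zero_eq_constantCoeff_apply, hUdef, coeff_mk, if_pos rfl]
  -- Multiply A + B = U' + 1 by (1 + U)(1 + tU) and substitute the two product formulas.
  have hode : d⁄dX R U * (1 - C t * U ^ 2) = (1 + U) * (1 + C t * U) := by
    linear_combination (1 + U) * h1 + (1 + C t * U) * h2 + (1 + U) * (1 + C t * U) * h3
  rw [← lagrangeCoeff_X t hN, ← constantCoeff_iterate_derivative_subst t hU0 hode hN,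
    subst_X (HasSubst.of_constantCoeff_zero' hU0), Function.iterate_succ_apply,
    constantCoeff_iterate_derivative, hD, coeff_mk, ← mul_assoc, ← map_natCast (algebraMap ℚ R),
    hcancel, one_mul]

end Lagrange

/-! ### Read-once Boolean functions and their splittings as conjunctions. -/

section Nets

variable {γ : Type*}

/-- The dual of a Boolean function. -/
def boolDual (f : Set γ → Prop) : Set γ → Prop := fun x => ¬ f xᶜ

/-- `f` is the conjunction of a function of the variables in `A` and a function of the others. -/
def AndSplit (f : Set γ → Prop) (A : Set γ) : Prop :=
  ∀ x, f x ↔ f (x ∪ Aᶜ) ∧ f (x ∪ A)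

/-- `f`, a function of the variables in `E`, is a conjunction in a nontrivial way. -/
def AndDecomposable (E : Finset γ) (f : Set γ → Prop) : Prop :=
  ∃ A : Finset γ, A ⊆ E ∧ A.Nonempty ∧ A ≠ E ∧ AndSplit f A

lemma boolDual_boolDual (f : Set γ → Prop) : boolDual (boolDual f) = f := by
  funext x; simp [boolDual]

lemma AndSplit.compl {f : Set γ → Prop} {A : Set γ} (hA : AndSplit f A) : AndSplit f Aᶜ := fun x => by
  rw [compl_compl, and_comm]; exact hA x

lemma AndSplit.restrict {f : Set γ → Prop} {S C : Set γ} (hC : AndSplit f C) :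
    AndSplit (fun x => f (x ∪ Sᶜ)) C := fun x => by
  have := hC (x ∪ Sᶜ)
  rwa [Set.union_right_comm x Sᶜ Cᶜ, Set.union_right_comm x Sᶜ C] at this

lemma not_andDecomposable_of_card_le_one {E : Finset γ} {f : Set γ → Prop} (hE : E.card ≤ 1) : ¬ AndDecomposable E f := by
  rintro ⟨A, hAE, hne, hne', -⟩
  have h1 := Finset.card_pos.2 hne
  exact hne' (Finset.eq_of_subset_of_card_le hAE (by omega))

variable [DecidableEq γ]

/-- Read-once monotone Boolean functions: `ReadOnce A f a b` says that `f` is given by a formula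
which uses each variable of `A` exactly once, `a` conjunctions and `b` disjunctions. -/
inductive ReadOnce : Finset γ → (Set γ → Prop) → ℕ → ℕ → Prop
  | leaf (i : γ) : ReadOnce {i} (fun x => i ∈ x) 0 0
  | and {A B : Finset γ} {f g : Set γ → Prop} {a b c d : ℕ} (hf : ReadOnce A f a b)
      (hg : ReadOnce B g c d) (hAB : Disjoint A B) :
      ReadOnce (A ∪ B) (fun x => f x ∧ g x) (a + c + 1) (b + d)
  | or {A B : Finset γ} {f g : Set γ → Prop} {a b c d : ℕ} (hf : ReadOnce A f a b)
      (hg : ReadOnce B g c d) (hAB : Disjoint A B) :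
      ReadOnce (A ∪ B) (fun x => f x ∨ g x) (a + c) (b + d + 1)

namespace ReadOnce

variable {E A B : Finset γ} {f g : Set γ → Prop} {a b c d : ℕ}

lemma congr_counts (h : ReadOnce E f a b) (hc : a = c) (hd : b = d) : ReadOnce E f c d :=
  hc ▸ hd ▸ h

lemma nonempty (h : ReadOnce E f a b) : E.Nonempty := by
  induction h with
  | leaf i => simp
  | and _ _ _ ih _ => exact ih.mono Finset.subset_union_left
  | or _ _ _ ih _ => exact ih.mono Finset.subset_union_left

lemma card_eq (h : ReadOnce E f a b) : E.card = a + b + 1 := by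
  induction h with
  | leaf i => simp
  | and _ _ h ih ih' => rw [Finset.card_union_of_disjoint h]; omega
  | or _ _ h ih ih' => rw [Finset.card_union_of_disjoint h]; omega

lemma congr_on (h : ReadOnce E f a b) {x y : Set γ} (hxy : ∀ i ∈ E, i ∈ x ↔ i ∈ y) :
    f x ↔ f y := by
  induction h with
  | leaf i => exact hxy i (by simp)
  | and _ _ _ ih ih' =>
    exact and_congr (ih fun i hi => hxy i (by simp [hi])) (ih' fun i hi => hxy i (by simp [hi]))
  | or _ _ _ ih ih' =>
    exact or_congr (ih fun i hi => hxy i (by simp [hi])) (ih' fun i hi => hxy i (by simp [hi]))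

lemma mono (h : ReadOnce E f a b) {x y : Set γ} (hxy : x ⊆ y) (hx : f x) : f y := by
  induction h with
  | leaf i => exact hxy hx
  | and _ _ _ ih ih' => exact ⟨ih hx.1, ih' hx.2⟩
  | or _ _ _ ih ih' => exact hx.imp ih ih'

lemma not_empty (h : ReadOnce E f a b) : ¬ f ∅ := by
  induction h with
  | leaf i => simp
  | and _ _ _ ih ih' => exact fun h => ih h.1
  | or _ _ _ ih ih' => exact fun h => h.elim ih ih'

lemma univ (h : ReadOnce E f a b) : f Set.univ := by
  induction h with
  | leaf i => simp
  | and _ _ _ ih ih' => exact ⟨ih, ih'⟩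
  | or _ _ _ ih ih' => exact Or.inl ih

lemma of_subset (h : ReadOnce E f a b) {x : Set γ} (hx : ↑E ⊆ x) : f x :=
  (h.congr_on fun i hi => by simp [hx hi]).2 h.univ

lemma not_of_disjoint (h : ReadOnce E f a b) {x : Set γ} (hx : ∀ i ∈ E, i ∉ x) : ¬ f x :=
  fun hf => h.not_empty ((h.congr_on fun i hi => by simp [hx i hi]).1 hf)

/-- No variable is redundant: fix the sibling subformula to true at a conjunction and to false at a
disjunction, and recurse into the part containing i. -/
lemma exists_pivotal (h : ReadOnce E f a b) {i : γ} (hi : i ∈ E) :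
    ∃ x, ¬ f x ∧ f (insert i x) := by
  have key : ∀ {A B : Finset γ} {f g : Set γ → Prop} {a b c d : ℕ}, ReadOnce A f a b →
      ReadOnce B g c d → Disjoint A B → (∃ x, ¬ f x ∧ f (insert i x)) → i ∈ A →
      (∃ x, ¬ (f x ∧ g x) ∧ (f (insert i x) ∧ g (insert i x))) ∧
      (∃ x, ¬ (f x ∨ g x) ∧ (f (insert i x) ∨ g (insert i x))) := by
    rintro A B f g a b c d hf hg hAB ⟨x, hx, hx'⟩ hiA
    rw [Finset.disjoint_left] at hAB
    constructor
    · refine ⟨(x ∩ A) ∪ B, fun h => hx ((hf.congr_on fun j hj => ?_).1 h.1),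
        (hf.congr_on fun j hj => ?_).1 hx', hg.of_subset fun j hj => Or.inr (Or.inr hj)⟩
      · simp [hj, hAB hj]
      · simp [hj, hAB hj]
    · refine ⟨x ∩ A, fun h => h.elim (fun h => hx ((hf.congr_on fun j hj => ?_).1 h))
        (hg.not_of_disjoint fun j hj hj' => hAB hj'.2 hj),
        Or.inl ((hf.congr_on fun j hj => ?_).1 hx')⟩
      · simp [hj]
      · simp [hj]
  induction h with
  | leaf j => exact ⟨∅, by simp, by simpa using (Finset.mem_singleton.1 hi).symm⟩
  | and hf hg hAB ih ih' =>
    rcases Finset.mem_union.1 hi with hi | hi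
    · exact (key hf hg hAB (ih hi) hi).1
    · obtain ⟨x, hx⟩ := (key hg hf hAB.symm (ih' hi) hi).1
      exact ⟨x, by tauto, by tauto⟩
  | or hf hg hAB ih ih' =>
    rcases Finset.mem_union.1 hi with hi | hi
    · exact (key hf hg hAB (ih hi) hi).2
    · obtain ⟨x, hx⟩ := (key hg hf hAB.symm (ih' hi) hi).2
      exact ⟨x, by tauto, by tauto⟩

lemma dual (h : ReadOnce E f a b) : ReadOnce E (boolDual f) b a := by
  induction h with
  | leaf i =>
    have : boolDual (fun x : Set γ => i ∈ x) = fun x => i ∈ x := by funext x; simp [boolDual]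
    rw [this]; exact .leaf i
  | @and A B f g a b c d _ _ h ih ih' =>
    have : boolDual (fun x : Set γ => f x ∧ g x) = fun x => boolDual f x ∨ boolDual g x := by
      funext x; simp only [boolDual, eq_iff_iff]; tauto
    rw [this]; exact ih.or ih' h
  | @or A B f g a b c d _ _ h ih ih' =>
    have : boolDual (fun x : Set γ => f x ∨ g x) = fun x => boolDual f x ∧ boolDual g x := by
      funext x; simp only [boolDual, eq_iff_iff]; tauto
    rw [this]; exact ih.and ih' h

lemma andSplit_self (h : ReadOnce E f a b) : AndSplit f E := fun x =>
  ⟨fun hx => ⟨h.mono Set.subset_union_left hx, h.mono Set.subset_union_left hx⟩,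
    fun hx => (h.congr_on fun i hi => by simp [hi]).1 hx.1⟩

lemma andSplit_iff (h : ReadOnce E f a b) {A : Set γ} :
    AndSplit f A ↔ ∀ x, f (x ∪ Aᶜ) → f (x ∪ A) → f x :=
  ⟨fun hs x h1 h2 => (hs x).2 ⟨h1, h2⟩, fun hs x =>
    ⟨fun hx => ⟨h.mono Set.subset_union_left hx, h.mono Set.subset_union_left hx⟩,
      fun hx => hs x hx.1 hx.2⟩⟩

/-- Together with `AndSplit.compl` this makes the splitting sets a Boolean algebra; its atoms will
be the unique indecomposable conjunctive factors. -/
lemma andSplit_inter (h : ReadOnce E f a b) {A B : Set γ} (hA : AndSplit f A)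
    (hB : AndSplit f B) : AndSplit f (A ∩ B) := by
  rw [h.andSplit_iff] at hA hB ⊢
  intro x h1 h2
  refine hA x (hB _ (h.mono ?_ h1) (h.mono ?_ h2)) (h.mono ?_ h2)
  · intro i; simp; tauto
  · intro i; simp; tauto
  · intro i; simp; tauto

lemma andSplit_congr (h : ReadOnce E f a b) {A B : Set γ} (hAB : ∀ i ∈ E, i ∈ A ↔ i ∈ B)
    (hA : AndSplit f A) : AndSplit f B := by
  rw [h.andSplit_iff] at hA ⊢
  intro x h1 h2
  exact hA x ((h.congr_on fun i hi => by simp [hAB i hi]).1 h1)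
    ((h.congr_on fun i hi => by simp [hAB i hi]).1 h2)

lemma andSplit_and (hf : ReadOnce A f a b) (hg : ReadOnce B g c d) (hAB : Disjoint A B) :
    AndSplit (fun x => f x ∧ g x) (A : Set γ) := by
  rw [(hf.and hg hAB).andSplit_iff]
  rw [Finset.disjoint_left] at hAB
  intro x h1 h2
  exact ⟨(hf.congr_on fun i hi => by simp [hi]).1 h1.1,
    (hg.congr_on fun i hi => by simp [show i ∉ A from fun h => hAB h hi]).1 h2.2⟩

/-- If S split f ∨ g, then making f true only inside S and g true only outside S would suffice, so
one of S, Sᶜ alone makes the disjunction true. A pivotal variable outside that set would then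
contradict the splitting. -/
lemma subset_or_disjoint_of_andSplit_or (hf : ReadOnce A f a b) (hg : ReadOnce B g c d)
    (hAB : Disjoint A B) {S : Set γ} (hS : AndSplit (fun x => f x ∨ g x) S) :
    (∀ i ∈ A ∪ B, i ∈ S) ∨ (∀ i ∈ A ∪ B, i ∉ S) := by
  have h := hf.or hg hAB
  have key : ∀ {S : Set γ}, AndSplit (fun x => f x ∨ g x) S → (f S ∨ g S) →
      ∀ i ∈ A ∪ B, i ∈ S := by
    intro S hS hfS i hi
    by_contra hiS
    obtain ⟨x, hx, hx'⟩ := h.exists_pivotal hi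
    refine hx ((hS x).2 ⟨h.mono ?_ hx', h.mono Set.subset_union_right hfS⟩)
    rintro j (rfl | hj)
    · exact Or.inr hiS
    · exact Or.inl hj
  -- Adding Sᶜ to this set covers A, and adding S covers B, so both conditions of the splitting
  -- hold.
  have h1 : f ((A ∩ S) ∪ (B ∩ Sᶜ)) ∨ g ((A ∩ S) ∪ (B ∩ Sᶜ)) := by
    refine (hS _).2 ⟨Or.inl (hf.of_subset ?_), Or.inr (hg.of_subset ?_)⟩
    · intro i hi; by_cases i ∈ S <;> simp_all
    · intro i hi; by_cases i ∈ S <;> simp_all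
  rw [Finset.disjoint_left] at hAB
  rcases h1 with h1 | h1
  · refine Or.inl (key hS (Or.inl (hf.mono (x := A ∩ S) (fun i hi => hi.2) ?_)))
    exact (hf.congr_on fun i hi => by simp [hi, hAB hi]).1 h1
  · refine Or.inr (key hS.compl (Or.inr (hg.mono (x := B ∩ Sᶜ) (fun i hi => hi.2) ?_)))
    exact (hg.congr_on fun i hi => by simp [hi, show i ∉ A from fun h => hAB h hi]).1 h1

/-- A splitting of a conjunction induces splittings of its two factors, and a disjunction can only
be split trivially; so fixing the variables outside S to true just deletes subformulas. -/
lemma restrict_of_andSplit (h : ReadOnce E f a b) {S : Set γ} [DecidablePred (· ∈ S)]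
    (hS : AndSplit f S) (hne : ∃ i ∈ E, i ∈ S) :
    ∃ c d, ReadOnce (E.filter (· ∈ S)) (fun x => f (x ∪ Sᶜ)) c d := by
  induction h with
  | leaf i =>
    have hi : i ∈ S := by simpa using hne
    refine ⟨0, 0, ?_⟩
    have h1 : ({i} : Finset γ).filter (· ∈ S) = {i} := by
      rw [Finset.filter_eq_self]; simpa using hi
    have h2 : (fun x : Set γ => i ∈ x ∪ Sᶜ) = fun x => i ∈ x := by funext x; simp [hi]
    rw [h1, h2]
    exact .leaf i
  | @and A B f g a b c d hf hg hAB ih ih' =>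
    have hA : AndSplit f S := by
      rw [hf.andSplit_iff]
      intro x h1 h2
      have hag : ∀ i ∈ A, i ∈ x ∪ (A : Set γ)ᶜ ↔ i ∈ x := fun i hi => by simp [hi]
      rw [← hf.congr_on hag]
      refine ((hS (x ∪ (A : Set γ)ᶜ)).2 ⟨⟨?_, ?_⟩, ?_, ?_⟩).1
      · exact hf.mono (by intro i; simp; tauto) h1
      · exact hg.of_subset fun i hi => by simp [Finset.disjoint_right.1 hAB hi]
      · exact hf.mono (by intro i; simp; tauto) h2
      · exact hg.of_subset fun i hi => by simp [Finset.disjoint_right.1 hAB hi]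
    have hB : AndSplit g S := by
      rw [hg.andSplit_iff]
      intro x h1 h2
      have hag : ∀ i ∈ B, i ∈ x ∪ (B : Set γ)ᶜ ↔ i ∈ x := fun i hi => by simp [hi]
      rw [← hg.congr_on hag]
      refine ((hS (x ∪ (B : Set γ)ᶜ)).2 ⟨⟨?_, ?_⟩, ?_, ?_⟩).2
      · exact hf.of_subset fun i hi => by simp [Finset.disjoint_left.1 hAB hi]
      · exact hg.mono (by intro i; simp; tauto) h1
      · exact hf.of_subset fun i hi => by simp [Finset.disjoint_left.1 hAB hi]
      · exact hg.mono (by intro i; simp; tauto) h2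
    rw [Finset.filter_union]
    by_cases hneA : ∃ i ∈ A, i ∈ S
    · obtain ⟨a', b', hA'⟩ := ih hA hneA
      by_cases hneB : ∃ i ∈ B, i ∈ S
      · obtain ⟨c', d', hB'⟩ := ih' hB hneB
        exact ⟨_, _, hA'.and hB' (Finset.disjoint_filter_filter hAB)⟩
      · push Not at hneB
        refine ⟨a', b', ?_⟩
        rw [Finset.filter_eq_empty_iff.2 fun i hi => hneB i hi, Finset.union_empty]
        have : (fun x : Set γ => f (x ∪ Sᶜ) ∧ g (x ∪ Sᶜ)) = fun x => f (x ∪ Sᶜ) := by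
          funext x
          simp [hg.of_subset (x := x ∪ Sᶜ) fun i hi => Or.inr (hneB i hi)]
        rwa [this]
    · by_cases hneB : ∃ i ∈ B, i ∈ S
      · obtain ⟨c', d', hB'⟩ := ih' hB hneB
        push Not at hneA
        refine ⟨c', d', ?_⟩
        rw [Finset.filter_eq_empty_iff.2 fun i hi => hneA i hi, Finset.empty_union]
        have : (fun x : Set γ => f (x ∪ Sᶜ) ∧ g (x ∪ Sᶜ)) = fun x => g (x ∪ Sᶜ) := by
          funext x
          simp [hf.of_subset (x := x ∪ Sᶜ) fun i hi => Or.inr (hneA i hi)]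
        rwa [this]
      · obtain ⟨i, hi, hiS⟩ := hne
        rcases Finset.mem_union.1 hi with hi | hi
        · exact absurd ⟨i, hi, hiS⟩ hneA
        · exact absurd ⟨i, hi, hiS⟩ hneB
  | @or A B f g a b c d hf hg hAB ih ih' =>
    rcases subset_or_disjoint_of_andSplit_or hf hg hAB hS with h1 | h1
    · rw [Finset.filter_eq_self.2 h1]
      have h := hf.or hg hAB
      have : (fun x : Set γ => f (x ∪ Sᶜ) ∨ g (x ∪ Sᶜ)) = fun x => f x ∨ g x := by
        funext x
        exact propext (h.congr_on fun i hi => by simp [h1 i hi])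
      rw [this]
      exact ⟨_, _, h⟩
    · obtain ⟨i, hi, hiS⟩ := hne
      exact absurd hiS (h1 i hi)

lemma not_andDecomposable_or (hf : ReadOnce A f a b) (hg : ReadOnce B g c d)
    (hAB : Disjoint A B) : ¬ AndDecomposable (A ∪ B) (fun x => f x ∨ g x) := by
  rintro ⟨S, hSE, ⟨i, hi⟩, hne', hS⟩
  rcases subset_or_disjoint_of_andSplit_or hf hg hAB hS with h1 | h1
  · exact hne' (Finset.Subset.antisymm hSE h1)
  · exact h1 i (hSE hi) hi

lemma andDecomposable_and (hf : ReadOnce A f a b) (hg : ReadOnce B g c d)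
    (hAB : Disjoint A B) : AndDecomposable (A ∪ B) (fun x => f x ∧ g x) := by
  refine ⟨A, Finset.subset_union_left, hf.nonempty, ?_, hf.andSplit_and hg hAB⟩
  obtain ⟨i, hi⟩ := hg.nonempty
  intro h
  exact Finset.disjoint_right.1 hAB hi (h ▸ Finset.mem_union_right _ hi)

/-- With at least two variables there is a top connective; duality exchanges ∧ and ∨ there, and a
disjunction is never a nontrivial conjunction. -/
lemma andDecomposable_dual_iff (h : ReadOnce E f a b) (hE : 2 ≤ E.card) :
    AndDecomposable E (boolDual f) ↔ ¬ AndDecomposable E f := by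
  cases h with
  | leaf i => simp at hE
  | @and A B f g a b c d hf hg hAB =>
    have : boolDual (fun x : Set γ => f x ∧ g x) = fun x => boolDual f x ∨ boolDual g x := by
      funext x; simp only [boolDual, eq_iff_iff]; tauto
    rw [this]
    have h1 := hf.dual.not_andDecomposable_or hg.dual hAB
    have h2 := hf.andDecomposable_and hg hAB
    tauto
  | @or A B f g a b c d hf hg hAB =>
    have : boolDual (fun x : Set γ => f x ∨ g x) = fun x => boolDual f x ∧ boolDual g x := by
      funext x; simp only [boolDual, eq_iff_iff]; tauto
    rw [this]
    have h1 := hf.not_andDecomposable_or hg hAB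
    have h2 := hf.dual.andDecomposable_and hg.dual hAB
    tauto

lemma andSplit_of_restrict (h : ReadOnce E f a b) {S C : Set γ} (hS : AndSplit f S) (hCS : C ⊆ S)
    (hC : AndSplit (fun x => f (x ∪ Sᶜ)) C) : AndSplit f C := by
  rw [h.andSplit_iff]
  intro x h1 h2
  refine (hS x).2 ⟨(hC x).2 ⟨h.mono (by intro i; simp; tauto) h1,
    h.mono (by intro i; simp; tauto) h2⟩, h.mono ?_ h2⟩
  rintro i (hi | hi)
  · exact Or.inl hi
  · exact Or.inr (hCS hi)

lemma and_restrict_left (hf : ReadOnce A f a b) (hg : ReadOnce B g c d) (hAB : Disjoint A B) :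
    (fun x : Set γ => f (x ∪ (A : Set γ)ᶜ) ∧ g (x ∪ (A : Set γ)ᶜ)) = f := by
  funext x
  rw [hf.congr_on (y := x) fun i hi => by simp [hi], eq_iff_iff, and_iff_left_iff_imp]
  exact fun _ => hg.of_subset fun i hi => Or.inr fun h => Finset.disjoint_right.1 hAB hi h

lemma and_restrict_right (hf : ReadOnce A f a b) (hg : ReadOnce B g c d) (hAB : Disjoint A B) :
    (fun x : Set γ => f (x ∪ A) ∧ g (x ∪ A)) = g := by
  funext x
  rw [hg.congr_on (y := x) fun i hi => by simp [Finset.disjoint_right.1 hAB hi], eq_iff_iff,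
    and_iff_right_iff_imp]
  exact fun _ => hf.of_subset fun i hi => Or.inr hi

end ReadOnce

end Nets

/-! ### Series and parallel extensions of binary spaces as substitutions in read-once functions. -/

section SPSpaces

variable {γ : Type*}

/-- Substitution of `g ∨ h` for the variable `g`. -/
def orSubst (g h : γ) (x : Set γ) : Set γ := x ∪ {y | y = g ∧ h ∈ x}

/-- Substitution of `g ∧ h` for the variable `g`. -/
def andSubst (g h : γ) (x : Set γ) : Set γ := x \ {y | y = g ∧ h ∉ x}

lemma mem_orSubst_of_ne {g h i : γ} (hi : i ≠ g) (x : Set γ) : i ∈ orSubst g h x ↔ i ∈ x := by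
  simp [orSubst, hi]

lemma mem_andSubst_of_ne {g h i : γ} (hi : i ≠ g) (x : Set γ) : i ∈ andSubst g h x ↔ i ∈ x := by
  simp [andSubst, hi]

lemma boolDual_comp_orSubst (f : Set γ → Prop) (g h : γ) :
    boolDual (fun x => f (orSubst g h x)) = fun x => boolDual f (andSubst g h x) := by
  funext x
  have : orSubst g h xᶜ = (andSubst g h x)ᶜ := by
    ext y; simp [orSubst, andSubst]; tauto
  simp [boolDual, this]

variable [DecidableEq γ]

namespace ReadOnce

variable {A : Finset γ} {f : Set γ → Prop} {a b : ℕ} {g h : γ}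

lemma comp_orSubst (hf : ReadOnce A f a b) (hg : g ∈ A) (hh : h ∉ A) :
    ReadOnce (insert h A) (fun x => f (orSubst g h x)) a (b + 1) := by
  induction hf with
  | leaf i =>
    obtain rfl : g = i := by simpa using hg
    have h1 : (fun x : Set γ => g ∈ orSubst g h x) = fun x => g ∈ x ∨ h ∈ x := by
      funext x; simp [orSubst]
    have h2 : insert h ({g} : Finset γ) = {g} ∪ {h} := by ext; simp; tauto
    rw [h1, h2]
    exact (ReadOnce.leaf g).or (.leaf h) (by simpa using fun h => hh (by simp [h]))
  | @and A B f f' a b c d hf hf' hAB ih ih' =>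
    rw [Finset.notMem_union] at hh
    rcases Finset.mem_union.1 hg with hg | hg
    · have h1 : (fun x => f (orSubst g h x) ∧ f' (orSubst g h x)) =
          fun x => f (orSubst g h x) ∧ f' x := by
        funext x
        rw [hf'.congr_on fun i hi => mem_orSubst_of_ne ?_ x]
        rintro rfl; exact Finset.disjoint_left.1 hAB hg hi
      rw [h1, ← Finset.insert_union]
      exact ((ih hg hh.1).and hf' (by simp [hh.2, hAB])).congr_counts rfl (by omega)
    · have h1 : (fun x => f (orSubst g h x) ∧ f' (orSubst g h x)) =
          fun x => f x ∧ f' (orSubst g h x) := by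
        funext x
        rw [hf.congr_on fun i hi => mem_orSubst_of_ne ?_ x]
        rintro rfl; exact Finset.disjoint_left.1 hAB hi hg
      rw [h1, ← Finset.union_insert]
      exact (hf.and (ih' hg hh.2) (by simp [hh.1, hAB])).congr_counts rfl (by omega)
  | @or A B f f' a b c d hf hf' hAB ih ih' =>
    rw [Finset.notMem_union] at hh
    rcases Finset.mem_union.1 hg with hg | hg
    · have h1 : (fun x => f (orSubst g h x) ∨ f' (orSubst g h x)) =
          fun x => f (orSubst g h x) ∨ f' x := by
        funext x
        rw [hf'.congr_on fun i hi => mem_orSubst_of_ne ?_ x]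
        rintro rfl; exact Finset.disjoint_left.1 hAB hg hi
      rw [h1, ← Finset.insert_union]
      exact ((ih hg hh.1).or hf' (by simp [hh.2, hAB])).congr_counts rfl (by omega)
    · have h1 : (fun x => f (orSubst g h x) ∨ f' (orSubst g h x)) =
          fun x => f x ∨ f' (orSubst g h x) := by
        funext x
        rw [hf.congr_on fun i hi => mem_orSubst_of_ne ?_ x]
        rintro rfl; exact Finset.disjoint_left.1 hAB hi hg
      rw [h1, ← Finset.union_insert]
      exact (hf.or (ih' hg hh.2) (by simp [hh.1, hAB])).congr_counts rfl (by omega)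

lemma comp_andSubst (hf : ReadOnce A f a b) (hg : g ∈ A) (hh : h ∉ A) :
    ReadOnce (insert h A) (fun x => f (andSubst g h x)) (a + 1) b := by
  have := (hf.dual.comp_orSubst hg hh).dual
  rwa [boolDual_comp_orSubst, boolDual_boolDual] at this

/-- A read-once function of at least two variables arises from a smaller one by splitting a
variable. -/
lemma exists_subst (hf : ReadOnce A f a b) :
    (∃ i, A = {i} ∧ (f = fun x => i ∈ x) ∧ a = 0 ∧ b = 0) ∨
    ∃ (g h : γ) (B : Finset γ) (f' : Set γ → Prop) (a' b' : ℕ), g ∈ B ∧ h ∉ B ∧ A = insert h B ∧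
      ReadOnce B f' a' b' ∧
      (((f = fun x => f' (orSubst g h x)) ∧ a = a' ∧ b = b' + 1) ∨
        ((f = fun x => f' (andSubst g h x)) ∧ a = a' + 1 ∧ b = b')) := by
  induction hf with
  | leaf i => exact Or.inl ⟨i, rfl, rfl, rfl, rfl⟩
  | @and A B f f' a b c d hf hf' hAB ih ih' =>
    right
    rcases ih with ⟨i, rfl, rfl, rfl, rfl⟩ | ⟨g, h, A', f₀, a', b', hg, hh, rfl, hf₀, hsub⟩
    · rcases ih' with ⟨j, rfl, rfl, rfl, rfl⟩ | ⟨g, h, B', f₀, a', b', hg, hh, rfl, hf₀, hsub⟩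
      · have hij : i ≠ j := by simpa using hAB
        refine ⟨i, j, {i}, _, 0, 0, by simp, by simpa using hij.symm, by ext; simp; tauto,
          .leaf i, Or.inr ⟨?_, rfl, rfl⟩⟩
        funext x; simp [andSubst]
      · rw [Finset.disjoint_insert_right] at hAB
        have hgi : i ≠ g := by rintro rfl; exact Finset.disjoint_left.1 hAB.2 (by simp) hg
        refine ⟨g, h, {i} ∪ B', _, _, _, Finset.mem_union_right _ hg,
          by rw [Finset.notMem_union]; exact ⟨hAB.1, hh⟩, by rw [Finset.union_insert],
          (ReadOnce.leaf i).and hf₀ hAB.2, ?_⟩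
        rcases hsub with ⟨rfl, rfl, rfl⟩ | ⟨rfl, rfl, rfl⟩
        · exact Or.inl ⟨by funext x; rw [mem_orSubst_of_ne hgi], rfl, by omega⟩
        · exact Or.inr ⟨by funext x; rw [mem_andSubst_of_ne hgi], by omega, rfl⟩
    · rw [Finset.disjoint_insert_left] at hAB
      have hgi : ∀ i ∈ B, i ≠ g := by rintro i hi rfl; exact Finset.disjoint_left.1 hAB.2 hg hi
      refine ⟨g, h, A' ∪ B, _, _, _, Finset.mem_union_left _ hg,
        by rw [Finset.notMem_union]; exact ⟨hh, hAB.1⟩, by rw [Finset.insert_union],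
        hf₀.and hf' hAB.2, ?_⟩
      rcases hsub with ⟨rfl, rfl, rfl⟩ | ⟨rfl, rfl, rfl⟩
      · refine Or.inl ⟨?_, rfl, by omega⟩
        funext x; rw [hf'.congr_on fun i hi => mem_orSubst_of_ne (hgi i hi) x]
      · refine Or.inr ⟨?_, by omega, rfl⟩
        funext x; rw [hf'.congr_on fun i hi => mem_andSubst_of_ne (hgi i hi) x]
  | @or A B f f' a b c d hf hf' hAB ih ih' =>
    right
    rcases ih with ⟨i, rfl, rfl, rfl, rfl⟩ | ⟨g, h, A', f₀, a', b', hg, hh, rfl, hf₀, hsub⟩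
    · rcases ih' with ⟨j, rfl, rfl, rfl, rfl⟩ | ⟨g, h, B', f₀, a', b', hg, hh, rfl, hf₀, hsub⟩
      · have hij : i ≠ j := by simpa using hAB
        refine ⟨i, j, {i}, _, 0, 0, by simp, by simpa using hij.symm, by ext; simp; tauto,
          .leaf i, Or.inl ⟨?_, rfl, rfl⟩⟩
        funext x; simp [orSubst]
      · rw [Finset.disjoint_insert_right] at hAB
        have hgi : i ≠ g := by rintro rfl; exact Finset.disjoint_left.1 hAB.2 (by simp) hg
        refine ⟨g, h, {i} ∪ B', _, _, _, Finset.mem_union_right _ hg,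
          by rw [Finset.notMem_union]; exact ⟨hAB.1, hh⟩, by rw [Finset.union_insert],
          (ReadOnce.leaf i).or hf₀ hAB.2, ?_⟩
        rcases hsub with ⟨rfl, rfl, rfl⟩ | ⟨rfl, rfl, rfl⟩
        · exact Or.inl ⟨by funext x; rw [mem_orSubst_of_ne hgi], rfl, by omega⟩
        · exact Or.inr ⟨by funext x; rw [mem_andSubst_of_ne hgi], by omega, rfl⟩
    · rw [Finset.disjoint_insert_left] at hAB
      have hgi : ∀ i ∈ B, i ≠ g := by rintro i hi rfl; exact Finset.disjoint_left.1 hAB.2 hg hi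
      refine ⟨g, h, A' ∪ B, _, _, _, Finset.mem_union_left _ hg,
        by rw [Finset.notMem_union]; exact ⟨hh, hAB.1⟩, by rw [Finset.insert_union],
        hf₀.or hf' hAB.2, ?_⟩
      rcases hsub with ⟨rfl, rfl, rfl⟩ | ⟨rfl, rfl, rfl⟩
      · refine Or.inl ⟨?_, rfl, by omega⟩
        funext x; rw [hf'.congr_on fun i hi => mem_orSubst_of_ne (hgi i hi) x]
      · refine Or.inr ⟨?_, by omega, rfl⟩
        funext x; rw [hf'.congr_on fun i hi => mem_andSubst_of_ne (hgi i hi) x]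

end ReadOnce

lemma zmod_two_eq_one {x : ZMod 2} (hx : x ≠ 0) : x = 1 := by
  revert x; decide

lemma zmod_two_add_self (x : ZMod 2) : x + x = 0 := CharTwo.add_self_eq_zero x

/-- The linear map `v ↦ v` with the coordinate `h` added to the coordinate `g` and set to `0`. -/
def mergeMap (g h : γ) : (γ → ZMod 2) →ₗ[ZMod 2] (γ → ZMod 2) where
  toFun v i := if i = h then 0 else if i = g then v g + v h else v i
  map_add' v w := by
    funext i; simp only [Pi.add_apply]; split_ifs <;> ring
  map_smul' r v := by
    funext i; simp only [Pi.smul_apply, RingHom.id_apply, smul_eq_mul]; split_ifs <;> ring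

/-- The linear map setting the coordinate `h` to `0`. -/
def eraseMap (h : γ) : (γ → ZMod 2) →ₗ[ZMod 2] (γ → ZMod 2) where
  toFun v i := if i = h then 0 else v i
  map_add' v w := by
    funext i; simp only [Pi.add_apply]; split_ifs <;> ring
  map_smul' r v := by
    funext i; simp only [Pi.smul_apply, RingHom.id_apply, smul_eq_mul]; split_ifs <;> ring

/-- The linear map copying the coordinate `g` to the coordinate `h`. -/
def copyMap (g h : γ) : (γ → ZMod 2) →ₗ[ZMod 2] (γ → ZMod 2) where
  toFun v i := if i = h then v g else v i
  map_add' v w := by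
    funext i; simp only [Pi.add_apply]; split_ifs <;> ring
  map_smul' r v := by
    funext i; simp only [Pi.smul_apply, RingHom.id_apply, smul_eq_mul]; split_ifs <;> ring

lemma mergeMap_apply (g h : γ) (v : γ → ZMod 2) (i : γ) :
    mergeMap g h v i = if i = h then 0 else if i = g then v g + v h else v i := rfl

lemma eraseMap_apply (h : γ) (v : γ → ZMod 2) (i : γ) :
    eraseMap h v i = if i = h then 0 else v i := rfl

lemma copyMap_apply (g h : γ) (v : γ → ZMod 2) (i : γ) :
    copyMap g h v i = if i = h then v g else v i := rfl

lemma mergeMap_eq_self {g h : γ} {v : γ → ZMod 2} (hv : v h = 0) : mergeMap g h v = v := by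
  funext i
  rw [mergeMap_apply]
  split_ifs with h1 h2
  · rw [h1, hv]
  · rw [h2, hv, add_zero]
  · rfl

/-- Replacing g by its parallel twin h lifts a member of `Z` through g to a member of the parallel
extension avoiding g. -/
lemma mergeMap_exchange {g h : γ} (hgh : g ≠ h) {v : γ → ZMod 2} (hvh : v h = 0) (hvg : v g = 1) :
    mergeMap g h (fun i => if i = g then 0 else if i = h then 1 else v i) = v := by
  funext i
  rw [mergeMap_apply]
  by_cases h1 : i = h
  · rw [if_pos h1, h1, hvh]
  by_cases h2 : i = g
  · rw [if_neg h1, if_pos h2, if_pos rfl, if_neg hgh.symm, if_pos rfl, h2, hvg, zero_add]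
  · rw [if_neg h1, if_neg h2, if_neg h2, if_neg h1]

/-- The vector of the two-element set `{g, h}`. -/
def pairVec (g h : γ) : γ → ZMod 2 := fun i => if i = g ∨ i = h then 1 else 0

lemma mergeMap_pairVec (g h : γ) : mergeMap g h (pairVec g h) = 0 := by
  funext i
  rw [mergeMap_apply]
  simp only [pairVec, true_or, or_true, if_true, zmod_two_add_self, Pi.zero_apply]
  split_ifs with h1 h2 h3
  · rfl
  · rfl
  · tauto
  · rfl

lemma eraseMap_copyMap {g h : γ} {v : γ → ZMod 2} (hv : v h = 0) :
    eraseMap h (copyMap g h v) = v := by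
  funext i
  rw [eraseMap_apply]
  split_ifs with h1
  · rw [h1, hv]
  · rw [copyMap_apply, if_neg h1]

/-- `SPSpace E Z a`: the binary space `Z` is the cycle space of a series-parallel matroid on `E`
which is built from a two-element circuit using `a` series extensions. -/
inductive SPSpace : Finset γ → Submodule (ZMod 2) (γ → ZMod 2) → ℕ → Prop
  | base {Z : Submodule (ZMod 2) (γ → ZMod 2)} {i j : γ} (hij : i ≠ j)
      (hZ : ∀ v, v ∈ Z ↔ v i = v j ∧ ∀ k, k ≠ i → k ≠ j → v k = 0) : SPSpace {i, j} Z 0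
  | par {E : Finset γ} {Z W : Submodule (ZMod 2) (γ → ZMod 2)} {a : ℕ} {g h : γ}
      (hZ : SPSpace E Z a) (hg : g ∈ E) (hh : h ∉ E) (hW : ∀ v, v ∈ W ↔ mergeMap g h v ∈ Z) :
      SPSpace (insert h E) W a
  | ser {E : Finset γ} {Z W : Submodule (ZMod 2) (γ → ZMod 2)} {a : ℕ} {g h : γ}
      (hZ : SPSpace E Z a) (hg : g ∈ E) (hh : h ∉ E)
      (hW : ∀ v, v ∈ W ↔ v g = v h ∧ eraseMap h v ∈ Z) : SPSpace (insert h E) W (a + 1)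

/-- `x` contains `C \ {e}` for some member `C ∋ e` of the binary space `Z`. -/
def pathFn (Z : Submodule (ZMod 2) (γ → ZMod 2)) (e : γ) : Set γ → Prop :=
  fun x => ∃ v ∈ Z, v e = 1 ∧ ∀ i, v i ≠ 0 → i = e ∨ i ∈ x

/-- The members of `Z` with minimal support among those containing `e`. -/
def minimalThrough (Z : Submodule (ZMod 2) (γ → ZMod 2)) (e : γ) : Set (γ → ZMod 2) :=
  {v | v ∈ Z ∧ v e = 1 ∧ ∀ w ∈ Z, w e = 1 → (∀ i, w i ≠ 0 → v i ≠ 0) → w = v}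

section PathFn

variable {E : Finset γ} {Z W : Submodule (ZMod 2) (γ → ZMod 2)} {e g h : γ}

/-- When the root is one of the two parallel elements, its ends are joined either by the twin or by
an old path. -/
lemma pathFn_par_self (hgh : g ≠ h) (hZ : ∀ v ∈ Z, v h = 0)
    (hW : ∀ v, v ∈ W ↔ mergeMap g h v ∈ Z) :
    pathFn W h = fun x => g ∈ x ∨ pathFn Z g x := by
  funext x
  rw [eq_iff_iff]
  constructor
  · rintro ⟨v, hv, hvh, hsupp⟩
    by_cases hvg : v g = 0
    · refine Or.inr ⟨_, (hW v).1 hv, by simp [mergeMap_apply, hgh, hvg, hvh], fun i hi => ?_⟩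
      rw [mergeMap_apply] at hi
      split_ifs at hi with h1 h2
      · exact absurd rfl hi
      · exact Or.inl h2
      · exact Or.inr ((hsupp i hi).resolve_left h1)
    · exact Or.inl ((hsupp g hvg).resolve_left hgh)
  · rintro (hg | ⟨v, hv, hvg, hsupp⟩)
    · refine ⟨pairVec g h, ?_, by simp [pairVec], fun i hi => ?_⟩
      · rw [hW]
        exact mergeMap_pairVec g h ▸ Z.zero_mem
      · by_cases h1 : i = h
        · exact Or.inl h1
        · have : i = g := by by_contra h2; simp [pairVec, h1, h2] at hi
          exact Or.inr (this ▸ hg)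
    · refine ⟨fun i => if i = g then 0 else if i = h then 1 else v i, ?_, by simp [hgh.symm],
        fun i hi => ?_⟩
      · rw [hW]
        rwa [mergeMap_exchange hgh (hZ v hv) hvg]
      · by_cases h1 : i = h
        · exact Or.inl h1
        · by_cases h2 : i = g
          · simp [h2] at hi
          · simp only [h1, h2, if_false] at hi
            exact Or.inr ((hsupp i hi).resolve_left h2)

lemma pathFn_par_old (hgh : g ≠ h) (hZ : ∀ v ∈ Z, v h = 0)
    (hW : ∀ v, v ∈ W ↔ mergeMap g h v ∈ Z) :
    pathFn W g = fun x => h ∈ x ∨ pathFn Z g x := by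
  funext x
  rw [eq_iff_iff]
  constructor
  · rintro ⟨v, hv, hvg, hsupp⟩
    by_cases hvh : v h = 0
    · rw [hW, mergeMap_eq_self hvh] at hv
      exact Or.inr ⟨v, hv, hvg, hsupp⟩
    · exact Or.inl ((hsupp h hvh).resolve_left hgh.symm)
  · rintro (hx | ⟨v, hv, hvg, hsupp⟩)
    · refine ⟨pairVec g h, ?_, by simp [pairVec], fun i hi => ?_⟩
      · rw [hW]
        exact mergeMap_pairVec g h ▸ Z.zero_mem
      · by_cases h1 : i = g
        · exact Or.inl h1
        · have : i = h := by by_contra h2; simp [pairVec, h1, h2] at hi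
          exact Or.inr (this ▸ hx)
    · exact ⟨v, by rwa [hW, mergeMap_eq_self (hZ v hv)], hvg, hsupp⟩

lemma pathFn_par_of_ne (hgh : g ≠ h) (hZ : ∀ v ∈ Z, v h = 0)
    (hW : ∀ v, v ∈ W ↔ mergeMap g h v ∈ Z) (heg : e ≠ g) (heh : e ≠ h) :
    pathFn W e = fun x => pathFn Z e (orSubst g h x) := by
  funext x
  rw [eq_iff_iff]
  constructor
  · rintro ⟨v, hv, hve, hsupp⟩
    refine ⟨_, (hW v).1 hv, by simp [mergeMap_apply, heg, heh, hve], fun i hi => ?_⟩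
    rw [mergeMap_apply] at hi
    split_ifs at hi with h1 h2
    · exact absurd rfl hi
    · right
      subst h2
      by_cases h3 : v i = 0
      · have h4 : v h ≠ 0 := by rwa [h3, zero_add] at hi
        exact Or.inr ⟨rfl, (hsupp h h4).resolve_left heh.symm⟩
      · exact Or.inl ((hsupp i h3).resolve_left heg.symm)
    · exact (hsupp i hi).imp id Or.inl
  · rintro ⟨v, hv, hve, hsupp⟩
    by_cases hvx : v g = 0 ∨ g ∈ x
    · refine ⟨v, by rwa [hW, mergeMap_eq_self (hZ v hv)], hve, fun i hi => ?_⟩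
      rcases hsupp i hi with h1 | h1 | ⟨h1, -⟩
      · exact Or.inl h1
      · exact Or.inr h1
      · subst h1; exact Or.inr (hvx.resolve_left hi)
    · push Not at hvx
      have hhx : h ∈ x := by
        rcases hsupp g hvx.1 with h1 | h1 | h1
        · exact absurd h1.symm heg
        · exact absurd h1 hvx.2
        · exact h1.2
      refine ⟨fun i => if i = g then 0 else if i = h then 1 else v i, ?_, by simp [heg, heh, hve],
        fun i hi => ?_⟩
      · rw [hW]
        rwa [mergeMap_exchange hgh (hZ v hv) (zmod_two_eq_one hvx.1)]
      · by_cases h1 : i = h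
        · exact Or.inr (h1 ▸ hhx)
        · by_cases h2 : i = g
          · simp [h2] at hi
          · simp only [h1, h2, if_false] at hi
            exact (hsupp i hi).imp id fun h3 => (mem_orSubst_of_ne h2 x).1 h3

lemma pathFn_ser_old (hgh : g ≠ h) (hZ : ∀ v ∈ Z, v h = 0)
    (hW : ∀ v, v ∈ W ↔ v g = v h ∧ eraseMap h v ∈ Z) :
    pathFn W g = fun x => h ∈ x ∧ pathFn Z g x := by
  funext x
  rw [eq_iff_iff]
  constructor
  · rintro ⟨v, hv, hvg, hsupp⟩
    rw [hW] at hv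
    refine ⟨(hsupp h (by rw [← hv.1, hvg]; decide)).resolve_left hgh.symm, _, hv.2,
      by rw [eraseMap_apply, if_neg hgh, hvg], fun i hi => ?_⟩
    rw [eraseMap_apply] at hi
    split_ifs at hi with h1
    · exact absurd rfl hi
    · exact hsupp i hi
  · rintro ⟨hx, v, hv, hvg, hsupp⟩
    refine ⟨copyMap g h v, (hW _).2 ⟨by simp [copyMap_apply, hgh],
      by rwa [eraseMap_copyMap (hZ v hv)]⟩, by rw [copyMap_apply, if_neg hgh, hvg], fun i hi => ?_⟩
    rw [copyMap_apply] at hi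
    split_ifs at hi with h1
    · exact Or.inr (h1 ▸ hx)
    · exact hsupp i hi

lemma pathFn_ser_self (hgh : g ≠ h) (hZ : ∀ v ∈ Z, v h = 0)
    (hW : ∀ v, v ∈ W ↔ v g = v h ∧ eraseMap h v ∈ Z) :
    pathFn W h = fun x => g ∈ x ∧ pathFn Z g x := by
  funext x
  rw [eq_iff_iff]
  constructor
  · rintro ⟨v, hv, hvh, hsupp⟩
    rw [hW] at hv
    have hvg : v g = 1 := by rw [hv.1, hvh]
    refine ⟨(hsupp g (by rw [hvg]; decide)).resolve_left hgh, _, hv.2,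
      by rw [eraseMap_apply, if_neg hgh, hvg], fun i hi => ?_⟩
    rw [eraseMap_apply] at hi
    split_ifs at hi with h1
    · exact absurd rfl hi
    · exact Or.inr ((hsupp i hi).resolve_left h1)
  · rintro ⟨hx, v, hv, hvg, hsupp⟩
    refine ⟨copyMap g h v, (hW _).2 ⟨by simp [copyMap_apply, hgh],
      by rwa [eraseMap_copyMap (hZ v hv)]⟩, by rw [copyMap_apply, if_pos rfl, hvg], fun i hi => ?_⟩
    rw [copyMap_apply] at hi
    split_ifs at hi with h1
    · exact Or.inl h1
    · rcases hsupp i hi with rfl | h2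
      · exact Or.inr hx
      · exact Or.inr h2

/-- Away from the root, members of `W` use g and h together or not at all, so the variable g becomes
g ∧ h. -/
lemma pathFn_ser_of_ne (hgh : g ≠ h) (hZ : ∀ v ∈ Z, v h = 0)
    (hW : ∀ v, v ∈ W ↔ v g = v h ∧ eraseMap h v ∈ Z) (heg : e ≠ g) (heh : e ≠ h) :
    pathFn W e = fun x => pathFn Z e (andSubst g h x) := by
  funext x
  rw [eq_iff_iff]
  constructor
  · rintro ⟨v, hv, hve, hsupp⟩
    rw [hW] at hv
    refine ⟨_, hv.2, by rw [eraseMap_apply, if_neg heh, hve], fun i hi => ?_⟩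
    rw [eraseMap_apply] at hi
    split_ifs at hi with h1
    · exact absurd rfl hi
    · refine (hsupp i hi).imp id fun h2 => ⟨h2, ?_⟩
      rintro ⟨rfl, h3⟩
      exact h3 ((hsupp h (by rwa [← hv.1])).resolve_left heh.symm)
  · rintro ⟨v, hv, hve, hsupp⟩
    refine ⟨copyMap g h v, (hW _).2 ⟨by simp [copyMap_apply, hgh],
      by rwa [eraseMap_copyMap (hZ v hv)]⟩, by rw [copyMap_apply, if_neg heh, hve], fun i hi => ?_⟩
    rw [copyMap_apply] at hi
    split_ifs at hi with h1
    · have h2 := (hsupp g hi).resolve_left heg.symm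
      have h3 : h ∈ x := by by_contra h3; exact h2.2 ⟨rfl, h3⟩
      exact Or.inr (h1 ▸ h3)
    · exact (hsupp i hi).imp id fun h2 => h2.1

end PathFn

namespace SPSpace

variable {E : Finset γ} {Z W : Submodule (ZMod 2) (γ → ZMod 2)} {a : ℕ}

lemma apply_eq_zero (hZ : SPSpace E Z a) {v : γ → ZMod 2} (hv : v ∈ Z) {i : γ} (hi : i ∉ E) :
    v i = 0 := by
  induction hZ generalizing v with
  | base hij hZ =>
    simp only [Finset.mem_insert, Finset.mem_singleton, not_or] at hi
    exact ((hZ v).1 hv).2 i hi.1 hi.2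
  | @par E Z W a g h hZ hg hh hW ih =>
    simp only [Finset.mem_insert, not_or] at hi
    have h1 := ih ((hW v).1 hv) hi.2
    rwa [mergeMap_apply, if_neg hi.1, if_neg (by rintro rfl; exact hi.2 hg)] at h1
  | @ser E Z W a g h hZ hg hh hW ih =>
    simp only [Finset.mem_insert, not_or] at hi
    have h1 := ih ((hW v).1 hv).2 hi.2
    rwa [eraseMap_apply, if_neg hi.1] at h1

/-- The induction has to cover every root simultaneously: when the new element h is the root, the
hypothesis is applied with its partner g as root. Each series extension adds exactly one
conjunction. -/
lemma readOnce_pathFn (hZ : SPSpace E Z a) {e : γ} (he : e ∈ E) :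
    ∃ b, ReadOnce (E.erase e) (pathFn Z e) a b := by
  induction hZ generalizing e with
  | @base Z i j hij hZ =>
    have key : ∀ {i j : γ}, i ≠ j → (∀ v, v ∈ Z ↔ v i = v j ∧ ∀ k, k ≠ i → k ≠ j → v k = 0) →
        pathFn Z i = fun x => j ∈ x := by
      intro i j hij hZ
      funext x
      rw [eq_iff_iff]
      constructor
      · rintro ⟨v, hv, hvi, hsupp⟩
        exact (hsupp j (by rw [← ((hZ v).1 hv).1, hvi]; decide)).resolve_left hij.symm
      · intro hj
        refine ⟨fun k => if k = i ∨ k = j then 1 else 0, (hZ _).2 ⟨by simp, fun k h1 h2 =>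
          by simp [h1, h2]⟩, by simp, fun k hk => ?_⟩
        by_cases h1 : k = i
        · exact Or.inl h1
        · have : k = j := by by_contra h2; simp [h1, h2] at hk
          exact Or.inr (this ▸ hj)
    simp only [Finset.mem_insert, Finset.mem_singleton] at he
    rcases he with rfl | rfl
    · refine ⟨0, ?_⟩
      have : ({e, j} : Finset γ).erase e = {j} := by ext k; simp; grind
      rw [key hij hZ, this]
      exact .leaf j
    · refine ⟨0, ?_⟩
      have : ({i, e} : Finset γ).erase e = {i} := by ext k; simp; grind
      rw [key hij.symm (fun v => (hZ v).trans (by grind)), this]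
      exact .leaf i
  | @par E Z W a g h hZ hg hh hW ih =>
    have hgh : g ≠ h := by rintro rfl; exact hh hg
    have hZh : ∀ v ∈ Z, v h = 0 := fun v hv => hZ.apply_eq_zero hv hh
    by_cases heh : e = h
    · subst heh
      obtain ⟨b, hb⟩ := ih hg
      refine ⟨0 + b + 1, ?_⟩
      have : (insert e E).erase e = {g} ∪ E.erase g := by ext k; simp; grind
      rw [pathFn_par_self hgh hZh hW, this]
      exact ((ReadOnce.leaf g).or hb (by simp)).congr_counts (by omega) rfl
    by_cases heg : e = g
    · subst heg
      obtain ⟨b, hb⟩ := ih hg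
      refine ⟨0 + b + 1, ?_⟩
      have : (insert h E).erase e = {h} ∪ E.erase e := by ext k; simp; grind
      rw [pathFn_par_old hgh hZh hW, this]
      exact ((ReadOnce.leaf h).or hb (by simp [hh])).congr_counts (by omega) rfl
    · obtain ⟨b, hb⟩ := ih ((Finset.mem_insert.1 he).resolve_left heh)
      refine ⟨b + 1, ?_⟩
      rw [pathFn_par_of_ne hgh hZh hW heg heh, Finset.erase_insert_of_ne (Ne.symm heh)]
      exact hb.comp_orSubst (by simp [hg, Ne.symm heg]) (by simp [hh])
  | @ser E Z W a g h hZ hg hh hW ih =>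
    have hgh : g ≠ h := by rintro rfl; exact hh hg
    have hZh : ∀ v ∈ Z, v h = 0 := fun v hv => hZ.apply_eq_zero hv hh
    by_cases heh : e = h
    · subst heh
      obtain ⟨b, hb⟩ := ih hg
      refine ⟨0 + b, ?_⟩
      have : (insert e E).erase e = {g} ∪ E.erase g := by ext k; simp; grind
      rw [pathFn_ser_self hgh hZh hW, this]
      exact ((ReadOnce.leaf g).and hb (by simp)).congr_counts (by omega) rfl
    by_cases heg : e = g
    · subst heg
      obtain ⟨b, hb⟩ := ih hg
      refine ⟨0 + b, ?_⟩
      have : (insert h E).erase e = {h} ∪ E.erase e := by ext k; simp; grind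
      rw [pathFn_ser_old hgh hZh hW, this]
      exact ((ReadOnce.leaf h).and hb (by simp [hh])).congr_counts (by omega) rfl
    · obtain ⟨b, hb⟩ := ih ((Finset.mem_insert.1 he).resolve_left heh)
      refine ⟨b, ?_⟩
      rw [pathFn_ser_of_ne hgh hZh hW heg heh, Finset.erase_insert_of_ne (Ne.symm heh)]
      exact hb.comp_andSubst (by simp [hg, Ne.symm heg]) (by simp [hh])

lemma exists_apply_eq_one (hZ : SPSpace E Z a) {e : γ} (he : e ∈ E) : ∃ v ∈ Z, v e = 1 := by
  obtain ⟨b, hb⟩ := hZ.readOnce_pathFn he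
  obtain ⟨v, hv, hve, -⟩ := hb.univ
  exact ⟨v, hv, hve⟩

/-- A loop at e would make the path function true on the empty set, which no read-once function is.
-/
lemma exists_ne_of_apply_ne_zero (hZ : SPSpace E Z a) {v : γ → ZMod 2} (hv : v ∈ Z) {e : γ}
    (he : v e ≠ 0) : ∃ i, i ≠ e ∧ v i ≠ 0 := by
  by_contra! hcon
  have heE : e ∈ E := by by_contra h; exact he (hZ.apply_eq_zero hv h)
  obtain ⟨b, hb⟩ := hZ.readOnce_pathFn heE
  refine hb.not_empty ⟨v, hv, zmod_two_eq_one he, fun i hi => Or.inl ?_⟩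
  by_contra h
  exact hi (hcon i h)

end SPSpace

/-- Undo one variable splitting by `ReadOnce.exists_subst`, realise the smaller function with root
e, and perform the corresponding extension, which leaves the root untouched. -/
lemma ReadOnce.exists_spSpace {A : Finset γ} {f : Set γ → Prop} {a b : ℕ} (hf : ReadOnce A f a b)
    {e : γ} (he : e ∉ A) : ∃ Z, SPSpace (insert e A) Z a ∧ pathFn Z e = f := by
  obtain ⟨n, hn⟩ : ∃ n, A.card = n := ⟨_, rfl⟩
  induction n generalizing A f a b with
  | zero => have := hf.card_eq; omega
  | succ n ih =>
    rcases hf.exists_subst with ⟨i, rfl, rfl, rfl, rfl⟩ |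
      ⟨g, h, B, f', a', b', hg, hh, rfl, hf', hsub⟩
    · have hei : e ≠ i := by simpa using he
      let Z : Submodule (ZMod 2) (γ → ZMod 2) :=
        { carrier := {v | v e = v i ∧ ∀ k, k ≠ e → k ≠ i → v k = 0}
          add_mem' := fun {v w} hv hw => ⟨by simp [hv.1, hw.1], fun k h1 h2 => by
            simp [hv.2 k h1 h2, hw.2 k h1 h2]⟩
          zero_mem' := by simp
          smul_mem' := fun r v hv => ⟨by simp [hv.1], fun k h1 h2 => by simp [hv.2 k h1 h2]⟩ }
      have hZ : SPSpace {e, i} Z 0 := .base hei fun v => Iff.rfl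
      refine ⟨Z, hZ, ?_⟩
      obtain ⟨b, hb⟩ := hZ.readOnce_pathFn (e := e) (by simp)
      have : ({e, i} : Finset γ).erase e = {i} := by ext k; simp; grind
      rw [this] at hb
      funext x
      rw [eq_iff_iff]
      constructor
      · intro hx
        by_contra hi
        exact hb.not_of_disjoint (by simpa using hi) hx
      · intro hx
        exact hb.of_subset (by simpa using hx)
    · rw [Finset.mem_insert, not_or] at he
      rw [Finset.card_insert_of_notMem hh] at hn
      obtain ⟨Z, hZ, hZf⟩ := ih hf' he.2 (by omega)
      have hgh : g ≠ h := by rintro rfl; exact hh hg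
      have heg : e ≠ g := by rintro rfl; exact he.2 hg
      have hh' : h ∉ insert e B := by simp [Ne.symm he.1, hh]
      have hZh : ∀ v ∈ Z, v h = 0 := fun v hv => hZ.apply_eq_zero hv hh'
      rw [Finset.insert_comm]
      rcases hsub with ⟨rfl, rfl, rfl⟩ | ⟨rfl, rfl, rfl⟩
      · have hW : ∀ v, v ∈ Z.comap (mergeMap g h) ↔ mergeMap g h v ∈ Z := fun v => Iff.rfl
        refine ⟨_, .par hZ (by simp [hg]) hh' hW, ?_⟩
        rw [pathFn_par_of_ne hgh hZh hW heg he.1, hZf]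
      · have hW : ∀ v, v ∈ Z.comap (eraseMap h) ⊓
            LinearMap.eqLocus (LinearMap.proj (R := ZMod 2) (φ := fun _ : γ => ZMod 2) g)
              (LinearMap.proj h) ↔ v g = v h ∧ eraseMap h v ∈ Z := fun v => by
          simp [and_comm]
        refine ⟨_, .ser hZ (by simp [hg]) hh' hW, ?_⟩
        rw [pathFn_ser_of_ne hgh hZh hW heg he.1, hZf]

end SPSpaces

/-! ### The path function determines the space. -/

section MinimalThrough

variable {γ : Type*} [DecidableEq γ] {E : Finset γ} {Z W : Submodule (ZMod 2) (γ → ZMod 2)}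
  {a : ℕ} {e g h : γ}

lemma eq_mergeMap_add_smul (hgh : g ≠ h) (v : γ → ZMod 2) :
    v = mergeMap g h v + v h • pairVec g h := by
  funext i
  simp only [Pi.add_apply, Pi.smul_apply, smul_eq_mul, mergeMap_apply, pairVec]
  by_cases h1 : i = h
  · simp [h1]
  by_cases h2 : i = g
  · simp [h2, hgh, add_assoc, zmod_two_add_self]
  · simp [h1, h2]

lemma minimalThrough_subset_par (hZ : ∀ v ∈ Z, v h = 0) (hW : ∀ v, v ∈ W ↔ mergeMap g h v ∈ Z) :
    minimalThrough Z e ⊆ minimalThrough W e := by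
  rintro v ⟨hv, hve, hmin⟩
  have hvh := hZ v hv
  refine ⟨(hW v).2 (by rwa [mergeMap_eq_self hvh]), hve, fun w hw hwe hsupp => ?_⟩
  have hwh : w h = 0 := by by_contra h1; exact hsupp h h1 hvh
  rw [hW, mergeMap_eq_self hwh] at hw
  exact hmin w hw hwe hsupp

/-- A parallel extension is generated by the old space and the two-element circuit {g, h}, so only
that circuit needs attention. -/
lemma le_span_par (hgh : g ≠ h) (hZ : ∀ v ∈ Z, v h = 0)
    (hW : ∀ v, v ∈ W ↔ mergeMap g h v ∈ Z)
    (hspan : Z ≤ Submodule.span (ZMod 2) (minimalThrough Z e))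
    (hpair : pairVec g h ∈ Submodule.span (ZMod 2) (minimalThrough W e)) :
    W ≤ Submodule.span (ZMod 2) (minimalThrough W e) := by
  intro v hv
  rw [eq_mergeMap_add_smul hgh v]
  exact Submodule.add_mem _
    (Submodule.span_mono (minimalThrough_subset_par hZ hW) (hspan ((hW v).1 hv)))
    (Submodule.smul_mem _ _ hpair)

lemma pairVec_mem_minimalThrough
    (hloop : ∀ v ∈ Z, v g ≠ 0 → ∃ i, i ≠ g ∧ v i ≠ 0)
    (hW : ∀ v, v ∈ W ↔ mergeMap g h v ∈ Z) : pairVec g h ∈ minimalThrough W g := by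
  refine ⟨(hW _).2 (mergeMap_pairVec g h ▸ Z.zero_mem), by simp [pairVec], fun w hw hwg hsupp => ?_⟩
  have hsupp' : ∀ i, i ≠ g → i ≠ h → w i = 0 := fun i h1 h2 => by
    by_contra h3; exact hsupp i h3 (by simp [pairVec, h1, h2])
  have hwh : w h = 1 := by
    by_contra h1
    have hwh : w h = 0 := by by_contra h2; exact h1 (zmod_two_eq_one h2)
    rw [hW, mergeMap_eq_self hwh] at hw
    obtain ⟨i, hi, hi'⟩ := hloop w hw (by rw [hwg]; decide)
    by_cases h2 : i = h
    · exact hi' (h2 ▸ hwh)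
    · exact hi' (hsupp' i hi h2)
  funext i
  by_cases h1 : i = g
  · simp [h1, pairVec, hwg]
  by_cases h2 : i = h
  · simp [h2, pairVec, hwh]
  · simp [pairVec, h1, h2, hsupp' i h1 h2]

/-- Some minimal member u through e contains g, since otherwise the span would vanish at g.
Exchanging g for h in u gives another minimal member, and the two differ by the circuit {g, h}. -/
lemma pairVec_mem_span_of_ne (hgh : g ≠ h) (heg : e ≠ g) (heh : e ≠ h) (hZ : ∀ v ∈ Z, v h = 0)
    (hcoloop : ∃ v ∈ Z, v g = 1) (hW : ∀ v, v ∈ W ↔ mergeMap g h v ∈ Z)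
    (hspan : Z ≤ Submodule.span (ZMod 2) (minimalThrough Z e)) :
    pairVec g h ∈ Submodule.span (ZMod 2) (minimalThrough W e) := by
  obtain ⟨u, hu, hug⟩ : ∃ u ∈ minimalThrough Z e, u g = 1 := by
    by_contra! hcon
    obtain ⟨v, hv, hvg⟩ := hcoloop
    have hle : Submodule.span (ZMod 2) (minimalThrough Z e) ≤
        LinearMap.ker (LinearMap.proj (R := ZMod 2) (φ := fun _ : γ => ZMod 2) g) := by
      rw [Submodule.span_le]
      intro w hw
      have : w g = 0 := by by_contra h2; exact hcon w hw (zmod_two_eq_one h2)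
      simpa using this
    have : v g = 0 := by simpa using hle (hspan hv)
    rw [hvg] at this
    exact absurd this (by decide)
  have huh := hZ u hu.1
  obtain ⟨u', hu'⟩ : ∃ u' : γ → ZMod 2, u' = fun i => if i = g then 0 else if i = h then 1 else u i :=
    ⟨_, rfl⟩
  have hmerge : mergeMap g h u' = u := by rw [hu', mergeMap_exchange hgh huh hug]
  have hu'g : u' g = 0 := by simp [hu']
  have hu'h : u' h = 1 := by simp [hu', hgh.symm]
  have hu'i : ∀ i, i ≠ g → i ≠ h → u' i = u i := fun i h1 h2 => by simp [hu', h1, h2]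
  have hmem : u' ∈ minimalThrough W e := by
    refine ⟨(hW _).2 (by rw [hmerge]; exact hu.1), by rw [hu'i e heg heh, hu.2.1],
      fun w hw hwe hsupp => ?_⟩
    have hwg : w g = 0 := by by_contra h1; exact hsupp g h1 hu'g
    have h1 : mergeMap g h w = u := by
      refine hu.2.2 _ ((hW w).1 hw) (by simp [mergeMap_apply, heg, heh, hwe]) fun i hi => ?_
      rw [mergeMap_apply] at hi
      split_ifs at hi with h1 h2
      · exact absurd rfl hi
      · rw [h2, hug]; decide
      · rw [← hu'i i h2 h1]; exact hsupp i hi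
    funext i
    have h2 := congrFun h1 i
    rw [mergeMap_apply] at h2
    by_cases h3 : i = h
    · have h4 := congrFun h1 g
      rw [mergeMap_apply, if_neg hgh, if_pos rfl, hwg, zero_add, hug] at h4
      rw [h3, h4, hu'h]
    by_cases h4 : i = g
    · rw [h4, hwg, hu'g]
    · rw [if_neg h3, if_neg h4] at h2
      rw [h2, hu'i i h4 h3]
  have heq : pairVec g h = u' - u := by
    have := eq_mergeMap_add_smul hgh u'
    rw [hmerge, hu'h, one_smul] at this
    rw [this]; abel
  rw [heq]
  exact Submodule.sub_mem _ (Submodule.subset_span hmem)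
    (Submodule.subset_span (minimalThrough_subset_par hZ hW hu))

lemma mergeMap_comp_swap (v : γ → ZMod 2) :
    mergeMap g h (v ∘ Equiv.swap g h) = mergeMap g h v := by
  funext i
  simp only [mergeMap_apply, Function.comp_apply, Equiv.swap_apply_left, Equiv.swap_apply_right]
  split_ifs with h1 h2
  · rfl
  · rw [add_comm]
  · rw [Equiv.swap_apply_of_ne_of_ne h2 h1]

/-- Interchanging the parallel elements g and h is a symmetry of `W`, so the result for root g
carries over to root h. -/
lemma le_span_par_swap (hW : ∀ v, v ∈ W ↔ mergeMap g h v ∈ Z)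
    (hspan : W ≤ Submodule.span (ZMod 2) (minimalThrough W g)) :
    W ≤ Submodule.span (ZMod 2) (minimalThrough W h) := by
  have hinv : ∀ v : γ → ZMod 2, (v ∘ Equiv.swap g h) ∘ Equiv.swap g h = v := fun v => by
    funext i; simp
  have hWs : ∀ v, v ∈ W → v ∘ Equiv.swap g h ∈ W := fun v hv => by
    rw [hW, mergeMap_comp_swap]; exact (hW v).1 hv
  let σ : (γ → ZMod 2) →ₗ[ZMod 2] (γ → ZMod 2) := LinearMap.funLeft _ _ (Equiv.swap g h)
  have hσ : ∀ v, σ v = v ∘ Equiv.swap g h := fun v => rfl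
  have hK : σ '' minimalThrough W g ⊆ minimalThrough W h := by
    rintro _ ⟨v, ⟨hv, hvg, hmin⟩, rfl⟩
    rw [hσ]
    refine ⟨hWs v hv, by simpa using hvg, fun w hw hwh hsupp => ?_⟩
    rw [← hmin _ (hWs w hw) (by simpa using hwh) fun i hi => by simpa using hsupp _ hi, hinv]
  intro v hv
  have h1 : σ (v ∘ Equiv.swap g h) ∈ (Submodule.span (ZMod 2) (minimalThrough W g)).map σ :=
    Submodule.mem_map_of_mem (hspan (hWs v hv))
  rw [Submodule.map_span, hσ, hinv] at h1
  exact Submodule.span_mono hK h1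

lemma copyMap_eraseMap {v : γ → ZMod 2} (hgh : g ≠ h) (hv : v g = v h) :
    copyMap g h (eraseMap h v) = v := by
  funext i
  rw [copyMap_apply, eraseMap_apply, eraseMap_apply, if_neg hgh]
  split_ifs with h1
  · rw [hv, h1]
  · rfl

lemma le_span_ser (hgh : g ≠ h) (heh : e ≠ h) (hZ : ∀ v ∈ Z, v h = 0)
    (hW : ∀ v, v ∈ W ↔ v g = v h ∧ eraseMap h v ∈ Z)
    (hspan : Z ≤ Submodule.span (ZMod 2) (minimalThrough Z e)) :
    W ≤ Submodule.span (ZMod 2) (minimalThrough W e) := by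
  have hK : copyMap g h '' minimalThrough Z e ⊆ minimalThrough W e := by
    rintro _ ⟨u, ⟨hu, hue, hmin⟩, rfl⟩
    have huh := hZ u hu
    refine ⟨(hW _).2 ⟨by simp [copyMap_apply, hgh], by rwa [eraseMap_copyMap huh]⟩,
      by rw [copyMap_apply, if_neg heh, hue], fun w hw hwe hsupp => ?_⟩
    rw [hW] at hw
    have : eraseMap h w = u := by
      refine hmin _ hw.2 (by rw [eraseMap_apply, if_neg heh, hwe]) fun i hi => ?_
      rw [eraseMap_apply] at hi
      split_ifs at hi with h1
      · exact absurd rfl hi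
      · have := hsupp i hi
        rwa [copyMap_apply, if_neg h1] at this
    rw [← this, copyMap_eraseMap hgh hw.1]
  intro v hv
  rw [hW] at hv
  have h1 := Submodule.mem_map_of_mem (f := copyMap g h) (hspan hv.2)
  rw [Submodule.map_span, copyMap_eraseMap hgh hv.1] at h1
  exact Submodule.span_mono hK h1

lemma minimalThrough_ser_eq (hW : ∀ v ∈ W, v g = v h) :
    minimalThrough W h = minimalThrough W g := by
  ext v
  simp only [minimalThrough, Set.mem_ofPred_eq]
  constructor
  · rintro ⟨hv, hvh, hmin⟩
    exact ⟨hv, by rw [hW v hv, hvh], fun w hw hwg => hmin w hw (by rw [← hW w hw, hwg])⟩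
  · rintro ⟨hv, hvh, hmin⟩
    exact ⟨hv, by rw [← hW v hv, hvh], fun w hw hwg => hmin w hw (by rw [hW w hw, hwg])⟩

/-- The circuits of a series-parallel matroid through a fixed element span its cycle space. -/
theorem SPSpace.le_span_minimalThrough (hZ : SPSpace E Z a) (he : e ∈ E) :
    Z ≤ Submodule.span (ZMod 2) (minimalThrough Z e) := by
  induction hZ generalizing e with
  | @base Z i j hij hZ =>
    intro v hv
    have hval : ∀ w ∈ Z, ∀ k, w k ≠ 0 → w k = w e ∧ (k = i ∨ k = j) := by
      intro w hw k hk
      obtain ⟨h1, h2⟩ := (hZ w).1 hw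
      have hk' : k = i ∨ k = j := by
        by_contra! h3; exact hk (h2 k h3.1 h3.2)
      simp only [Finset.mem_insert, Finset.mem_singleton] at he
      grind
    by_cases hve : v e = 0
    · have : v = 0 := by
        funext k; by_contra hk; exact hk ((hval v hv k hk).1.trans hve)
      rw [this]; exact Submodule.zero_mem _
    · refine Submodule.subset_span ⟨hv, zmod_two_eq_one hve, fun w hw hwe _ => ?_⟩
      simp only [Finset.mem_insert, Finset.mem_singleton] at he
      have h1 := (hZ v).1 hv
      have h2 := (hZ w).1 hw
      have h3 := zmod_two_eq_one hve
      funext k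
      by_cases hki : k = i
      · grind
      by_cases hkj : k = j
      · grind
      · rw [h1.2 k hki hkj, h2.2 k hki hkj]
  | @par E Z W a g h hZ hg hh hW ih =>
    have hgh : g ≠ h := by rintro rfl; exact hh hg
    have hZh : ∀ v ∈ Z, v h = 0 := fun v hv => hZ.apply_eq_zero hv hh
    have hspang : W ≤ Submodule.span (ZMod 2) (minimalThrough W g) :=
      le_span_par hgh hZh hW (ih hg) (Submodule.subset_span (pairVec_mem_minimalThrough
        (fun v hv hvg => hZ.exists_ne_of_apply_ne_zero hv hvg) hW))
    by_cases heh : e = h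
    · rw [heh]
      exact le_span_par_swap hW hspang
    by_cases heg : e = g
    · rwa [heg]
    · have hspan := ih ((Finset.mem_insert.1 he).resolve_left heh)
      exact le_span_par hgh hZh hW hspan
        (pairVec_mem_span_of_ne hgh heg heh hZh (hZ.exists_apply_eq_one hg) hW hspan)
  | @ser E Z W a g h hZ hg hh hW ih =>
    have hgh : g ≠ h := by rintro rfl; exact hh hg
    have hZh : ∀ v ∈ Z, v h = 0 := fun v hv => hZ.apply_eq_zero hv hh
    by_cases heh : e = h
    · rw [heh, minimalThrough_ser_eq fun v hv => ((hW v).1 hv).1]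
      exact le_span_ser hgh hgh hZh hW (ih hg)
    · exact le_span_ser hgh heh hZh hW (ih ((Finset.mem_insert.1 he).resolve_left heh))

/-- For a minimal v in `Z` through e, equality of path functions gives a w in `W` inside v, and then
a u in `Z` inside w. Minimality forces u = v, hence w = v, and such v span `Z`. -/
lemma SPSpace.le_of_pathFn_eq (hZ : SPSpace E Z a) (he : e ∈ E)
    (hf : pathFn Z e = pathFn W e) : Z ≤ W := by
  refine (hZ.le_span_minimalThrough he).trans (Submodule.span_le.2 ?_)
  rintro v ⟨hv, hve, hmin⟩
  obtain ⟨w, hw, hwe, hws⟩ : pathFn W e {i | v i ≠ 0} := hf ▸ ⟨v, hv, hve, fun i hi => Or.inr hi⟩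
  obtain ⟨u, hu, hue, hus⟩ : pathFn Z e {i | w i ≠ 0} := hf ▸ ⟨w, hw, hwe, fun i hi => Or.inr hi⟩
  have hwv : ∀ i, w i ≠ 0 → v i ≠ 0 := fun i hi => by
    rcases hws i hi with rfl | h
    · rw [hve]; decide
    · exact h
  have huw : ∀ i, u i ≠ 0 → w i ≠ 0 := fun i hi => by
    rcases hus i hi with rfl | h
    · rw [hwe]; decide
    · exact h
  have huv := hmin u hu hue fun i hi => hwv i (huw i hi)
  have : w = v := by
    funext i
    by_cases hi : v i = 0
    · rw [hi]; by_contra h; exact hwv i h hi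
    · rw [zmod_two_eq_one hi, zmod_two_eq_one (huw i (huv ▸ hi))]
  exact this ▸ hw

theorem SPSpace.eq_of_pathFn_eq {E' : Finset γ} {a' : ℕ} (hZ : SPSpace E Z a)
    (hW : SPSpace E' W a') (he : e ∈ E) (he' : e ∈ E') (hf : pathFn Z e = pathFn W e) : Z = W :=
  le_antisymm (hZ.le_of_pathFn_eq he hf) (hW.le_of_pathFn_eq he' hf.symm)

end MinimalThrough

/-! ### The binary matroid of a space: circuits and rank. -/

section SpaceMatroid

variable {γ : Type*}

/-- The support of a vector, as a set. -/
def vecSupport (v : γ → ZMod 2) : Set γ := {i | v i ≠ 0}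

lemma mem_vecSupport {v : γ → ZMod 2} {i : γ} : i ∈ vecSupport v ↔ v i ≠ 0 := Iff.rfl

lemma vecSupport_injective : Function.Injective (vecSupport (γ := γ)) := by
  intro v w h
  funext i
  have := Set.ext_iff.1 h i
  rw [mem_vecSupport, mem_vecSupport] at this
  by_cases hv : v i = 0
  · rw [hv]; by_contra hw; exact this.2 (Ne.symm hw) hv
  · rw [zmod_two_eq_one hv, zmod_two_eq_one (this.1 hv)]

lemma vecSupport_eq_empty {v : γ → ZMod 2} (h : vecSupport v = ∅) : v = 0 := by
  funext i
  by_contra hi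
  exact Set.notMem_empty i (h ▸ hi)

/-- `C` is a minimal support of a nonzero vector of `Z`. -/
def IsMinSupport (Z : Submodule (ZMod 2) (γ → ZMod 2)) : Set γ → Prop :=
  Minimal fun C => ∃ v ∈ Z, v ≠ 0 ∧ vecSupport v = C

/-- The sets which contain no support of a nonzero vector of `Z`. -/
def IndepMod (Z : Submodule (ZMod 2) (γ → ZMod 2)) (I : Set γ) : Prop :=
  ∀ v ∈ Z, vecSupport v ⊆ I → v = 0

/-- A basis is carried along the construction: a parallel extension keeps it and a series extension
adds the new element to it. -/
lemma SPSpace.exists_maximal_indepMod [DecidableEq γ] {E : Finset γ}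
    {Z : Submodule (ZMod 2) (γ → ZMod 2)} {a : ℕ} (hZ : SPSpace E Z a) :
    ∃ B : Finset γ, B ⊆ E ∧ B.card = a + 1 ∧ IndepMod Z B ∧
      ∀ x ∈ E, x ∉ B → ¬ IndepMod Z (insert x (B : Set γ)) := by
  induction hZ with
  | @base Z i j hij hZ =>
    refine ⟨{i}, by simp, by simp, fun v hv hs => ?_, fun x hx hxi h => ?_⟩
    · have h1 := (hZ v).1 hv
      have h2 : v j = 0 := by
        by_contra h2
        exact hij.symm (by simpa using hs h2)
      funext k
      by_cases hk : k = i
      · rw [hk, h1.1, h2]; rfl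
      by_cases hk' : k = j
      · rw [hk', h2]; rfl
      · exact h1.2 k hk hk'
    · have hxj : x = j := by
        simp only [Finset.mem_insert, Finset.mem_singleton] at hx hxi
        tauto
      have h1 := h (pairVec i j) ((hZ _).2 ⟨by simp [pairVec], fun k h1 h2 => by
        simp [pairVec, h1, h2]⟩) (fun k hk => by
          rw [mem_vecSupport, pairVec] at hk
          simp only [Finset.coe_singleton, Set.mem_insert_iff, Set.mem_singleton_iff, hxj]
          by_contra h2
          exact hk (if_neg (by tauto)))
      have := congrFun h1 i
      simp [pairVec] at this
  | @par E Z W a g h hZ hg hh hW ih =>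
    obtain ⟨B, hBE, hB, hind, hmax⟩ := ih
    have hgh : g ≠ h := by rintro rfl; exact hh hg
    have hZh : ∀ v ∈ Z, v h = 0 := fun v hv => hZ.apply_eq_zero hv hh
    have hZW : ∀ v ∈ Z, v ∈ W := fun v hv => (hW v).2 (by rwa [mergeMap_eq_self (hZh v hv)])
    refine ⟨B, hBE.trans (Finset.subset_insert _ _), hB, fun v hv hs => ?_, fun x hx hxB hcon => ?_⟩
    · have hvh : v h = 0 := by
        by_contra h1
        exact hh (hBE (hs h1))
      exact hind v (by rwa [hW, mergeMap_eq_self hvh] at hv) hs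
    · by_cases hxh : x = h
      · subst hxh
        -- The new element is dependent on B either through the two-element circuit with g, or
        -- through a circuit in B ∪ {g} with g exchanged for the new element.
        by_cases hgB : g ∈ B
        · have h1 := hcon (pairVec g x) ((hW _).2 (mergeMap_pairVec g x ▸ Z.zero_mem))
            (fun k hk => by
              by_cases h1 : k = x
              · exact Or.inl h1
              · have : k = g := by by_contra h2; exact hk (if_neg (by tauto))
                exact Or.inr (this ▸ hgB))
          have := congrFun h1 g
          simp [pairVec] at this
        · have h1 := hmax g hg hgB
          simp only [IndepMod, not_forall] at h1
          obtain ⟨v, hv, hs, hv0⟩ := h1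
          have hvg : v g = 1 := by
            by_contra hvg
            refine hv0 (hind v hv fun k hk => (hs hk).resolve_left ?_)
            rintro rfl
            exact hvg (zmod_two_eq_one hk)
          have h2 := hcon _ ((hW _).2 (by rwa [mergeMap_exchange hgh (hZh v hv) hvg]))
            (fun k hk => by
              rw [mem_vecSupport] at hk
              by_cases h1 : k = x
              · exact Or.inl h1
              by_cases h2 : k = g
              · simp [h2] at hk
              · simp only [h1, h2, if_false] at hk
                exact Or.inr ((hs hk).resolve_left h2))
          have := congrFun h2 x
          simp [hgh.symm] at this
      · exact hmax x ((Finset.mem_insert.1 hx).resolve_left hxh) hxB fun v hv hs =>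
          hcon v (hZW v hv) hs
  | @ser E Z W a g h hZ hg hh hW ih =>
    obtain ⟨B, hBE, hB, hind, hmax⟩ := ih
    have hgh : g ≠ h := by rintro rfl; exact hh hg
    have hZh : ∀ v ∈ Z, v h = 0 := fun v hv => hZ.apply_eq_zero hv hh
    refine ⟨insert h B, Finset.insert_subset_insert _ hBE, ?_, fun v hv hs => ?_,
      fun x hx hxB hcon => ?_⟩
    · rw [Finset.card_insert_of_notMem fun h1 => hh (hBE h1), hB]
    · have hv' := (hW v).1 hv
      have h1 := hind _ hv'.2 (fun k hk => by
        rw [mem_vecSupport, eraseMap_apply] at hk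
        split_ifs at hk with h1
        · exact absurd rfl hk
        · have := hs hk
          rw [Finset.coe_insert] at this
          exact this.resolve_left h1)
      rw [← copyMap_eraseMap hgh hv'.1, h1, map_zero]
    · rw [Finset.mem_insert, not_or] at hxB
      refine hmax x ((Finset.mem_insert.1 hx).resolve_left hxB.1) hxB.2 fun v hv hs => ?_
      have h1 := hcon (copyMap g h v) ((hW _).2 ⟨by simp [copyMap_apply, hgh],
        by rwa [eraseMap_copyMap (hZh v hv)]⟩) (fun k hk => by
          rw [mem_vecSupport, copyMap_apply] at hk
          rw [Finset.coe_insert]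
          split_ifs at hk with h1
          · exact Or.inr (Or.inl h1)
          · exact (hs hk).imp id Or.inr)
      rw [← eraseMap_copyMap (g := g) (hZh v hv), h1, map_zero]

variable [Finite γ]

lemma exists_isMinSupport_subset {Z : Submodule (ZMod 2) (γ → ZMod 2)} {v : γ → ZMod 2}
    (hv : v ∈ Z) (hv0 : v ≠ 0) : ∃ C, C ⊆ vecSupport v ∧ IsMinSupport Z C :=
  exists_minimal_le_of_wellFoundedLT
    (fun C => ∃ v ∈ Z, v ≠ 0 ∧ vecSupport v = C) (vecSupport v) ⟨v, hv, hv0, rfl⟩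

/-- Subtracting a vector with minimal support inside v strictly shrinks the support, because over
`ZMod 2` all of its entries cancel. -/
lemma mem_span_of_isMinSupport {Z : Submodule (ZMod 2) (γ → ZMod 2)} {v : γ → ZMod 2}
    (hv : v ∈ Z) : v ∈ Submodule.span (ZMod 2) {w | IsMinSupport Z (vecSupport w)} := by
  obtain ⟨n, hn⟩ : ∃ n, (vecSupport v).ncard = n := ⟨_, rfl⟩
  induction n using Nat.strong_induction_on generalizing v with
  | _ n ih =>
    by_cases hv0 : v = 0
    · rw [hv0]; exact Submodule.zero_mem _
    obtain ⟨C, hC, hmin⟩ := exists_isMinSupport_subset hv hv0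
    obtain ⟨w, hw, hw0, rfl⟩ := hmin.prop
    have hlt : vecSupport (v - w) ⊂ vecSupport v := by
      rw [Set.ssubset_iff_subset_ne]
      constructor
      · intro i hi
        by_contra h
        have h1 : v i = 0 := by simpa [mem_vecSupport] using h
        have h2 : w i = 0 := by
          by_contra h2; exact h (hC h2)
        exact hi (by simp [h1, h2])
      · intro h
        apply hw0
        funext i
        by_contra hi
        have h1 : v i = 1 := zmod_two_eq_one (hC hi)
        have h2 : w i = 1 := zmod_two_eq_one hi
        have : i ∈ vecSupport (v - w) := h ▸ hC hi
        exact this (by simp [h1, h2])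
    have h1 := ih _ (hn ▸ Set.ncard_lt_ncard hlt (Set.toFinite _)) (Z.sub_mem hv hw) rfl
    have h2 : w ∈ Submodule.span (ZMod 2) {w | IsMinSupport Z (vecSupport w)} :=
      Submodule.subset_span hmin
    simpa using Submodule.add_mem _ h1 h2

/-- A binary space is determined by its minimal supports. -/
lemma eq_of_isMinSupport_iff {Z W : Submodule (ZMod 2) (γ → ZMod 2)}
    (h : ∀ C, IsMinSupport Z C ↔ IsMinSupport W C) : Z = W := by
  have key : ∀ {Z W : Submodule (ZMod 2) (γ → ZMod 2)},
      (∀ C, IsMinSupport Z C ↔ IsMinSupport W C) → Z ≤ W := by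
    intro Z W h v hv
    refine Submodule.span_le.2 ?_ (mem_span_of_isMinSupport hv)
    intro w hw
    obtain ⟨u, hu, -, huw⟩ := ((h _).1 hw).prop
    exact vecSupport_injective huw ▸ hu
  exact le_antisymm (key h) (key fun C => (h C).symm)

section

variable (Z : Submodule (ZMod 2) (γ → ZMod 2))

/-- The classes of the unit vectors modulo `Z` represent the matroid: linear relations among them
are precisely the members of `Z`. -/
lemma linearIndepOn_iff_indepMod [DecidableEq γ] (I : Set γ) :
    LinearIndepOn (ZMod 2) (fun i => Z.mkQ (Pi.single i 1)) I ↔ IndepMod Z I := by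
  have hlin : ∀ l : γ →₀ ZMod 2,
      Finsupp.linearCombination (ZMod 2) (fun i => Z.mkQ (Pi.single i 1)) l = Z.mkQ l := by
    intro l
    have := Fintype.ofFinite γ
    rw [Finsupp.linearCombination_apply, Finsupp.sum_fintype _ _ (by simp)]
    simp_rw [← map_smul, ← map_sum]
    congr 1
    funext i
    rw [Finset.sum_apply]
    simp [Pi.single_apply]
  rw [linearIndepOn_iff]
  constructor
  · intro h v hv hsupp
    have h1 := h (Finsupp.equivFunOnFinite.symm v)
      (by
        rw [Finsupp.mem_supported]
        intro i hi
        exact hsupp (by simpa [mem_vecSupport] using hi))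
      (by rw [hlin]; simpa using hv)
    funext i
    simpa using DFunLike.congr_fun h1 i
  · intro h l hl hl0
    rw [hlin] at hl0
    have h1 := h l (by simpa using hl0) (fun i hi => by
      rw [Finsupp.mem_supported] at hl
      exact hl (by simpa [mem_vecSupport] using hi))
    exact DFunLike.coe_injective h1

lemma IndepMod.exists_insert {I J : Set γ} (hI : IndepMod Z I) (hJ : IndepMod Z J)
    (hIJ : I.ncard < J.ncard) : ∃ e ∈ J, e ∉ I ∧ IndepMod Z (insert e I) := by
  classical
  have := Fintype.ofFinite γ
  by_contra! hcon
  rw [← linearIndepOn_iff_indepMod] at hI hJ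
  set b : γ → (γ → ZMod 2) ⧸ Z := fun i => Z.mkQ (Pi.single i 1) with hb
  have hle : Submodule.span (ZMod 2) (b '' J) ≤ Submodule.span (ZMod 2) (b '' I) := by
    rw [Submodule.span_le]
    rintro _ ⟨e, he, rfl⟩
    by_cases heI : e ∈ I
    · exact Submodule.subset_span ⟨e, heI, rfl⟩
    · have h1 := hcon e he heI
      rw [← linearIndepOn_iff_indepMod] at h1
      by_contra h2
      exact h1 (hI.insert h2)
  have hcard : ∀ K : Set γ, LinearIndepOn (ZMod 2) b K →
      Module.finrank (ZMod 2) (Submodule.span (ZMod 2) (b '' K)) = K.ncard := by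
    intro K hK
    have h1 := finrank_span_eq_card (LinearIndepOn.linearIndependent hK)
    rw [Set.image_eq_range, h1, ← Nat.card_eq_fintype_card, Nat.card_coe_set_eq]
  have := Submodule.finrank_mono hle
  rw [hcard I hI, hcard J hJ] at this
  omega

/-- The binary matroid on `E` with cycle space `Z`. -/
noncomputable def spaceMatroid (E : Set γ) : Matroid γ :=
  (IndepMatroid.ofFinite (E := E) (Set.toFinite _) (fun I => I ⊆ E ∧ IndepMod Z I)
    ⟨Set.empty_subset _, fun _ _ h => vecSupport_eq_empty (Set.subset_empty_iff.1 h)⟩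
    (fun _ _ hJ hIJ => ⟨hIJ.trans hJ.1, fun v hv hs => hJ.2 v hv (hs.trans hIJ)⟩)
    (fun I J hI hJ hIJ => by
      obtain ⟨e, heJ, heI, he⟩ := hI.2.exists_insert Z hJ.2 hIJ
      exact ⟨e, heJ, heI, Set.insert_subset (hJ.1 heJ) hI.1, he⟩)
    (fun _ h => h.1)).matroid

variable {Z} {E : Set γ}

lemma spaceMatroid_ground : (spaceMatroid Z E).E = E := rfl

lemma spaceMatroid_indep_iff {I : Set γ} : (spaceMatroid Z E).Indep I ↔ I ⊆ E ∧ IndepMod Z I :=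
  Iff.rfl

lemma spaceMatroid_isCircuit_iff (hZ : ∀ v ∈ Z, vecSupport v ⊆ E) {C : Set γ} :
    (spaceMatroid Z E).IsCircuit C ↔ IsMinSupport Z C := by
  have hdep : ∀ D, (spaceMatroid Z E).Dep D ↔ D ⊆ E ∧ ∃ v ∈ Z, v ≠ 0 ∧ vecSupport v ⊆ D := by
    intro D
    rw [Matroid.Dep, spaceMatroid_indep_iff, spaceMatroid_ground, IndepMod]
    constructor
    · rintro ⟨h1, h2⟩
      refine ⟨h2, ?_⟩
      by_contra! h3
      exact h1 ⟨h2, fun v hv hs => by by_contra h; exact h3 v hv h hs⟩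
    · rintro ⟨h2, v, hv, hv0, hs⟩
      exact ⟨fun h => hv0 (h.2 v hv hs), h2⟩
  have hmindep : ∀ v ∈ Z, v ≠ 0 → (spaceMatroid Z E).Dep (vecSupport v) := fun v hv hv0 =>
    (hdep _).2 ⟨hZ v hv, v, hv, hv0, subset_rfl⟩
  constructor
  · intro h
    obtain ⟨-, v, hv, hv0, hs⟩ := (hdep C).1 h.prop
    have hC : C = vecSupport v := (h.eq_of_subset (hmindep v hv hv0) hs).symm
    refine ⟨⟨v, hv, hv0, hC.symm⟩, ?_⟩
    rintro _ ⟨w, hw, hw0, rfl⟩ hle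
    exact h.le_of_le (hmindep w hw hw0) hle
  · intro h
    obtain ⟨v, hv, hv0, rfl⟩ := h.prop
    refine ⟨hmindep v hv hv0, fun D hD hle => ?_⟩
    obtain ⟨-, w, hw, hw0, hs⟩ := (hdep D).1 hD
    exact (h.le_of_le ⟨w, hw, hw0, rfl⟩ (hs.trans hle)).trans hs

end

lemma SPSpace.eRank_spaceMatroid [DecidableEq γ] {E : Finset γ}
    {Z : Submodule (ZMod 2) (γ → ZMod 2)} {a : ℕ} (hZ : SPSpace E Z a) :
    (spaceMatroid Z (E : Set γ)).eRank = ((a + 1 : ℕ) : ℕ∞) := by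
  obtain ⟨B, hBE, hB, hind, hmax⟩ := hZ.exists_maximal_indepMod
  have hbase : (spaceMatroid Z (E : Set γ)).IsBase (B : Set γ) := by
    refine Matroid.Indep.isBase_of_forall_insert ⟨by exact_mod_cast hBE, hind⟩ ?_
    rintro x ⟨hx, hxB⟩
    exact fun h => hmax x hx (by simpa using hxB) h.2
  rw [← hbase.encard_eq_eRank, Set.encard_coe_eq_coe_finsetCard, hB]

lemma SPSpace.count_unique [DecidableEq γ] {E : Finset γ}
    {Z : Submodule (ZMod 2) (γ → ZMod 2)} {a a' : ℕ} (hZ : SPSpace E Z a)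
    (hZ' : SPSpace E Z a') : a = a' := by
  have := hZ.eRank_spaceMatroid.symm.trans hZ'.eRank_spaceMatroid
  have := Nat.cast_injective (R := ℕ∞) this
  omega

/-- The number of conjunctions depends on the function alone, as it is one less than the rank of the
matroid it determines; the spare element e serves as root. -/
lemma ReadOnce.counts_unique [DecidableEq γ] {A : Finset γ} {f : Set γ → Prop} {a b a' b' : ℕ}
    (h : ReadOnce A f a b) (h' : ReadOnce A f a' b') {e : γ} (he : e ∉ A) : a = a' ∧ b = b' := by
  obtain ⟨Z, hZ, hf⟩ := h.exists_spSpace he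
  obtain ⟨Z', hZ', hf'⟩ := h'.exists_spSpace he
  have : Z = Z' := hZ.eq_of_pathFn_eq hZ' (by simp) (by simp) (hf.trans hf'.symm)
  subst this
  have h1 := hZ.count_unique hZ'
  have h2 := h.card_eq
  have h3 := h'.card_eq
  omega

end SpaceMatroid

/-! ### The cycle space of a graph: its minimal supports are the cycles. -/

namespace Graph

variable {α γ : Type*} {G H : Graph α γ}

open Classical in
/-- The sum of the values of a vertex function at the ends of an edge. -/
noncomputable def endSum (G : Graph α γ) (p : α → ZMod 2) (e : γ) : ZMod 2 :=
  if h : ∃ x y, G.IsLink e x y then p h.choose + p h.choose_spec.choose else 0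

lemma IsLink.endSum_eq {e : γ} {x y : α} (h : G.IsLink e x y) (p : α → ZMod 2) :
    G.endSum p e = p x + p y := by
  have hex : ∃ x y, G.IsLink e x y := ⟨x, y, h⟩
  rw [endSum, dif_pos hex]
  rcases h.eq_and_eq_or_eq_and_eq hex.choose_spec.choose_spec with ⟨h1, h2⟩ | ⟨h1, h2⟩
  · exact congrArg₂ (· + ·) (congrArg p h1.symm) (congrArg p h2.symm)
  · rw [add_comm (p x)]
    exact congrArg₂ (· + ·) (congrArg p h2.symm) (congrArg p h1.symm)

lemma endSum_eq_zero {e : γ} (h : e ∉ E(G)) (p : α → ZMod 2) : G.endSum p e = 0 := by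
  rw [endSum, dif_neg]
  rintro ⟨x, y, hxy⟩
  exact h hxy.edge_mem

lemma endSum_congr {e : γ} (h : ∀ x y, H.IsLink e x y ↔ G.IsLink e x y) (p : α → ZMod 2) :
    H.endSum p e = G.endSum p e := by
  by_cases he : e ∈ E(G)
  · obtain ⟨x, y, hxy⟩ := exists_isLink_of_mem_edgeSet he
    rw [hxy.endSum_eq, ((h x y).2 hxy).endSum_eq]
  · rw [endSum_eq_zero he, endSum_eq_zero]
    intro he'
    obtain ⟨x, y, hxy⟩ := exists_isLink_of_mem_edgeSet he'
    exact he ((h x y).1 hxy).edge_mem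

section CycleSpace

variable [Fintype γ]

/-- The binary cycle space of a graph. -/
noncomputable def cycleSpace (G : Graph α γ) : Submodule (ZMod 2) (γ → ZMod 2) where
  carrier := {v | (∀ e, e ∉ E(G) → v e = 0) ∧ ∀ p : α → ZMod 2, ∑ e, v e * G.endSum p e = 0}
  add_mem' := fun {v w} hv hw => ⟨fun e he => by simp [hv.1 e he, hw.1 e he], fun p => by
    simp [add_mul, Finset.sum_add_distrib, hv.2 p, hw.2 p]⟩
  zero_mem' := by simp
  smul_mem' := fun r v hv => ⟨fun e he => by simp [hv.1 e he], fun p => by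
    simp [mul_assoc, ← Finset.mul_sum, hv.2 p]⟩

lemma mem_cycleSpace {v : γ → ZMod 2} : v ∈ G.cycleSpace ↔
    (∀ e, e ∉ E(G) → v e = 0) ∧ ∀ p : α → ZMod 2, ∑ e, v e * G.endSum p e = 0 := Iff.rfl

/-- A member of the cycle space supported on a cycle is constant along it, so it is zero or has the
full cycle as support. -/
lemma IsCycleEdgeSet.isMinSupport {C : Set γ} (hC : G.IsCycleEdgeSet C) :
    IsMinSupport G.cycleSpace C := by
  classical
  obtain ⟨k, v, e, hv, he, hlink, rfl⟩ := hC
  have hsum : ∀ w : γ → ZMod 2, (∀ g, w g ≠ 0 → g ∈ Set.range e) → ∀ p : α → ZMod 2,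
      ∑ g, w g * G.endSum p g = ∑ i, w (e i) * (p (v i) + p (v (i + 1))) := by
    intro w hw p
    have h1 : ∀ i, w (e i) * (p (v i) + p (v (i + 1))) = w (e i) * G.endSum p (e i) := fun i => by
      rw [(hlink i).endSum_eq]
    rw [Finset.sum_congr rfl fun i _ => h1 i,
      ← Finset.sum_image (f := fun g => w g * G.endSum p g) (g := e) he.injOn]
    refine (Finset.sum_subset (Finset.subset_univ _) fun g _ hg => ?_).symm
    have : w g = 0 := by
      by_contra h
      obtain ⟨i, hi⟩ := hw g h
      exact hg (Finset.mem_image.2 ⟨i, Finset.mem_univ _, hi⟩)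
    rw [this, zero_mul]
  have hconst : ∀ w ∈ G.cycleSpace, vecSupport w ⊆ Set.range e → ∀ i, w (e i) = w (e 0) := by
    intro w hw hs
    have hstep : ∀ i, w (e (i + 1)) = w (e i) := by
      intro i
      -- Testing against the indicator of a vertex compares the two cycle edges that meet there.
      have h1 := hw.2 (fun x => if x = v (i + 1) then 1 else 0)
      rw [hsum w hs] at h1
      simp only [mul_add, Finset.sum_add_distrib, hv.eq_iff, add_left_inj, mul_ite, mul_one,
        mul_zero, Finset.sum_ite_eq', Finset.mem_univ, if_true] at h1
      exact CharTwo.add_eq_zero.1 h1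
    intro i
    induction i using Fin.induction with
    | zero => rfl
    | succ i ih => rw [← ih, ← Fin.coeSucc_eq_succ, hstep]
  let χ : γ → ZMod 2 := fun g => if g ∈ Set.range e then 1 else 0
  have hχs : vecSupport χ = Set.range e := by
    ext g; simp [mem_vecSupport, χ]
  refine ⟨⟨χ, ⟨fun g hg => if_neg ?_, fun p => ?_⟩, fun h => ?_, hχs⟩, ?_⟩
  · rintro ⟨i, rfl⟩
    exact hg (hlink i).edge_mem
  · rw [hsum χ (fun g hg => hχs ▸ hg)]
    have h1 : ∀ i, χ (e i) = 1 := fun i => if_pos ⟨i, rfl⟩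
    simp only [h1, one_mul, Finset.sum_add_distrib]
    have h2 := Equiv.sum_comp (Equiv.addRight (1 : Fin (k + 1))) (fun i => p (v i))
    simp only [Equiv.coe_addRight] at h2
    rw [h2]
    exact zmod_two_add_self _
  · have := congrFun h (e 0)
    simp [χ] at this
  · rintro _ ⟨w, hw, hw0, rfl⟩ hle
    rintro _ ⟨i, rfl⟩
    rw [mem_vecSupport, hconst w hw hle i]
    intro h0
    apply hw0
    funext g
    by_contra hg
    obtain ⟨j, rfl⟩ := hle hg
    exact hg ((hconst w hw hle j).trans h0)

/-- A set of edges without loops in which every walk can be continued contains a cycle. -/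
lemma exists_isCycleEdgeSet_of_walk {x : ℕ → α} {e : ℕ → γ}
    (hlink : ∀ n, G.IsLink (e n) (x n) (x (n + 1))) (hne : ∀ n, e (n + 1) ≠ e n) :
    ∃ C, C ⊆ Set.range e ∧ G.IsCycleEdgeSet C := by
  classical
  have hrep : ∃ m, 0 < m ∧ ∃ i, x i = x (i + m) := by
    by_contra! hcon
    have hx : Function.Injective x := by
      intro i j hij
      by_contra hne
      rcases Nat.lt_or_gt_of_ne hne with h | h
      · exact hcon (j - i) (by omega) i (by rw [hij]; congr 1; omega)
      · exact hcon (i - j) (by omega) j (by rw [← hij]; congr 1; omega)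
    have he : Function.Injective e := by
      intro i j hij
      have h1 := hlink i
      rw [hij] at h1
      rcases h1.eq_and_eq_or_eq_and_eq (hlink j) with ⟨h2, -⟩ | ⟨h2, h3⟩
      · exact hx h2
      · have h4 := hx h2
        have h5 := hx h3
        omega
    exact not_injective_infinite_finite e he
  -- The shortest return time over all starting points makes the vertices of the closed segment
  -- distinct; distinctness of the edges also uses that consecutive edges differ.
  obtain ⟨hm, i, hi⟩ := Nat.find_spec hrep
  have hmin : ∀ m' < Nat.find hrep, 0 < m' → ∀ i, x i ≠ x (i + m') := fun m' hm' h0 i hi' =>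
    Nat.find_min hrep hm' ⟨h0, i, hi'⟩
  generalize Nat.find hrep = m at hm hi hmin
  obtain ⟨k, rfl⟩ : ∃ k, m = k + 1 := ⟨m - 1, by omega⟩
  have hxinj : ∀ s t : ℕ, s < k + 1 → t < k + 1 → x (i + s) = x (i + t) → s = t := by
    intro s t hs ht hst
    by_contra hne
    rcases Nat.lt_or_gt_of_ne hne with h | h
    · exact hmin (t - s) (by omega) (by omega) (i + s) (by rw [hst]; congr 1; omega)
    · exact hmin (s - t) (by omega) (by omega) (i + t) (by rw [← hst]; congr 1; omega)
  have heinj : ∀ s t : ℕ, s < t → t < k + 1 → e (i + s) ≠ e (i + t) := by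
    intro s t hst ht h
    have h1 := hlink (i + s)
    rw [h] at h1
    rcases h1.eq_and_eq_or_eq_and_eq (hlink (i + t)) with ⟨h2, -⟩ | ⟨-, h3⟩
    · have := hxinj s t (by omega) ht h2
      omega
    · have := hxinj (s + 1) t (by omega) ht h3
      subst this
      exact hne (i + s) h.symm
  refine ⟨Set.range fun t : Fin (k + 1) => e (i + t), ?_, k, fun t => x (i + t), fun t => e (i + t),
    ?_, ?_, ?_, rfl⟩
  · rintro _ ⟨t, rfl⟩; exact ⟨_, rfl⟩
  · intro s t hst
    exact Fin.ext (hxinj s t s.2 t.2 hst)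
  · intro s t hst
    by_contra hne
    rcases lt_or_gt_of_ne hne with h | h
    · exact heinj s t h t.2 hst
    · exact heinj t s h s.2 hst.symm
  · intro t
    have h1 := hlink (i + t)
    have h2 : x (i + t + 1) = x (i + ((t + 1 : Fin (k + 1)) : ℕ)) := by
      by_cases ht : t = Fin.last k
      · subst ht
        rw [Fin.last_add_one]
        simpa [add_assoc] using hi.symm
      · rw [Fin.val_add_one_of_lt (lt_of_le_of_ne (Fin.le_last t) ht)]
        rfl
    rwa [h2] at h1

/-- Unless the support contains a loop, parity lets a walk in it leave every vertex by an edge other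
than the one just used; an infinite such walk contains a cycle. -/
lemma exists_isCycleEdgeSet_subset {w : γ → ZMod 2} (hw : w ∈ G.cycleSpace) (hw0 : w ≠ 0) :
    ∃ C, C ⊆ vecSupport w ∧ G.IsCycleEdgeSet C := by
  classical
  by_cases hloop : ∃ e x, w e ≠ 0 ∧ G.IsLink e x x
  · obtain ⟨e, x, he, hx⟩ := hloop
    exact ⟨{e}, by simpa [mem_vecSupport] using he, 0, fun _ => x, fun _ => e,
      fun _ _ _ => Subsingleton.elim (α := Fin 1) _ _,
      fun _ _ _ => Subsingleton.elim (α := Fin 1) _ _, fun _ => hx, by simp⟩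
  push Not at hloop
  have hnext : ∀ (e : γ) (x y : α), w e ≠ 0 → G.IsLink e x y →
      ∃ e' z, e' ≠ e ∧ w e' ≠ 0 ∧ G.IsLink e' y z := by
    intro e x y he hxy
    by_contra! hcon
    have hne : x ≠ y := by rintro rfl; exact hloop e x he hxy
    have h1 := hw.2 (fun u => if u = y then 1 else 0)
    rw [Finset.sum_eq_single e] at h1
    · rw [hxy.endSum_eq, zmod_two_eq_one he, if_neg hne, if_pos rfl] at h1
      exact absurd h1 (by decide)
    · intro e' _ he'
      by_cases hwe' : w e' = 0
      · rw [hwe', zero_mul]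
      have he'E : e' ∈ E(G) := by
        by_contra h; exact hwe' (hw.1 e' h)
      obtain ⟨a, b, hab⟩ := exists_isLink_of_mem_edgeSet he'E
      have ha : a ≠ y := by rintro rfl; exact hcon e' b he' hwe' hab
      have hb : b ≠ y := by rintro rfl; exact hcon e' a he' hwe' hab.symm
      rw [hab.endSum_eq, if_neg ha, if_neg hb]
      simp
    · simp
  let S := {q : γ × α × α // w q.1 ≠ 0 ∧ G.IsLink q.1 q.2.1 q.2.2}
  have hstep : ∀ q : S, ∃ q' : S, q'.1.1 ≠ q.1.1 ∧ q'.1.2.1 = q.1.2.2 := by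
    rintro ⟨⟨e, x, y⟩, he, hxy⟩
    obtain ⟨e', z, h1, h2, h3⟩ := hnext e x y he hxy
    exact ⟨⟨⟨e', y, z⟩, h2, h3⟩, h1, rfl⟩
  choose next hnext1 hnext2 using hstep
  obtain ⟨e, he⟩ : ∃ e, w e ≠ 0 := by
    by_contra! h; exact hw0 (funext h)
  have heE : e ∈ E(G) := by
    by_contra h; exact he (hw.1 e h)
  obtain ⟨a, b, hab⟩ := exists_isLink_of_mem_edgeSet heE
  let q : ℕ → S := fun n => next^[n] ⟨⟨e, a, b⟩, he, hab⟩
  have hq : ∀ n, q (n + 1) = next (q n) := fun n => Function.iterate_succ_apply' _ _ _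
  obtain ⟨C, hC, hC'⟩ := exists_isCycleEdgeSet_of_walk (G := G) (x := fun n => (q n).1.2.1)
    (e := fun n => (q n).1.1)
    (fun n => by
      have h1 := (q n).2.2
      rw [← hnext2, ← hq] at h1
      exact h1)
    (fun n => by
      have := hnext1 (q n)
      rwa [← hq] at this)
  refine ⟨C, hC.trans ?_, hC'⟩
  rintro _ ⟨n, rfl⟩
  exact (q n).2.1

/-- The cycles are the minimal supports of the binary cycle space. -/
theorem isCycleEdgeSet_iff_isMinSupport {C : Set γ} :
    G.IsCycleEdgeSet C ↔ IsMinSupport G.cycleSpace C := by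
  refine ⟨fun h => h.isMinSupport, fun h => ?_⟩
  obtain ⟨v, hv, hv0, rfl⟩ := h.prop
  obtain ⟨C, hC, hC'⟩ := exists_isCycleEdgeSet_subset hv hv0
  have := h.eq_of_subset hC'.isMinSupport.prop hC
  rwa [← this]

section Extensions

variable [DecidableEq γ]

lemma mem_cycleSpace_of_twoCycle {x y : α} {e f : γ} (hxy : x ≠ y) (hef : e ≠ f)
    (hlink : ∀ g a b, G.IsLink g a b ↔ (g = e ∨ g = f) ∧ s(a, b) = s(x, y)) :
    E(G) = ({e, f} : Finset γ) ∧
      ∀ v, v ∈ G.cycleSpace ↔ v e = v f ∧ ∀ k, k ≠ e → k ≠ f → v k = 0 := by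
  classical
  have hE : E(G) = ({e, f} : Finset γ) := by
    ext g
    rw [edge_mem_iff_exists_isLink]
    simp only [hlink, Finset.coe_insert, Finset.coe_singleton, Set.mem_insert_iff,
      Set.mem_singleton_iff]
    exact ⟨fun ⟨a, b, h, _⟩ => h, fun h => ⟨x, y, h, rfl⟩⟩
  have he : ∀ p, G.endSum p e = p x + p y := ((hlink e x y).2 ⟨Or.inl rfl, rfl⟩).endSum_eq
  have hf : ∀ p, G.endSum p f = p x + p y := ((hlink f x y).2 ⟨Or.inr rfl, rfl⟩).endSum_eq
  refine ⟨hE, fun v => ?_⟩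
  have hsum : (∀ k, k ≠ e → k ≠ f → v k = 0) → ∀ p : α → ZMod 2,
      ∑ g, v g * G.endSum p g = (v e + v f) * (p x + p y) := by
    intro hv p
    rw [← Finset.sum_subset (Finset.subset_univ {e, f}) fun g _ hg => ?_,
      Finset.sum_pair hef, he, hf, add_mul]
    simp only [Finset.mem_insert, Finset.mem_singleton, not_or] at hg
    rw [hv g hg.1 hg.2, zero_mul]
  rw [mem_cycleSpace]
  constructor
  · rintro ⟨h1, h2⟩
    have h3 : ∀ k, k ≠ e → k ≠ f → v k = 0 := fun k hk hk' => h1 k (by simp [hE, hk, hk'])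
    refine ⟨?_, h3⟩
    have h4 := h2 (fun u => if u = x then 1 else 0)
    rw [hsum h3, if_pos rfl, if_neg hxy.symm, add_zero, mul_one] at h4
    exact CharTwo.add_eq_zero.1 h4
  · rintro ⟨h1, h2⟩
    refine ⟨fun k hk => ?_, fun p => ?_⟩
    · simp only [hE, Finset.coe_insert, Finset.coe_singleton, Set.mem_insert_iff,
        Set.mem_singleton_iff, not_or] at hk
      exact h2 k hk.1 hk.2
    · rw [hsum h2, h1, zmod_two_add_self, zero_mul]

/-- Parallel edges have equal end sums, so only the sum of their coefficients enters the cycle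
conditions. -/
lemma mem_cycleSpace_of_parallel {e f : γ} {x y : α} (he : G.IsLink e x y) (hf : f ∉ E(G))
    (hlink : ∀ g a b, H.IsLink g a b ↔ G.IsLink g a b ∨ (g = f ∧ s(a, b) = s(x, y))) :
    E(H) = insert f E(G) ∧ ∀ v, v ∈ H.cycleSpace ↔ mergeMap e f v ∈ G.cycleSpace := by
  have hef : e ≠ f := by rintro rfl; exact hf he.edge_mem
  have hE : E(H) = insert f E(G) := by
    ext g
    simp only [edge_mem_iff_exists_isLink, hlink, Set.mem_insert_iff]
    constructor
    · rintro ⟨a, b, h | ⟨h, -⟩⟩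
      · exact Or.inr ⟨a, b, h⟩
      · exact Or.inl h
    · rintro (h | ⟨a, b, h⟩)
      · exact ⟨x, y, Or.inr ⟨h, rfl⟩⟩
      · exact ⟨a, b, Or.inl h⟩
  refine ⟨hE, fun v => ?_⟩
  have hsum : ∀ p, ∑ g, v g * H.endSum p g = ∑ g, mergeMap e f v g * G.endSum p g := by
    intro p
    have hterm : ∀ g, v g * H.endSum p g = mergeMap e f v g * G.endSum p g +
        ((if g = e then v f * (p x + p y) else 0) + if g = f then v f * (p x + p y) else 0) := by
      intro g
      rw [mergeMap_apply]
      by_cases hgf : g = f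
      · subst hgf
        rw [if_pos rfl, if_neg hef.symm, if_pos rfl, zero_mul, zero_add, zero_add,
          ((hlink g x y).2 (Or.inr ⟨rfl, rfl⟩)).endSum_eq]
      · rw [endSum_congr (G := G) (H := H) (fun a b => by simp [hlink, hgf]), if_neg hgf,
          if_neg hgf]
        by_cases hge : g = e
        · subst hge
          rw [if_pos rfl, if_pos rfl, he.endSum_eq, add_zero, add_mul, add_assoc,
            zmod_two_add_self, add_zero]
        · rw [if_neg hge, if_neg hge, add_zero, add_zero]
    rw [Finset.sum_congr rfl fun g _ => hterm g, Finset.sum_add_distrib, Finset.sum_add_distrib,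
      Finset.sum_ite_eq' Finset.univ e, Finset.sum_ite_eq' Finset.univ f]
    simp [zmod_two_add_self]
  rw [mem_cycleSpace, mem_cycleSpace]
  refine and_congr ?_ (forall_congr' fun p => by rw [hsum])
  rw [hE]
  constructor
  · intro h g hg
    rw [mergeMap_apply]
    split_ifs with h1 h2
    · rfl
    · exact absurd (h2 ▸ he.edge_mem) hg
    · exact h g (by simp [h1, hg])
  · intro h g hg
    rw [Set.mem_insert_iff, not_or] at hg
    have := h g hg.2
    rwa [mergeMap_apply, if_neg hg.1, if_neg (by rintro rfl; exact hg.2 he.edge_mem)] at this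

lemma mem_cycleSpace_of_series {e f : γ} {x y z : α} (he : G.IsLink e x y) (hf : f ∉ E(G))
    (hz : z ∉ V(G)) (hlink : ∀ g a b, H.IsLink g a b ↔
      (g ≠ e ∧ G.IsLink g a b) ∨ (g = e ∧ s(a, b) = s(x, z)) ∨ (g = f ∧ s(a, b) = s(z, y))) :
    E(H) = insert f E(G) ∧
      ∀ v, v ∈ H.cycleSpace ↔ v e = v f ∧ eraseMap f v ∈ G.cycleSpace := by
  classical
  have hef : e ≠ f := by rintro rfl; exact hf he.edge_mem
  have hE : E(H) = insert f E(G) := by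
    ext g
    simp only [edge_mem_iff_exists_isLink, hlink, Set.mem_insert_iff]
    constructor
    · rintro ⟨a, b, ⟨-, h⟩ | ⟨h, -⟩ | ⟨h, -⟩⟩
      · exact Or.inr ⟨a, b, h⟩
      · exact Or.inr ⟨x, y, h ▸ he⟩
      · exact Or.inl h
    · rintro (h | ⟨a, b, h⟩)
      · exact ⟨z, y, Or.inr (Or.inr ⟨h, rfl⟩)⟩
      · by_cases hge : g = e
        · exact ⟨x, z, Or.inr (Or.inl ⟨hge, rfl⟩)⟩
        · exact ⟨a, b, Or.inl ⟨hge, h⟩⟩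
  have hHe : ∀ p, H.endSum p e = p x + p z :=
    ((hlink e x z).2 (Or.inr (Or.inl ⟨rfl, rfl⟩))).endSum_eq
  have hHf : ∀ p, H.endSum p f = p z + p y :=
    ((hlink f z y).2 (Or.inr (Or.inr ⟨rfl, rfl⟩))).endSum_eq
  refine ⟨hE, fun v => ?_⟩
  have hsum : ∀ p, ∑ g, v g * H.endSum p g =
      ∑ g, eraseMap f v g * G.endSum p g + (v e + v f) * (p z + p y) := by
    intro p
    have hterm : ∀ g, v g * H.endSum p g = eraseMap f v g * G.endSum p g +
        ((if g = e then v e * (p z + p y) else 0) + if g = f then v f * (p z + p y) else 0) := by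
      intro g
      rw [eraseMap_apply]
      by_cases hgf : g = f
      · subst hgf
        rw [if_pos rfl, if_neg hef.symm, if_pos rfl, zero_mul, zero_add, zero_add, hHf]
      · rw [if_neg hgf, if_neg hgf]
        by_cases hge : g = e
        · subst hge
          rw [if_pos rfl, he.endSum_eq, hHe]
          linear_combination (-v g) * zmod_two_add_self (p y)
        · rw [endSum_congr (G := G) (H := H) (fun a b => by simp [hlink, hgf, hge]), if_neg hge,
            add_zero, add_zero]
    rw [Finset.sum_congr rfl fun g _ => hterm g, Finset.sum_add_distrib, Finset.sum_add_distrib,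
      Finset.sum_ite_eq' Finset.univ e, Finset.sum_ite_eq' Finset.univ f]
    simp [add_mul]
  have hsupp : (∀ g, g ∉ E(H) → v g = 0) ↔ ∀ g, g ∉ E(G) → eraseMap f v g = 0 := by
    rw [hE]
    constructor
    · intro h g hg
      rw [eraseMap_apply]
      split_ifs with h1
      · rfl
      · exact h g (by simp [h1, hg])
    · intro h g hg
      rw [Set.mem_insert_iff, not_or] at hg
      have := h g hg.2
      rwa [eraseMap_apply, if_neg hg.1] at this
  rw [mem_cycleSpace, mem_cycleSpace, hsupp]
  constructor
  · rintro ⟨h1, h2⟩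
    have h3 : v e = v f := by
      -- The new vertex z meets only e and f, so its parity condition equates their coefficients.
      have h3 := h2 (fun u => if u = z then 1 else 0)
      have hy : y ≠ z := by rintro rfl; exact hz he.right_mem
      rw [hsum, if_pos rfl, if_neg hy, add_zero, mul_one, Finset.sum_eq_zero, zero_add] at h3
      · exact CharTwo.add_eq_zero.1 h3
      · intro g _
        by_cases hg : g ∈ E(G)
        · obtain ⟨a, b, hab⟩ := exists_isLink_of_mem_edgeSet hg
          have ha : a ≠ z := by rintro rfl; exact hz hab.left_mem
          have hb : b ≠ z := by rintro rfl; exact hz hab.right_mem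
          rw [hab.endSum_eq, if_neg ha, if_neg hb, add_zero, mul_zero]
        · rw [endSum_eq_zero hg, mul_zero]
    refine ⟨h3, h1, fun p => ?_⟩
    have := h2 p
    rwa [hsum, h3, zmod_two_add_self, zero_mul, add_zero] at this
  · rintro ⟨h3, h1, h2⟩
    refine ⟨h1, fun p => ?_⟩
    rw [hsum, h2, h3, zmod_two_add_self, zero_mul, add_zero]

/-- The cycle space of a series-parallel graph. -/
theorem BuiltFromTwoCycle.exists_spSpace (h : G.BuiltFromTwoCycle) :
    ∃ (E : Finset γ) (a : ℕ), E(G) = (E : Set γ) ∧ SPSpace E G.cycleSpace a := by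
  induction h with
  | twoCycle hG =>
    obtain ⟨x, y, e, f, hxy, hef, -, hlink⟩ := hG
    obtain ⟨hE, hZ⟩ := mem_cycleSpace_of_twoCycle hxy hef hlink
    exact ⟨{e, f}, 0, hE, .base hef hZ⟩
  | series _ hext ih =>
    obtain ⟨E, a, hE, hZ⟩ := ih
    obtain ⟨e, f, x, y, z, he, hf, hz, -, hlink⟩ := hext
    obtain ⟨hEH, hW⟩ := mem_cycleSpace_of_series he hf hz hlink
    have he' := he.edge_mem
    rw [hE] at he' hf hEH
    exact ⟨insert f E, a + 1, by simpa using hEH,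
      .ser hZ (by simpa using he') (by simpa using hf) hW⟩
  | parallel _ hext ih =>
    obtain ⟨E, a, hE, hZ⟩ := ih
    obtain ⟨e, f, x, y, he, hf, -, hlink⟩ := hext
    obtain ⟨hEH, hW⟩ := mem_cycleSpace_of_parallel he hf hlink
    have he' := he.edge_mem
    rw [hE] at he' hf hEH
    exact ⟨insert f E, a, by simpa using hEH,
      .par hZ (by simpa using he') (by simpa using hf) hW⟩

end Extensions

end CycleSpace

end Graph

/-! ### Realising the spaces by graphs. -/

namespace Graph

variable {α γ : Type*} {G : Graph α γ}

lemma exists_isTwoCycle {x y : α} {e f : γ} (hxy : x ≠ y) (hef : e ≠ f) :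
    ∃ H : Graph α γ, H.IsTwoCycle ∧ V(H) = {x, y} ∧
      ∀ g a b, H.IsLink g a b ↔ (g = e ∨ g = f) ∧ s(a, b) = s(x, y) := by
  let H : Graph α γ :=
    { vertexSet := {x, y}
      IsLink := fun g a b => (g = e ∨ g = f) ∧ s(a, b) = s(x, y)
      isLink_symm := fun g _ => ⟨fun a b h => ⟨h.1, by rw [Sym2.eq_swap]; exact h.2⟩⟩
      eq_or_eq_of_isLink_of_isLink := by
        rintro g a b c d ⟨-, h⟩ ⟨-, h'⟩
        have := Sym2.eq_iff.1 (h.trans h'.symm)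
        tauto
      left_mem_of_isLink := by
        rintro g a b ⟨-, h⟩
        have := Sym2.eq_iff.1 h
        simp only [Set.mem_insert_iff, Set.mem_singleton_iff]
        tauto }
  exact ⟨H, ⟨x, y, e, f, hxy, hef, rfl, fun _ _ _ => Iff.rfl⟩, rfl, fun _ _ _ => Iff.rfl⟩

lemma exists_isParallelExtension {x y : α} {e f : γ} (he : G.IsLink e x y) (hf : f ∉ E(G)) :
    ∃ H : Graph α γ, G.IsParallelExtension H ∧ V(H) = V(G) ∧
      ∀ g a b, H.IsLink g a b ↔ G.IsLink g a b ∨ (g = f ∧ s(a, b) = s(x, y)) := by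
  let H : Graph α γ :=
    { vertexSet := V(G)
      IsLink := fun g a b => G.IsLink g a b ∨ (g = f ∧ s(a, b) = s(x, y))
      isLink_symm := fun g _ => ⟨fun a b h =>
        h.imp (fun h => h.symm) fun h => ⟨h.1, by rw [Sym2.eq_swap]; exact h.2⟩⟩
      eq_or_eq_of_isLink_of_isLink := by
        rintro g a b c d (h | ⟨rfl, h⟩) (h' | ⟨h1, h'⟩)
        · exact h.left_eq_or_eq h'
        · exact absurd (h1 ▸ h.edge_mem) hf
        · exact absurd h'.edge_mem hf
        · have := Sym2.eq_iff.1 (h.trans h'.symm)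
          tauto
      left_mem_of_isLink := by
        rintro g a b (h | ⟨rfl, h⟩)
        · exact h.left_mem
        · rcases Sym2.eq_iff.1 h with ⟨rfl, -⟩ | ⟨rfl, -⟩
          · exact he.left_mem
          · exact he.right_mem }
  exact ⟨H, ⟨e, f, x, y, he, hf, rfl, fun _ _ _ => Iff.rfl⟩, rfl, fun _ _ _ => Iff.rfl⟩

lemma exists_isSeriesExtension {x y z : α} {e f : γ} (he : G.IsLink e x y) (hf : f ∉ E(G))
    (hz : z ∉ V(G)) : ∃ H : Graph α γ, G.IsSeriesExtension H ∧ V(H) = insert z V(G) ∧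
      ∀ g a b, H.IsLink g a b ↔
        (g ≠ e ∧ G.IsLink g a b) ∨ (g = e ∧ s(a, b) = s(x, z)) ∨ (g = f ∧ s(a, b) = s(z, y)) := by
  have hef : f ≠ e := by rintro rfl; exact hf he.edge_mem
  let H : Graph α γ :=
    { vertexSet := insert z V(G)
      IsLink := fun g a b =>
        (g ≠ e ∧ G.IsLink g a b) ∨ (g = e ∧ s(a, b) = s(x, z)) ∨ (g = f ∧ s(a, b) = s(z, y))
      isLink_symm := fun g _ => ⟨fun a b h =>
        h.imp (fun h => ⟨h.1, h.2.symm⟩) fun h => by rwa [Sym2.eq_swap]⟩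
      eq_or_eq_of_isLink_of_isLink := by
        rintro g a b c d (⟨h0, h⟩ | ⟨h0, h⟩ | ⟨h0, h⟩) (⟨h1, h'⟩ | ⟨h1, h'⟩ | ⟨h1, h'⟩)
        · exact h.left_eq_or_eq h'
        · exact absurd h1 h0
        · exact absurd (h1 ▸ h.edge_mem) hf
        · exact absurd h0 h1
        · have := Sym2.eq_iff.1 (h.trans h'.symm)
          tauto
        · exact absurd (h1.symm.trans h0) hef
        · exact absurd (h0 ▸ h'.edge_mem) hf
        · exact absurd (h0.symm.trans h1) hef
        · have := Sym2.eq_iff.1 (h.trans h'.symm)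
          tauto
      left_mem_of_isLink := by
        rintro g a b (⟨-, h⟩ | ⟨rfl, h⟩ | ⟨rfl, h⟩)
        · exact Or.inr h.left_mem
        · rcases Sym2.eq_iff.1 h with ⟨rfl, -⟩ | ⟨rfl, -⟩
          · exact Or.inr he.left_mem
          · exact Or.inl rfl
        · rcases Sym2.eq_iff.1 h with ⟨rfl, -⟩ | ⟨rfl, -⟩
          · exact Or.inl rfl
          · exact Or.inr he.right_mem }
  exact ⟨H, ⟨e, f, x, y, z, he, hf, hz, rfl, fun _ _ _ => Iff.rfl⟩, rfl, fun _ _ _ => Iff.rfl⟩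

end Graph

/-- Every space of series-parallel type is the cycle space of a series-parallel graph. -/
theorem SPSpace.exists_graph {γ : Type*} [Fintype γ] [DecidableEq γ] {E : Finset γ}
    {Z : Submodule (ZMod 2) (γ → ZMod 2)} {a : ℕ} (hZ : SPSpace E Z a) :
    ∃ G : Graph ℕ γ, G.BuiltFromTwoCycle ∧ V(G).Finite ∧ E(G) = (E : Set γ) ∧
      G.cycleSpace = Z := by
  induction hZ with
  | @base Z i j hij hZ =>
    obtain ⟨H, hH, hV, hlink⟩ := Graph.exists_isTwoCycle (α := ℕ) zero_ne_one hij
    obtain ⟨hE, hmem⟩ := Graph.mem_cycleSpace_of_twoCycle zero_ne_one hij hlink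
    refine ⟨H, .twoCycle hH, by rw [hV]; simp, hE, ?_⟩
    ext v
    rw [hmem, hZ]
  | @par E Z W a g h hZ hg hh hW ih =>
    obtain ⟨G, hG, hV, hE, rfl⟩ := ih
    obtain ⟨x, y, hxy⟩ := Graph.exists_isLink_of_mem_edgeSet (G := G) (e := g) (by simp [hE, hg])
    have hhE : h ∉ E(G) := by simp [hE, hh]
    obtain ⟨H, hH, hVH, hlink⟩ := Graph.exists_isParallelExtension hxy hhE
    obtain ⟨hEH, hmem⟩ := Graph.mem_cycleSpace_of_parallel hxy hhE hlink
    refine ⟨H, .parallel hG hH, by rwa [hVH], by simp [hEH, hE], ?_⟩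
    ext v
    rw [hmem, hW]
  | @ser E Z W a g h hZ hg hh hW ih =>
    obtain ⟨G, hG, hV, hE, rfl⟩ := ih
    obtain ⟨x, y, hxy⟩ := Graph.exists_isLink_of_mem_edgeSet (G := G) (e := g) (by simp [hE, hg])
    have hhE : h ∉ E(G) := by simp [hE, hh]
    -- Finiteness of the vertex set is carried through the induction to supply a fresh natural
    -- number for the subdivision.
    obtain ⟨z, hz⟩ := hV.exists_notMem
    obtain ⟨H, hH, hVH, hlink⟩ := Graph.exists_isSeriesExtension hxy hhE hz
    obtain ⟨hEH, hmem⟩ := Graph.mem_cycleSpace_of_series hxy hhE hz hlink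
    refine ⟨H, .series hG hH, by rw [hVH]; exact hV.insert z, by simp [hEH, hE], ?_⟩
    ext v
    rw [hmem, hW]

/-! ### From matroids to cycle spaces to read-once functions. -/

lemma Graph.isCycleMatroid_spaceMatroid {α γ : Type*} [Fintype γ] (G : Graph α γ) :
    G.IsCycleMatroid (spaceMatroid G.cycleSpace E(G)) := by
  refine ⟨rfl, fun C => ?_⟩
  rw [isCycleEdgeSet_iff_isMinSupport, spaceMatroid_isCircuit_iff]
  intro v hv i hi
  by_contra h
  exact hi (hv.1 i h)

lemma Graph.IsCycleMatroid.eq_spaceMatroid {α γ : Type*} [Fintype γ] {G : Graph α γ}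
    {M : Matroid γ} (hM : G.IsCycleMatroid M) : M = spaceMatroid G.cycleSpace E(G) :=
  Matroid.ext_isCircuit hM.1 fun C _ =>
    (hM.2 C).trans (G.isCycleMatroid_spaceMatroid.2 C).symm

lemma Graph.IsSeriesParallel.builtFromTwoCycle {α γ : Type*} {G : Graph α γ}
    (hG : G.IsSeriesParallel) (hE : E(G).encard ≠ 1) : G.BuiltFromTwoCycle := by
  have key : ∀ (x y : α) (e : γ), (∀ g a b, G.IsLink g a b ↔ g = e ∧ s(a, b) = s(x, y)) →
      E(G).encard = 1 := by
    intro x y e hlink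
    rw [Set.encard_eq_one]
    refine ⟨e, ?_⟩
    ext g
    simp only [Graph.edge_mem_iff_exists_isLink, hlink, Set.mem_singleton_iff]
    exact ⟨fun ⟨_, _, h, _⟩ => h, fun h => ⟨x, y, h, rfl⟩⟩
  rcases hG with ⟨x, y, e, -, -, hlink⟩ | ⟨x, e, -, hlink⟩ | h
  · exact absurd (key x y e hlink) hE
  · exact absurd (key x x e hlink) hE
  · exact h

/-- Counting series-parallel matroids amounts to counting their cycle spaces. -/
theorem numSeriesParallel_eq_ncard_spSpace {n : ℕ} (hn : 2 ≤ n) (a : ℕ) :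
    numSeriesParallel n (a + 1) =
      {Z : Submodule (ZMod 2) (Fin n → ZMod 2) | SPSpace Finset.univ Z a}.ncard := by
  symm
  refine Set.ncard_congr (fun Z _ => spaceMatroid Z Set.univ) ?_ ?_ ?_
  · intro Z hZ
    obtain ⟨G, hG, -, hE, rfl⟩ := hZ.exists_graph
    rw [Finset.coe_univ] at hE
    refine ⟨rfl, ⟨G, Or.inr (Or.inr hG), hE ▸ G.isCycleMatroid_spaceMatroid⟩, ?_⟩
    have := hZ.eRank_spaceMatroid
    rwa [Finset.coe_univ] at this
  · intro Z W hZ hW h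
    refine eq_of_isMinSupport_iff fun C => ?_
    rw [← spaceMatroid_isCircuit_iff (Z := Z) (E := Set.univ) fun _ _ => Set.subset_univ _,
      ← spaceMatroid_isCircuit_iff (Z := W) (E := Set.univ) fun _ _ => Set.subset_univ _, h]
  · rintro M ⟨hME, ⟨G, hG, hM⟩, hr⟩
    have hE : E(G) = Set.univ := hM.1.symm.trans hME
    have hG' := Graph.IsSeriesParallel.builtFromTwoCycle hG (by
      rw [hE, Set.encard_univ, ENat.card_eq_coe_fintype_card, Fintype.card_fin]
      norm_cast
      omega)
    obtain ⟨E, a', hE', hZ⟩ := hG'.exists_spSpace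
    have hEu : E = Finset.univ := by
      rw [← Finset.coe_eq_univ, ← hE', hE]
    subst hEu
    have hMeq : M = spaceMatroid G.cycleSpace Set.univ := by rw [hM.eq_spaceMatroid, hE]
    have h1 := hZ.eRank_spaceMatroid
    rw [Finset.coe_univ, ← hMeq, hr] at h1
    have h2 := Nat.cast_injective (R := ℕ∞) h1
    obtain rfl : a = a' := by omega
    exact ⟨_, hZ, hMeq.symm⟩

lemma numSeriesParallel_zero {n : ℕ} (hn : 2 ≤ n) : numSeriesParallel n 0 = 0 := by
  rw [numSeriesParallel]
  convert Set.ncard_empty (Matroid (Fin n))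
  rw [Set.eq_empty_iff_forall_notMem]
  rintro M ⟨hME, ⟨G, hG, hM⟩, hr⟩
  have hE : E(G) = Set.univ := hM.1.symm.trans hME
  have hG' := Graph.IsSeriesParallel.builtFromTwoCycle hG (by
    rw [hE, Set.encard_univ, ENat.card_eq_coe_fintype_card, Fintype.card_fin]
    norm_cast
    omega)
  obtain ⟨E, a', hE', hZ⟩ := hG'.exists_spSpace
  have h1 := hZ.eRank_spaceMatroid
  rw [← hE', ← hM.eq_spaceMatroid, hr] at h1
  have h2 := Nat.cast_injective (R := ℕ∞) h1
  omega

theorem ncard_spSpace_eq_ncard_readOnce {γ : Type*} [Fintype γ] [DecidableEq γ] {E : Finset γ}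
    {e : γ} (he : e ∈ E) (a : ℕ) :
    {Z : Submodule (ZMod 2) (γ → ZMod 2) | SPSpace E Z a}.ncard =
      {f : Set γ → Prop | ∃ b, ReadOnce (E.erase e) f a b}.ncard := by
  refine Set.ncard_congr (fun Z _ => pathFn Z e) (fun Z hZ => hZ.readOnce_pathFn he)
    (fun Z W hZ hW h => hZ.eq_of_pathFn_eq hW he he h) ?_
  rintro f ⟨b, hf⟩
  obtain ⟨Z, hZ, hZf⟩ := hf.exists_spSpace (Finset.notMem_erase e E)
  rw [Finset.insert_erase he] at hZ
  exact ⟨Z, hZ, hZf⟩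

/-! ### Unique factorisation and the recursion for the generating functions. -/

section Counting

variable {γ : Type*} [DecidableEq γ]

namespace ReadOnce

/-- Both B and B' split the common function, hence so does B ∩ B', which therefore splits the factor
g; as g is indecomposable and i lies in both sets, B ∩ B' is all of B. -/
lemma subset_of_and_eq {B D B' D' : Finset γ} {g h g' h' : Set γ → Prop}
    {a₁ b₁ a₂ b₂ a₃ b₃ a₄ b₄ : ℕ} (hg : ReadOnce B g a₁ b₁) (hh : ReadOnce D h a₂ b₂)
    (hg' : ReadOnce B' g' a₃ b₃) (hh' : ReadOnce D' h' a₄ b₄) (hBD : Disjoint B D)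
    (hBD' : Disjoint B' D') {i : γ} (hi : i ∈ B) (hi' : i ∈ B')
    (hdec : ¬ AndDecomposable B g)
    (heq : (fun x => g x ∧ h x) = fun x => g' x ∧ h' x) : B ⊆ B' := by
  have h1 := hg.andSplit_and hh hBD
  have h2 := hg'.andSplit_and hh' hBD'
  rw [← heq] at h2
  have h3 := ((hg.and hh hBD).andSplit_inter h1 h2).restrict (S := (B : Set γ))
  simp only [hg.and_restrict_left hh hBD] at h3
  rw [← Finset.coe_inter] at h3
  by_contra hcon
  refine hdec ⟨B ∩ B', Finset.inter_subset_left, ⟨i, Finset.mem_inter.2 ⟨hi, hi'⟩⟩, ?_, h3⟩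
  intro h
  exact hcon (Finset.inter_eq_left.1 h)

lemma and_decomposition_unique {B D B' D' : Finset γ} {g h g' h' : Set γ → Prop}
    {a₁ b₁ a₂ b₂ a₃ b₃ a₄ b₄ : ℕ} (hg : ReadOnce B g a₁ b₁) (hh : ReadOnce D h a₂ b₂)
    (hg' : ReadOnce B' g' a₃ b₃) (hh' : ReadOnce D' h' a₄ b₄) (hBD : Disjoint B D)
    (hBD' : Disjoint B' D') {i : γ} (hi : i ∈ B) (hi' : i ∈ B')
    (hdec : ¬ AndDecomposable B g) (hdec' : ¬ AndDecomposable B' g')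
    (heq : (fun x => g x ∧ h x) = fun x => g' x ∧ h' x) : B = B' ∧ g = g' ∧ h = h' := by
  have hBB : B = B' := Finset.Subset.antisymm
    (subset_of_and_eq hg hh hg' hh' hBD hBD' hi hi' hdec heq)
    (subset_of_and_eq hg' hh' hg hh hBD' hBD hi' hi hdec' heq.symm)
  subst hBB
  refine ⟨rfl, ?_, ?_⟩
  · rw [← hg.and_restrict_left hh hBD, ← hg'.and_restrict_left hh' hBD']
    funext x
    exact congrFun heq _
  · rw [← hg.and_restrict_right hh hBD, ← hg'.and_restrict_right hh' hBD']
    funext x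
    exact congrFun heq _

/-- Take a smallest splitting set containing i. A proper splitting of its factor would lift to f,
and that part or its complement would be a smaller splitting set containing i. -/
lemma exists_and_decomposition {A : Finset γ} {f : Set γ → Prop} {a b : ℕ}
    (hf : ReadOnce A f a b) (hdec : AndDecomposable A f) {i : γ} (hi : i ∈ A) :
    ∃ (B : Finset γ) (g h : Set γ → Prop) (a₁ b₁ a₂ b₂ : ℕ), i ∈ B ∧ B ⊂ A ∧
      ReadOnce B g a₁ b₁ ∧ ReadOnce (A \ B) h a₂ b₂ ∧ ¬ AndDecomposable B g ∧
      f = fun x => g x ∧ h x := by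
  classical
  have hcompl : ∀ C : Finset γ, C ⊆ A → AndSplit f C → AndSplit f (A \ C : Finset γ) := by
    intro C _ hC
    exact hf.andSplit_congr (fun j hj => by simp [hj]) hC.compl
  obtain ⟨B, hB, hmin⟩ := Finset.exists_min_image
    (A.powerset.filter fun B : Finset γ => i ∈ B ∧ AndSplit f (B : Set γ)) Finset.card
    ⟨A, by simp [hi, hf.andSplit_self]⟩
  simp only [Finset.mem_filter, Finset.mem_powerset] at hB hmin
  obtain ⟨hBA, hiB, hBs⟩ := hB
  have hBne : B ≠ A := by
    rintro rfl
    obtain ⟨C, hCA, ⟨j, hj⟩, hCne, hCs⟩ := hdec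
    have hlt : C.card < B.card := Finset.card_lt_card (hCA.ssubset_of_ne hCne)
    by_cases hiC : i ∈ C
    · have := hmin C ⟨hCA, hiC, hCs⟩
      omega
    · have h1 := hmin (B \ C) ⟨Finset.sdiff_subset, by simp [hiC, hi], hcompl C hCA hCs⟩
      have h2 : 0 < C.card := Finset.card_pos.2 ⟨j, hj⟩
      have h3 := Finset.card_sdiff_add_card_eq_card hCA
      omega
  obtain ⟨j, hjA, hjB⟩ : ∃ j ∈ A, j ∉ B :=
    Finset.exists_of_ssubset (hBA.ssubset_of_ne hBne)
  obtain ⟨a₁, b₁, hg⟩ := hf.restrict_of_andSplit hBs ⟨i, hi, hiB⟩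
  obtain ⟨a₂, b₂, hh⟩ := hf.restrict_of_andSplit hBs.compl ⟨j, hjA, hjB⟩
  have e1 : A.filter (· ∈ (B : Set γ)) = B := by
    ext k; simp only [Finset.mem_filter, Finset.mem_coe]; exact ⟨fun h => h.2, fun h => ⟨hBA h, h⟩⟩
  have e2 : A.filter (· ∈ (B : Set γ)ᶜ) = A \ B := by
    ext k; simp
  rw [e1] at hg
  rw [e2] at hh
  refine ⟨B, _, _, a₁, b₁, a₂, b₂, hiB, hBA.ssubset_of_ne hBne, hg, hh, ?_, ?_⟩
  · rintro ⟨C, hCB, ⟨k, hk⟩, hCne, hCs⟩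
    have hlt : C.card < B.card := Finset.card_lt_card (hCB.ssubset_of_ne hCne)
    have hlift : ∀ C : Finset γ, C ⊆ B → AndSplit (fun x => f (x ∪ (B : Set γ)ᶜ)) C →
        AndSplit f C := fun C hC hCs =>
      hf.andSplit_of_restrict hBs (by exact_mod_cast hC) hCs
    by_cases hiC : i ∈ C
    · have := hmin C ⟨hCB.trans hBA, hiC, hlift C hCB hCs⟩
      omega
    · have h1 := hmin (B \ C) ⟨Finset.sdiff_subset.trans hBA, by simp [hiC, hiB],
        hlift _ Finset.sdiff_subset (hg.andSplit_congr (fun j hj => by simp [hj]) hCs.compl)⟩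
      have h2 : 0 < C.card := Finset.card_pos.2 ⟨k, hk⟩
      have h3 := Finset.card_sdiff_add_card_eq_card hCB
      omega
  · funext x
    rw [compl_compl]
    exact propext (hBs x)

end ReadOnce

lemma sum_ssubsets_card {R : Type*} [CommRing R] (S : Finset γ) (F : ℕ → R) :
    ∑ C ∈ S.ssubsets, F C.card = ∑ k ∈ Finset.range S.card, (S.card.choose k : R) * F k := by
  have h1 : ∑ C ∈ S.powerset, F C.card = _ := Finset.sum_powerset_apply_card F
  rw [Finset.sum_range_succ, Nat.choose_self, one_smul] at h1
  have h2 := Finset.sum_erase_add S.powerset (fun C => F C.card) (Finset.mem_powerset_self S)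
  rw [h1] at h2
  have h3 := add_right_cancel h2
  rw [Finset.ssubsets, h3]
  simp

variable [Finite γ]

/-- The read-once functions of the variables in `A`. -/
noncomputable def readOnceFns (A : Finset γ) : Finset (Set γ → Prop) :=
  (Set.toFinite {f | ∃ a b, ReadOnce A f a b}).toFinset

lemma mem_readOnceFns {A : Finset γ} {f : Set γ → Prop} :
    f ∈ readOnceFns A ↔ ∃ a b, ReadOnce A f a b := by
  simp [readOnceFns]

variable {R : Type*} [CommRing R]

open Classical in
/-- The weight `p ^ a * q ^ b` of a read-once function with `a` conjunctions and `b`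
disjunctions. -/
noncomputable def readOnceWeight (p q : R) (A : Finset γ) (f : Set γ → Prop) : R :=
  if h : ∃ a b, ReadOnce A f a b then p ^ h.choose * q ^ h.choose_spec.choose else 0

lemma ReadOnce.weight_eq {A : Finset γ} {f : Set γ → Prop} {a b : ℕ} (hf : ReadOnce A f a b)
    {e : γ} (he : e ∉ A) (p q : R) : readOnceWeight p q A f = p ^ a * q ^ b := by
  have hex : ∃ a b, ReadOnce A f a b := ⟨a, b, hf⟩
  obtain ⟨h1, h2⟩ := hf.counts_unique hex.choose_spec.choose_spec he
  rw [readOnceWeight, dif_pos hex]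
  exact congrArg₂ (· * ·) (congrArg (p ^ ·) h1.symm) (congrArg (q ^ ·) h2.symm)

/-- The generating function of the read-once functions of the variables in `A`. -/
noncomputable def readOnceGen (p q : R) (A : Finset γ) : R :=
  ∑ f ∈ readOnceFns A, readOnceWeight p q A f

open Classical in
/-- The generating function of the read-once functions of `A` which are not conjunctions. -/
noncomputable def nonAndGen (p q : R) (A : Finset γ) : R :=
  ∑ f ∈ readOnceFns A with ¬ AndDecomposable A f, readOnceWeight p q A f

lemma boolDual_mem_readOnceFns {A : Finset γ} {f : Set γ → Prop} (hf : f ∈ readOnceFns A) :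
    boolDual f ∈ readOnceFns A := by
  obtain ⟨a, b, h⟩ := mem_readOnceFns.1 hf
  exact mem_readOnceFns.2 ⟨b, a, h.dual⟩

lemma readOnceWeight_dual {A : Finset γ} {f : Set γ → Prop} (hf : f ∈ readOnceFns A)
    {e : γ} (he : e ∉ A) (p q : R) :
    readOnceWeight p q A (boolDual f) = readOnceWeight q p A f := by
  obtain ⟨a, b, h⟩ := mem_readOnceFns.1 hf
  rw [h.weight_eq he, h.dual.weight_eq he, mul_comm]

lemma readOnceGen_swap {A : Finset γ} {e : γ} (he : e ∉ A) (p q : R) :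
    readOnceGen p q A = readOnceGen q p A :=
  Finset.sum_bij' (fun f _ => boolDual f) (fun f _ => boolDual f)
    (fun _ hf => boolDual_mem_readOnceFns hf) (fun _ hf => boolDual_mem_readOnceFns hf)
    (fun f _ => boolDual_boolDual f) (fun f _ => boolDual_boolDual f)
    (fun _ hf => (readOnceWeight_dual hf he q p).symm)

lemma nonAndGen_add_swap_of_two_le {A : Finset γ} {e : γ} (he : e ∉ A) (hA : 2 ≤ A.card)
    (p q : R) : nonAndGen p q A + nonAndGen q p A = readOnceGen p q A := by
  classical
  rw [readOnceGen, ← Finset.sum_filter_not_add_sum_filter _ (fun f => AndDecomposable A f),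
    nonAndGen]
  congr 1
  refine Finset.sum_bij' (fun f _ => boolDual f) (fun f _ => boolDual f) ?_ ?_
    (fun f _ => boolDual_boolDual f) (fun f _ => boolDual_boolDual f) ?_
  · intro f hf
    rw [Finset.mem_filter] at hf ⊢
    refine ⟨boolDual_mem_readOnceFns hf.1, ?_⟩
    obtain ⟨a, b, h⟩ := mem_readOnceFns.1 hf.1
    exact (h.andDecomposable_dual_iff hA).2 hf.2
  · intro f hf
    rw [Finset.mem_filter] at hf ⊢
    refine ⟨boolDual_mem_readOnceFns hf.1, ?_⟩
    obtain ⟨a, b, h⟩ := mem_readOnceFns.1 hf.1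
    rw [h.andDecomposable_dual_iff hA, not_not]
    exact hf.2
  · intro f hf
    exact (readOnceWeight_dual (Finset.mem_filter.1 hf).1 he p q).symm

lemma readOnceGen_singleton {i e : γ} (he : e ≠ i) (p q : R) :
    readOnceGen p q ({i} : Finset γ) = 1 := by
  have h1 : readOnceFns ({i} : Finset γ) = {fun x => i ∈ x} := by
    ext f
    rw [mem_readOnceFns, Finset.mem_singleton]
    constructor
    · rintro ⟨a, b, h⟩
      funext x
      rw [eq_iff_iff]
      constructor
      · intro hx
        by_contra hi
        exact h.not_of_disjoint (by simpa using hi) hx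
      · intro hx
        exact h.of_subset (by simpa using hx)
    · rintro rfl
      exact ⟨0, 0, .leaf i⟩
  rw [readOnceGen, h1, Finset.sum_singleton, (ReadOnce.leaf i).weight_eq (e := e) (by simpa using he)]
  simp

lemma nonAndGen_of_card_le_one {A : Finset γ} (hA : A.card ≤ 1) (p q : R) :
    nonAndGen p q A = readOnceGen p q A := by
  classical
  rw [nonAndGen, Finset.filter_true_of_mem fun f _ => not_andDecomposable_of_card_le_one hA]
  rfl

/-- A conjunction is uniquely the indecomposable factor containing i, on the variables i and C,
joined by one ∧ to an arbitrary function of the remaining variables, of which there is at least one.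
-/
lemma readOnceGen_eq_nonAndGen_add {A : Finset γ} {e : γ} (he : e ∉ A) {i : γ} (hi : i ∈ A)
    (p q : R) : readOnceGen p q A = nonAndGen p q A +
      p * ∑ C ∈ (A.erase i).ssubsets,
        nonAndGen p q (insert i C) * readOnceGen p q (A.erase i \ C) := by
  classical
  rw [readOnceGen, ← Finset.sum_filter_not_add_sum_filter _ (fun f => AndDecomposable A f)]
  refine congrArg₂ (· + ·) rfl ?_
  simp only [nonAndGen, readOnceGen, Finset.sum_mul_sum]
  simp only [← Finset.sum_product']
  rw [Finset.sum_sigma', Finset.mul_sum]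
  have hprop : ∀ C ∈ (A.erase i).ssubsets, i ∉ C ∧ insert i C ⊆ A ∧
      Disjoint (insert i C) (A.erase i \ C) ∧ insert i C ∪ (A.erase i \ C) = A := by
    intro C hC
    rw [Finset.mem_ssubsets] at hC
    have hiC : i ∉ C := fun h => Finset.notMem_erase i A (hC.1 h)
    refine ⟨hiC, Finset.insert_subset hi (hC.1.trans (Finset.erase_subset _ _)), ?_, ?_⟩
    · rw [Finset.disjoint_insert_left]
      exact ⟨by simp, Finset.disjoint_sdiff⟩
    · rw [Finset.insert_union, Finset.union_sdiff_of_subset hC.1, Finset.insert_erase hi]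
  symm
  refine Finset.sum_bij (fun x _ => fun y => x.2.1 y ∧ x.2.2 y) ?_ ?_ ?_ ?_
  · rintro ⟨C, g, h⟩ hx
    simp only [Finset.mem_sigma, Finset.mem_product, Finset.mem_filter, mem_readOnceFns] at hx ⊢
    obtain ⟨hC, ⟨⟨a₁, b₁, hg⟩, hgd⟩, a₂, b₂, hh⟩ := hx
    obtain ⟨hiC, -, hdisj, hun⟩ := hprop C hC
    have h1 := hg.and hh hdisj
    have h2 := hg.andDecomposable_and hh hdisj
    rw [hun] at h1 h2
    exact ⟨⟨_, _, h1⟩, h2⟩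
  · rintro ⟨C, g, h⟩ hx ⟨C', g', h'⟩ hx' heq
    simp only [Finset.mem_sigma, Finset.mem_product, Finset.mem_filter, mem_readOnceFns] at hx hx'
    obtain ⟨hC, ⟨⟨a₁, b₁, hg⟩, hgd⟩, a₂, b₂, hh⟩ := hx
    obtain ⟨hC', ⟨⟨a₃, b₃, hg'⟩, hgd'⟩, a₄, b₄, hh'⟩ := hx'
    obtain ⟨hiC, -, hdisj, -⟩ := hprop C hC
    obtain ⟨hiC', -, hdisj', -⟩ := hprop C' hC'
    obtain ⟨h1, rfl, rfl⟩ := hg.and_decomposition_unique hh hg' hh' hdisj hdisj' (i := i) (by simp)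
      (by simp) hgd hgd' heq
    have : C = C' := by
      rw [← Finset.erase_insert hiC, h1, Finset.erase_insert hiC']
    subst this
    rfl
  · intro f hf
    simp only [Finset.mem_filter, mem_readOnceFns] at hf
    obtain ⟨⟨a, b, hf⟩, hdec⟩ := hf
    obtain ⟨B, g, h, a₁, b₁, a₂, b₂, hiB, hBA, hg, hh, hgd, rfl⟩ :=
      hf.exists_and_decomposition hdec hi
    have h1 : insert i (B.erase i) = B := Finset.insert_erase hiB
    have h2 : A.erase i \ B.erase i = A \ B := by
      ext j; simp only [Finset.mem_sdiff, Finset.mem_erase]; grind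
    refine ⟨⟨B.erase i, g, h⟩, ?_, rfl⟩
    simp only [Finset.mem_sigma, Finset.mem_product, Finset.mem_filter, mem_readOnceFns,
      Finset.mem_ssubsets, h1, h2]
    refine ⟨?_, ⟨⟨a₁, b₁, hg⟩, hgd⟩, a₂, b₂, hh⟩
    refine (Finset.erase_subset_erase i hBA.1).ssubset_of_ne fun h => hBA.ne ?_
    rw [← h1, h, Finset.insert_erase hi]
  · rintro ⟨C, g, h⟩ hx
    simp only [Finset.mem_sigma, Finset.mem_product, Finset.mem_filter, mem_readOnceFns] at hx
    obtain ⟨hC, ⟨⟨a₁, b₁, hg⟩, hgd⟩, a₂, b₂, hh⟩ := hx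
    obtain ⟨hiC, hsub, hdisj, hun⟩ := hprop C hC
    have h1 := hg.and hh hdisj
    rw [hun] at h1
    simp only
    rw [h1.weight_eq he, hg.weight_eq fun h => he (hsub h), hh.weight_eq (e := e) fun h => he
      (Finset.erase_subset _ _ (Finset.sdiff_subset h))]
    ring

/-- The numbers of read-once functions of `m + 1` variables: all of them, those which are not
conjunctions, and those which are not disjunctions, weighted by `p` for each conjunction and `q`
for each disjunction. -/
noncomputable def readOnceSeq (p q : R) (m : ℕ) : R × R × R :=
  let σ := p * ∑ k : Fin m,
    (m.choose k : R) * (readOnceSeq p q k).2.1 * (readOnceSeq p q (m - 1 - k)).1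
  let π := q * ∑ k : Fin m,
    (m.choose k : R) * (readOnceSeq p q k).2.2 * (readOnceSeq p q (m - 1 - k)).1
  ((if m = 0 then 1 else 0) + σ + π, (if m = 0 then 1 else 0) + π, (if m = 0 then 1 else 0) + σ)
termination_by m
decreasing_by all_goals have := k.isLt; omega

lemma readOnceSeq_fst (p q : R) (m : ℕ) : (readOnceSeq p q m).1 = (readOnceSeq p q m).2.1 +
    p * ∑ k ∈ Finset.range m,
      (m.choose k : R) * (readOnceSeq p q k).2.1 * (readOnceSeq p q (m - 1 - k)).1 := by
  rw [Finset.sum_range fun k =>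
    (m.choose k : R) * (readOnceSeq p q k).2.1 * (readOnceSeq p q (m - 1 - k)).1]
  conv_lhs => rw [readOnceSeq]
  conv_rhs => enter [1]; rw [readOnceSeq]
  ring

lemma readOnceSeq_fst' (p q : R) (m : ℕ) : (readOnceSeq p q m).1 = (readOnceSeq p q m).2.2 +
    q * ∑ k ∈ Finset.range m,
      (m.choose k : R) * (readOnceSeq p q k).2.2 * (readOnceSeq p q (m - 1 - k)).1 := by
  rw [Finset.sum_range fun k =>
    (m.choose k : R) * (readOnceSeq p q k).2.2 * (readOnceSeq p q (m - 1 - k)).1]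
  conv_lhs => rw [readOnceSeq]
  conv_rhs => enter [1]; rw [readOnceSeq]

lemma readOnceSeq_add (p q : R) (m : ℕ) : (readOnceSeq p q m).2.1 + (readOnceSeq p q m).2.2 =
    (readOnceSeq p q m).1 + if m = 0 then 1 else 0 := by
  rw [readOnceSeq]
  ring

/-- Strong induction on the number of variables. The convolution sums involve only smaller sets, and
the remaining three linear relations determine the three generating functions. -/
theorem readOnceGen_eq_readOnceSeq {e : γ} (p q : R) (A : Finset γ) (he : e ∉ A)
    (hA : A.Nonempty) :
    readOnceGen p q A = (readOnceSeq p q (A.card - 1)).1 ∧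
      nonAndGen p q A = (readOnceSeq p q (A.card - 1)).2.1 ∧
      nonAndGen q p A = (readOnceSeq p q (A.card - 1)).2.2 := by
  obtain ⟨n, hn⟩ : ∃ n, A.card = n := ⟨_, rfl⟩
  induction n using Nat.strong_induction_on generalizing A with
  | _ n ih =>
    obtain ⟨i, hi⟩ := hA
    have hcard : (A.erase i).card = A.card - 1 := Finset.card_erase_of_mem hi
    have hpos : 0 < A.card := Finset.card_pos.2 ⟨i, hi⟩
    have hC : ∀ C ∈ (A.erase i).ssubsets, (insert i C).card = C.card + 1 ∧
        (insert i C).card < n ∧ e ∉ insert i C ∧ (A.erase i \ C).card = A.card - 1 - C.card ∧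
        (A.erase i \ C).Nonempty ∧ (A.erase i \ C).card < n ∧ e ∉ A.erase i \ C := by
      intro C hC
      rw [Finset.mem_ssubsets] at hC
      have hiC : i ∉ C := fun h => Finset.notMem_erase i A (hC.1 h)
      have h1 := Finset.card_insert_of_notMem hiC
      have h2 := Finset.card_lt_card hC
      have h3 := Finset.card_sdiff_of_subset hC.1
      refine ⟨h1, by omega, ?_, by omega, ?_, by omega, ?_⟩
      · intro h
        exact he (Finset.insert_subset hi (hC.1.trans (Finset.erase_subset _ _)) h)
      · rw [← Finset.card_pos]; omega
      · exact fun h => he (Finset.erase_subset _ _ (Finset.sdiff_subset h))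
    have hsum1 : ∑ C ∈ (A.erase i).ssubsets,
        nonAndGen p q (insert i C) * readOnceGen p q (A.erase i \ C) =
        ∑ k ∈ Finset.range (A.card - 1), ((A.card - 1).choose k : R) *
          (readOnceSeq p q k).2.1 * (readOnceSeq p q (A.card - 1 - 1 - k)).1 := by
      rw [Finset.sum_congr rfl (g := fun C : Finset γ => (readOnceSeq p q C.card).2.1 *
        (readOnceSeq p q (A.card - 1 - 1 - C.card)).1),
        sum_ssubsets_card _ fun k => (readOnceSeq p q k).2.1 *
          (readOnceSeq p q (A.card - 1 - 1 - k)).1, hcard]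
      · simp only [mul_assoc]
      · intro C hCm
        obtain ⟨h1, h2, h3, h4, h5, h6, h7⟩ := hC C hCm
        rw [(ih _ h2 _ h3 (by simp) rfl).2.1, (ih _ h6 _ h7 h5 rfl).1, h1, h4,
          add_tsub_cancel_right, Nat.sub_right_comm (A.card - 1)]
    have hsum2 : ∑ C ∈ (A.erase i).ssubsets,
        nonAndGen q p (insert i C) * readOnceGen q p (A.erase i \ C) =
        ∑ k ∈ Finset.range (A.card - 1), ((A.card - 1).choose k : R) *
          (readOnceSeq p q k).2.2 * (readOnceSeq p q (A.card - 1 - 1 - k)).1 := by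
      rw [Finset.sum_congr rfl (g := fun C : Finset γ => (readOnceSeq p q C.card).2.2 *
        (readOnceSeq p q (A.card - 1 - 1 - C.card)).1),
        sum_ssubsets_card _ fun k => (readOnceSeq p q k).2.2 *
          (readOnceSeq p q (A.card - 1 - 1 - k)).1, hcard]
      · simp only [mul_assoc]
      · intro C hCm
        obtain ⟨h1, h2, h3, h4, h5, h6, h7⟩ := hC C hCm
        rw [(ih _ h2 _ h3 (by simp) rfl).2.2, readOnceGen_swap h7, (ih _ h6 _ h7 h5 rfl).1, h1, h4,
          add_tsub_cancel_right, Nat.sub_right_comm (A.card - 1)]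
    have hd1 := readOnceGen_eq_nonAndGen_add he hi p q
    have hd2 := readOnceGen_eq_nonAndGen_add he hi q p
    rw [hsum1] at hd1
    rw [hsum2, ← readOnceGen_swap he] at hd2
    have hs1 := readOnceSeq_fst p q (A.card - 1)
    have hs2 := readOnceSeq_fst' p q (A.card - 1)
    have hs3 := readOnceSeq_add p q (A.card - 1)
    have hadd : nonAndGen p q A + nonAndGen q p A =
        readOnceGen p q A + if A.card - 1 = 0 then 1 else 0 := by
      split_ifs with h
      · obtain ⟨j, rfl⟩ := Finset.card_eq_one.1 (show A.card = 1 by omega)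
        rw [nonAndGen_of_card_le_one (by simp), nonAndGen_of_card_le_one (by simp),
          readOnceGen_swap he q p, readOnceGen_singleton (by simpa using he)]
      · rw [nonAndGen_add_swap_of_two_le he (by omega), add_zero]
    have hmain : readOnceGen p q A = (readOnceSeq p q (A.card - 1)).1 := by
      linear_combination hadd - hs3 + hd1 + hd2 - hs1 - hs2
    refine ⟨hmain, ?_, ?_⟩
    · linear_combination hmain - hd1 + hs1
    · linear_combination hmain - hd2 + hs2

end Counting

/-! ### Extracting coefficients. -/

lemma coeff_readOnceGen {γ : Type*} [DecidableEq γ] [Finite γ] {A : Finset γ} {e : γ}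
    (he : e ∉ A) (a : ℕ) :
    (readOnceGen (Polynomial.X : Polynomial ℚ) 1 A).coeff a =
      ({f : Set γ → Prop | ∃ b, ReadOnce A f a b}.ncard : ℚ) := by
  classical
  have h1 : {f : Set γ → Prop | ∃ b, ReadOnce A f a b} =
      ((readOnceFns A).filter fun f => ∃ b, ReadOnce A f a b : Finset (Set γ → Prop)) := by
    ext f
    simp only [Set.mem_ofPred_eq, Finset.coe_filter, mem_readOnceFns]
    exact ⟨fun ⟨b, h⟩ => ⟨⟨a, b, h⟩, b, h⟩, fun h => h.2⟩
  rw [h1, Set.ncard_coe_finset, Finset.card_filter, readOnceGen, Polynomial.finsetSum_coeff,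
    Nat.cast_sum]
  refine Finset.sum_congr rfl fun f hf => ?_
  obtain ⟨a', b', h⟩ := mem_readOnceFns.1 hf
  rw [h.weight_eq he, one_pow, mul_one, Polynomial.coeff_X_pow]
  by_cases haa : a = a'
  · subst haa
    rw [if_pos rfl, if_pos ⟨b', h⟩, Nat.cast_one]
  · rw [if_neg haa, if_neg fun ⟨b, h'⟩ => haa (h'.counts_unique h he).1, Nat.cast_zero]

/-- With the element 0 as root, m + 1 variables remain, and rank a + 1 means a conjunctions. -/
lemma numSeriesParallel_eq_coeff (m a : ℕ) : (numSeriesParallel (m + 2) (a + 1) : ℚ) =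
    (readOnceSeq (Polynomial.X : Polynomial ℚ) 1 m).1.coeff a := by
  have he : (0 : Fin (m + 2)) ∉ Finset.univ.erase (0 : Fin (m + 2)) := Finset.notMem_erase _ _
  have hcard : (Finset.univ.erase (0 : Fin (m + 2))).card = m + 1 := by
    rw [Finset.card_erase_of_mem (Finset.mem_univ _), Finset.card_univ, Fintype.card_fin]
    rfl
  rw [numSeriesParallel_eq_ncard_spSpace (by omega),
    ncard_spSpace_eq_ncard_readOnce (Finset.mem_univ 0), ← coeff_readOnceGen he,
    (readOnceGen_eq_readOnceSeq _ _ _ he (Finset.card_pos.1 (by omega))).1, hcard,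
    Nat.add_sub_cancel]

lemma numSeriesParallel_eq_sum (m a : ℕ) : (numSeriesParallel (m + 2) (a + 1) : ℚ) =
    ∑ k ∈ Finset.range (a + 1), (-1 : ℚ) ^ (k + a) * (assocStirlingFirst (k + a) k : ℚ) *
      (Nat.stirlingSecond (m + 1 + k) (k + a + 1) : ℚ) := by
  have hX := eq_sum_of_recursion (Polynomial.X : Polynomial ℚ)
    (u := fun m => (readOnceSeq (Polynomial.X : Polynomial ℚ) 1 m).1)
    (a := fun m => (readOnceSeq (Polynomial.X : Polynomial ℚ) 1 m).2.1)
    (b := fun m => (readOnceSeq (Polynomial.X : Polynomial ℚ) 1 m).2.2)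
    (fun m => readOnceSeq_fst _ _ m) (fun m => by simpa using readOnceSeq_fst' (Polynomial.X : Polynomial ℚ) 1 m)
    -- Any N above m + 1 is admissible; this one also contains every k up to a.
    (fun m => readOnceSeq_add _ _ m) (N := m + a + 2) (m := m) (by omega)
  rw [numSeriesParallel_eq_coeff, hX, Polynomial.finsetSum_coeff]
  have hterm : ∀ k, (∑ j ∈ Finset.range (m + k + 1), ((-1 : Polynomial ℚ) ^ j *
      (assocStirlingFirst j k : Polynomial ℚ) *
      (Nat.stirlingSecond (m + k + 1) (j + 1) : Polynomial ℚ)) *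
        (Polynomial.X : Polynomial ℚ) ^ (j - k)).coeff a =
      (-1 : ℚ) ^ (k + a) * (assocStirlingFirst (k + a) k : ℚ) *
        (Nat.stirlingSecond (m + 1 + k) (k + a + 1) : ℚ) := by
    intro k
    have hj : ∀ j, (((-1 : Polynomial ℚ) ^ j * (assocStirlingFirst j k : Polynomial ℚ) *
        (Nat.stirlingSecond (m + k + 1) (j + 1) : Polynomial ℚ)) *
          (Polynomial.X : Polynomial ℚ) ^ (j - k)).coeff a =
        if j = k + a then (-1 : ℚ) ^ (k + a) * (assocStirlingFirst (k + a) k : ℚ) *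
          (Nat.stirlingSecond (m + 1 + k) (k + a + 1) : ℚ) else 0 := by
      intro j
      have hC : ((-1 : Polynomial ℚ) ^ j * (assocStirlingFirst j k : Polynomial ℚ) *
          (Nat.stirlingSecond (m + k + 1) (j + 1) : Polynomial ℚ)) = Polynomial.C
            ((-1 : ℚ) ^ j * (assocStirlingFirst j k : ℚ) *
              (Nat.stirlingSecond (m + k + 1) (j + 1) : ℚ)) := by
        simp
      rw [hC, Polynomial.coeff_C_mul_X_pow]
      by_cases hjk : j < k
      · rw [assocStirlingFirst_eq_zero_of_lt (n := j) (by omega), if_neg (by omega : ¬ j = k + a)]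
        simp
      · by_cases h : j = k + a
        · rw [if_pos h, if_pos (by omega), h, Nat.add_right_comm m 1 k]
        · rw [if_neg h, if_neg (by omega)]
    rw [Polynomial.finsetSum_coeff, Finset.sum_congr rfl fun j _ => hj j, Finset.sum_ite_eq']
    -- The index j = k + a leaves the range only when a > m, and then the Stirling number of the
    -- second kind is zero.
    split_ifs with h
    · rfl
    · rw [Finset.mem_range] at h
      rw [Nat.stirlingSecond_eq_zero_of_lt (by omega)]
      simp
  rw [Finset.sum_congr rfl fun k _ => hterm k]
  symm
  refine Finset.sum_subset (Finset.range_subset_range.2 (by omega)) fun k _ hk => ?_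
  rw [Finset.mem_range] at hk
  -- For k > a a derangement of k + a points cannot have k cycles.
  rw [assocStirlingFirst_eq_zero_of_lt (by omega)]
  simp

theorem corollary4p3 (n l : ℕ) (hn : 2 ≤ n) :
    (numSeriesParallel n l : ℤ) =
      ∑ k ∈ Finset.range l,
        (-1 : ℤ) ^ (k + l - 1) * (assocStirlingFirst (k + l - 1) k : ℤ) *
          (Nat.stirlingSecond (n - 1 + k) (k + l) : ℤ) := by
  obtain ⟨m, rfl⟩ := Nat.exists_eq_add_of_le' hn
  cases l with
  | zero => simp [numSeriesParallel_zero hn]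
  | succ a =>
    have h := numSeriesParallel_eq_sum m a
    exact_mod_cast h
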